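/- Let $(M,g)$ be a smooth ($C^\infty$) Riemannian manifold of dimension $n\ge 2$ with Riemannian distance $d_g$, and let $\mathbb D\subset\mathbb C$ be the open unit disc. A *conformal harmonic disc* is a $C^\infty$ map $u:\mathbb D\to M$ such that $u^*g=\lambda\,ds^2$ for some function $\lambda\ge 0$ (singular points, where $du=0$, are allowed) and such that $u$ is harmonic, i.e. in local coordinates of $M$ $$\Delta u^k+\sum_{i,j}\Gamma^k_{ij}(u)\Big(\frac{\partial u^i}{\partial x}\frac{\partial u^j}{\partial x}+\frac{\partial u^i}{\partial y}\frac{\partial u^j}{\partial y}\Big)=0,\qquad k=1,\dots,n;$$ it is called *immersed* if $du$ is injective at every point. An upper semicontinuous function $\rho:W\to[-\infty,+\infty)$ on an open set $W\subset M$ is *MPSH* (minimal plurisubharmonic) on $W$ if $\rho\circ u$ is subharmonic on $\mathbb D$ (the function $\equiv-\infty$ being allowed) for every conformal harmonic immersed disc $u$ with $u(\mathbb D)\subset W$. It is *strictly MPSH* on $W$ if for every $q\in W$ there are normal coordinates $x$ centred at $q$ and $\varepsilon>0$ such that $\rho-\varepsilon|x|^2$ is MPSH in a neighbourhood of $q$.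 **Theorem.** Let $\rho$ be an MPSH function on $M$, let $u:\mathbb D\to M$ be a conformal harmonic disc with $\rho\circ u\ge 0$ on $\mathbb D$, and let $\gamma\subset b\mathbb D$ be an open arc such that $(\rho\circ u)(z)\to 0$ as $z\in\mathbb D$ tends to any point of $\gamma$. Assume that for some $a\in\gamma$ the cluster set $C(u,a)$ of $u$ at $a$ (the set of all limit points in $M$ of $u(z)$ as $z\in\mathbb D$, $z\to a$) contains a point $p\in M$ such that $\rho$ is strictly MPSH on a neighbourhood of $p$. Then $u$ extends to a neighbourhood of $a$ in $\mathbb D\cup\gamma$ as a Hölder-$1/2$ continuous map: there are a neighbourhood $V$ of $a$ in $\mathbb C$, a map $v:V\cap(\mathbb D\cup\gamma)\to M$ with $v=u$ on $V\cap\mathbb D$, and a constant $C\ge 0$ such that $d_g(v(z),v(w))\le C|z-w|^{1/2}$ for all $z,w\in V\cap(\mathbb D\cup\gamma)$. -/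

import Mathlib

open scoped Bundle Manifold ContDiff Topology NNReal

noncomputable section

namespace MinimalDisc

/-- The open unit disc of `ℂ = ℝ²`. -/
def disc : Set ℂ := Metric.ball 0 1

/-- The open arc `{e^{iθ} : α < θ < β}` of the unit circle. -/
def openArc (α β : ℝ) : Set ℂ :=
  (fun θ : ℝ => Complex.exp (θ * Complex.I)) '' Set.Ioo α β

open Laplacian in
/-- Subharmonic functions with values in `[-∞, ∞)` on a set `Ω` (meant to be open) of the plane:
upper semicontinuous, and dominated on each closed disc in `Ω` by every continuous function that
is harmonic inside the disc and dominates on its boundary. The function that is identically `-∞`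
is allowed. -/
structure SubharmonicOn (f : ℂ → EReal) (Ω : Set ℂ) : Prop where
  usc : UpperSemicontinuousOn f Ω
  lt_top : ∀ z ∈ Ω, f z < ⊤
  le_of_le_on_sphere : ∀ (c : ℂ) (r : ℝ), 0 < r → Metric.closedBall c r ⊆ Ω →
    ∀ h : ℂ → ℝ, InnerProductSpace.HarmonicContOnCl h (Metric.ball c r) →
      (∀ z ∈ Metric.sphere c r, f z ≤ (h z : EReal)) →
      ∀ z ∈ Metric.ball c r, f z ≤ (h z : EReal)

section Riemannian

variable {n : ℕ} {M : Type*} [TopologicalSpace M] [ChartedSpace (EuclideanSpace ℝ (Fin n)) M]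
  [IsManifold (𝓡 n) ∞ M] [Bundle.RiemannianBundle (fun x : M => TangentSpace (𝓡 n) x)]

/-- The coordinate vector field `∂/∂xⁱ` of the chart `e`, at the point with coordinates `y`. -/
def coordVec (e : OpenPartialHomeomorph M (EuclideanSpace ℝ (Fin n)))
    (y : EuclideanSpace ℝ (Fin n)) (i : Fin n) : TangentSpace (𝓡 n) (e.symm y) :=
  mfderiv (𝓡 n) (𝓡 n) e.symm y (EuclideanSpace.single i (1 : ℝ) : EuclideanSpace ℝ (Fin n))

/-- The matrix `(g_{ij})` of the Riemannian metric in the chart `e`, as a function of the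
coordinates `y`. -/
def metricMatrix (e : OpenPartialHomeomorph M (EuclideanSpace ℝ (Fin n)))
    (y : EuclideanSpace ℝ (Fin n)) : Matrix (Fin n) (Fin n) ℝ :=
  Matrix.of fun i j => inner ℝ (coordVec e y i) (coordVec e y j)

/-- The partial derivative `∂g_{ij}/∂x^k` in the chart `e`. -/
def metricDeriv (e : OpenPartialHomeomorph M (EuclideanSpace ℝ (Fin n)))
    (y : EuclideanSpace ℝ (Fin n)) (i j k : Fin n) : ℝ :=
  fderiv ℝ (fun y' => metricMatrix e y' i j) y (EuclideanSpace.single k (1 : ℝ))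

/-- The Christoffel symbols `Γ^k_{ij}` of the Levi-Civita connection in the chart `e`. -/
def christoffel (e : OpenPartialHomeomorph M (EuclideanSpace ℝ (Fin n)))
    (y : EuclideanSpace ℝ (Fin n)) (k i j : Fin n) : ℝ :=
  (1 / 2) * ∑ l, (metricMatrix e y)⁻¹ k l *
    (metricDeriv e y j l i + metricDeriv e y i l j - metricDeriv e y i j l)

/-- Normal coordinates centred at `p`: a smooth chart `e` around `p` with `e p = 0`, whose range is
star-shaped about `0`, in which the metric at `p` is the identity matrix and the segments `t ↦ t y`
issuing from `0` are geodesics (`c'' + Γ(c)(c', c') = 0`). -/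
structure IsNormalChart (e : OpenPartialHomeomorph M (EuclideanSpace ℝ (Fin n))) (p : M) :
    Prop where
  mem_atlas : e ∈ IsManifold.maximalAtlas (𝓡 n) ∞ M
  mem_source : p ∈ e.source
  map_center : e p = 0
  starConvex : StarConvex ℝ 0 e.target
  metric_center : metricMatrix e 0 = 1
  geodesic : ∀ y ∈ e.target, ∀ t ∈ Set.Icc (0 : ℝ) 1, ∀ k,
    ∑ i, ∑ j, christoffel e (t • y) k i j * y i * y j = 0

/-- Smooth (weakly) conformal maps of the disc: `u^* g = λ ds²` with a function `λ ≥ 0`. Points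
where `du = 0` are allowed. -/
def IsConformalDisc (u : ℂ → M) : Prop :=
  ContMDiffOn 𝓘(ℝ, ℂ) (𝓡 n) ∞ u disc ∧
  ∀ z ∈ disc, ∃ lam : ℝ, 0 ≤ lam ∧ ∀ v w : ℂ,
    inner ℝ (mfderiv 𝓘(ℝ, ℂ) (𝓡 n) u z v) (mfderiv 𝓘(ℝ, ℂ) (𝓡 n) u z w) = lam * inner ℝ v w

open Laplacian in
/-- Smooth harmonic maps of the disc, through the Euler-Lagrange equations of the energy
`∫ |du|²` in local coordinates:
`Δ u^k + Γ^k_{ij}(u) (∂_x u^i ∂_x u^j + ∂_y u^i ∂_y u^j) = 0`. -/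
def IsHarmonicDisc (u : ℂ → M) : Prop :=
  ContMDiffOn 𝓘(ℝ, ℂ) (𝓡 n) ∞ u disc ∧
  ∀ z ∈ disc, ∀ e ∈ IsManifold.maximalAtlas (𝓡 n) ∞ M, u z ∈ e.source → ∀ k,
    (Δ (fun z' => e (u z')) z) k +
      ∑ i, ∑ j, christoffel e (e (u z)) k i j *
        ((fderiv ℝ (fun z' => e (u z')) z 1) i * (fderiv ℝ (fun z' => e (u z')) z 1) j +
         (fderiv ℝ (fun z' => e (u z')) z Complex.I) i *
           (fderiv ℝ (fun z' => e (u z')) z Complex.I) j) = 0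

/-- Conformal harmonic discs, possibly with singular points. Only the values of `u` on the open
unit disc matter. -/
def IsConformalHarmonicDisc (u : ℂ → M) : Prop :=
  IsConformalDisc (n := n) u ∧ IsHarmonicDisc (n := n) u

/-- Conformal harmonic immersed discs. -/
def IsConformalHarmonicImmersedDisc (u : ℂ → M) : Prop :=
  IsConformalHarmonicDisc (n := n) u ∧
  ∀ z ∈ disc, Function.Injective (mfderiv 𝓘(ℝ, ℂ) (𝓡 n) u z)

variable (n) in
/-- Minimal plurisubharmonic (MPSH) functions on a set `W` (meant to be open) of `M`: upper
semicontinuous, with values in `[-∞, ∞)`, and subharmonic along every conformal harmonic immersed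
disc in `W`. -/
structure MPSHOn (ρ : M → EReal) (W : Set M) : Prop where
  usc : UpperSemicontinuousOn ρ W
  lt_top : ∀ x ∈ W, ρ x < ⊤
  subharmonic : ∀ u : ℂ → M, IsConformalHarmonicImmersedDisc (n := n) u →
    Set.MapsTo u disc W → SubharmonicOn (fun z => ρ (u z)) disc

variable (n) in
/-- `ρ` is strictly MPSH on `W`: at each `q ∈ W` there are normal coordinates `x` centred at `q`
and `ε > 0` such that `ρ - ε |x|²` is MPSH in a neighbourhood of `q`. No differentiability of `ρ`
is required. -/
def StrictlyMPSHOn (ρ : M → EReal) (W : Set M) : Prop :=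
  ∀ q ∈ W, ∃ e : OpenPartialHomeomorph M (EuclideanSpace ℝ (Fin n)), IsNormalChart e q ∧
    ∃ ε : ℝ, 0 < ε ∧ ∃ V : Set M, IsOpen V ∧ q ∈ V ∧ V ⊆ e.source ∧
      MPSHOn n (fun x => ρ x - ((ε * ‖e x‖ ^ 2 : ℝ) : EReal)) V

end Riemannian

end MinimalDisc

end

/-! Let `f` be `u` read in normal coordinates at `p`, and let `d = 1 - |z|`. Everything rests on one
comparison at the scale `d`, made with a logarithmic pole.

Subharmonicity of `ρ ∘ u` is given only along immersed pieces of `u`, so the critical points have to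
be removed. `f` solves `Δf = 𝔅(f)(∂f, ∂f)`, hence `f_x - i f_y` is almost holomorphic, and `-log(Λ -
log |df|²)` has Laplacian bounded below. The critical set is therefore polar
(`locallyPolarAt_of_quadraticSystem`). Either it is the whole disc and `u` is constant, or it has
dense complement; in the second case the upper regularization `rr` of `ρ ∘ u` from this complement
satisfies `Δ rr ≥ 0`, and `Δ rr ≥ ε Δ|f|²` where `u` lies near `p` (`viscAt_regularize`). As `ρ` is
only semicontinuous, these inequalities are tested by smooth functions touching from above.

Since `rr` vanishes on the arc, a quadratic barrier gives `rr ≤ C₀ d` near `a`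
(`le_mul_dist_boundary`).

Conformality makes `log |f - c|`, after a correction by a multiple of `|f - c|`, subharmonic
(`laplacian_poleFn_nonneg`). Take `c = f(z₀)` and `d = 1 - |z₀|`. The function `rr/d + ε - (ε/2d)|f
- c|² + η (log |f - c| - ½ log d)` is subharmonic, because strictness of `ρ` pays for the negative
quadratic term. That term makes the last three summands negative at `|f - c| = 2√d`, so they can be
glued to `0` by a maximum, and it does not matter that `u` may leave the chart. On `|z - z₀| ≤ d/2`
the glued function is bounded above independently of `d`, and it has a pole at `z₀`. Comparison with
`(η/2) log(|z - z₀|/d)` shows that `|f - c| < √d` for `|z - z₀| ≤ κd` and, as `log d` cancels, that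
`|f(z) - f(z₀)| ≤ C |z - z₀|^{1/2}` there (`holder_at_boundary_scale`).

Chains of such discs, radially inwards, across and outwards again, give Hölder-1/2 continuity near
`a` (`HolderAtScale.exists_propagates`). Staying inside the chart is carried along the chains; they
start from one point near `a` whose image is close to `p`, which the cluster hypothesis supplies.
The map then extends to the arc by completeness. -/

namespace MinimalDisc

/-! ### Second order calculus in the plane and test functions for subharmonicity -/

section PlaneCalculus

open Laplacian Filter

variable {E F G : Type*} [NormedAddCommGroup E] [NormedSpace ℝ E] [NormedAddCommGroup F]
  [NormedSpace ℝ F] [NormedAddCommGroup G] [NormedSpace ℝ G]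

/-- The derivative of `f` in the direction `v`. -/
noncomputable def dirD (v : ℂ) (f : ℂ → E) (z : ℂ) : E := fderiv ℝ f z v

lemma dirD_congr {v : ℂ} {f g : ℂ → E} {z : ℂ} (h : f =ᶠ[𝓝 z] g) : dirD v f z = dirD v g z := by
  unfold dirD; rw [h.fderiv_eq]

lemma contDiffAt_dirD {v : ℂ} {f : ℂ → E} {z : ℂ} {m n : ℕ∞ω} (hf : ContDiffAt ℝ n f z)
    (hmn : m + 1 ≤ n) : ContDiffAt ℝ m (dirD v f) z :=
  (hf.fderiv_right hmn).clm_apply contDiffAt_const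

lemma dirD_dirD {v w : ℂ} {f : ℂ → E} {z : ℂ} (hf : ContDiffAt ℝ 2 f z) :
    dirD v (dirD w f) z = fderiv ℝ (fderiv ℝ f) z v w := by
  have h1 : DifferentiableAt ℝ (fderiv ℝ f) z :=
    (hf.fderiv_right (m := 1) (by norm_num)).differentiableAt (by norm_num)
  unfold dirD
  rw [fderiv_clm_apply h1 (differentiableAt_const w)]
  simp

lemma dirD_comm {v w : ℂ} {f : ℂ → E} {z : ℂ} (hf : ContDiffAt ℝ 2 f z) :
    dirD v (dirD w f) z = dirD w (dirD v f) z := by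
  rw [dirD_dirD hf, dirD_dirD hf]
  exact (hf.isSymmSndFDerivAt (by simp)).eq v w

lemma laplacian_eq_dirD {f : ℂ → E} {z : ℂ} (hf : ContDiffAt ℝ 2 f z) :
    (Δ f) z = dirD 1 (dirD 1 f) z + dirD Complex.I (dirD Complex.I f) z := by
  rw [InnerProductSpace.laplacian_eq_iteratedFDeriv_complexPlane, dirD_dirD hf, dirD_dirD hf]
  simp [iteratedFDeriv_two_apply]

lemma dirD_add {v : ℂ} {f g : ℂ → E} {z : ℂ} (hf : DifferentiableAt ℝ f z)
    (hg : DifferentiableAt ℝ g z) :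
    dirD v (fun w => f w + g w) z = dirD v f z + dirD v g z := by
  unfold dirD; rw [fderiv_fun_add hf hg]; simp

lemma dirD_bilin (b : E →L[ℝ] F →L[ℝ] G) {v : ℂ} {f : ℂ → E} {g : ℂ → F} {z : ℂ}
    (hf : DifferentiableAt ℝ f z) (hg : DifferentiableAt ℝ g z) :
    dirD v (fun w => b (f w) (g w)) z = b (dirD v f z) (g z) + b (f z) (dirD v g z) := by
  unfold dirD
  rw [b.fderiv_of_bilinear hf hg]
  simp [add_comm]

lemma dirD_dirD_bilin (b : E →L[ℝ] F →L[ℝ] G) {v : ℂ} {f : ℂ → E} {g : ℂ → F} {z : ℂ}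
    (hf : ContDiffAt ℝ 2 f z) (hg : ContDiffAt ℝ 2 g z) :
    dirD v (dirD v (fun w => b (f w) (g w))) z =
      b (dirD v (dirD v f) z) (g z) + (2 : ℝ) • b (dirD v f z) (dirD v g z) +
        b (f z) (dirD v (dirD v g) z) := by
  have ev : dirD v (fun w => b (f w) (g w)) =ᶠ[𝓝 z]
      fun w => b (dirD v f w) (g w) + b (f w) (dirD v g w) := by
    filter_upwards [hf.eventually (by simp), hg.eventually (by simp)] with w hw1 hw2
    exact dirD_bilin b (hw1.differentiableAt (by norm_num)) (hw2.differentiableAt (by norm_num))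
  have f1 := hf.differentiableAt (by norm_num)
  have g1 := hg.differentiableAt (by norm_num)
  have f2 : DifferentiableAt ℝ (dirD v f) z :=
    (contDiffAt_dirD (m := 1) hf (by norm_num)).differentiableAt (by norm_num)
  have g2 : DifferentiableAt ℝ (dirD v g) z :=
    (contDiffAt_dirD (m := 1) hg (by norm_num)).differentiableAt (by norm_num)
  have b1 : DifferentiableAt ℝ (fun w => b (dirD v f w) (g w)) z :=
    ((b.differentiableAt.comp z f2).clm_apply g1)
  have b2 : DifferentiableAt ℝ (fun w => b (f w) (dirD v g w)) z :=
    ((b.differentiableAt.comp z f1).clm_apply g2)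
  rw [dirD_congr ev, dirD_add b1 b2, dirD_bilin b f2 g1, dirD_bilin b f1 g2, two_smul]
  abel

lemma contDiffAt_bilin (b : E →L[ℝ] F →L[ℝ] G) {f : ℂ → E} {g : ℂ → F} {z : ℂ} {n : ℕ∞ω}
    (hf : ContDiffAt ℝ n f z) (hg : ContDiffAt ℝ n g z) :
    ContDiffAt ℝ n (fun w => b (f w) (g w)) z :=
  (b.contDiff.contDiffAt.comp z hf).clm_apply hg

/-- The Laplacian of a bilinear expression. -/
lemma laplacian_bilin (b : E →L[ℝ] F →L[ℝ] G) {f : ℂ → E} {g : ℂ → F} {z : ℂ}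
    (hf : ContDiffAt ℝ 2 f z) (hg : ContDiffAt ℝ 2 g z) :
    (Δ (fun w => b (f w) (g w))) z = b ((Δ f) z) (g z) +
      (2 : ℝ) • (b (dirD 1 f z) (dirD 1 g z) + b (dirD Complex.I f z) (dirD Complex.I g z)) +
        b (f z) ((Δ g) z) := by
  rw [laplacian_eq_dirD (contDiffAt_bilin b hf hg), laplacian_eq_dirD hf, laplacian_eq_dirD hg,
    dirD_dirD_bilin b hf hg, dirD_dirD_bilin b hf hg]
  simp only [map_add, _root_.add_apply, smul_add]
  abel

lemma dirD_comp_real {H : ℝ → ℝ} {H' : ℝ} {v : ℂ} {q : ℂ → ℝ} {z : ℂ}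
    (hH : HasDerivAt H H' (q z)) (hq : DifferentiableAt ℝ q z) :
    dirD v (fun w => H (q w)) z = H' * dirD v q z := by
  have := (hH.comp_hasFDerivAt z hq.hasFDerivAt).fderiv
  unfold dirD
  change fderiv ℝ (H ∘ q) z v = _
  rw [this]; simp

lemma dirD_dirD_comp_real {H H' : ℝ → ℝ} {H'' : ℝ} {v : ℂ} {q : ℂ → ℝ} {z : ℂ}
    (hH : ∀ᶠ t in 𝓝 (q z), HasDerivAt H (H' t) t) (hH' : HasDerivAt H' H'' (q z))
    (hq : ContDiffAt ℝ 2 q z) :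
    dirD v (dirD v (fun w => H (q w))) z =
      H'' * (dirD v q z) ^ 2 + H' (q z) * dirD v (dirD v q) z := by
  have ev : dirD v (fun w => H (q w)) =ᶠ[𝓝 z] fun w => H' (q w) * dirD v q w := by
    filter_upwards [hq.continuousAt.eventually hH, hq.eventually (by simp)] with w hw1 hw2
    exact dirD_comp_real hw1 (hw2.differentiableAt (by norm_num))
  have q1 := hq.differentiableAt (by norm_num)
  have q2 : DifferentiableAt ℝ (dirD v q) z :=
    (contDiffAt_dirD (m := 1) hq (by norm_num)).differentiableAt (by norm_num)
  have h1 : DifferentiableAt ℝ (fun w => H' (q w)) z := hH'.differentiableAt.comp z q1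
  rw [dirD_congr ev]
  have := dirD_bilin (ContinuousLinearMap.mul ℝ ℝ) (v := v) h1 q2
  simp only [ContinuousLinearMap.mul_apply'] at this
  rw [this, dirD_comp_real hH' q1]
  ring

/-- The Laplacian of a function of a function. -/
lemma laplacian_comp_real {H H' : ℝ → ℝ} {H'' : ℝ} {q : ℂ → ℝ} {z : ℂ}
    (hc : ContDiffAt ℝ 2 H (q z))
    (hH : ∀ᶠ t in 𝓝 (q z), HasDerivAt H (H' t) t) (hH' : HasDerivAt H' H'' (q z))
    (hq : ContDiffAt ℝ 2 q z) :
    (Δ (fun w => H (q w))) z =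
      H'' * ((dirD 1 q z) ^ 2 + (dirD Complex.I q z) ^ 2) + H' (q z) * (Δ q) z := by
  have hcq : ContDiffAt ℝ 2 (fun w => H (q w)) z := hc.comp z hq
  rw [laplacian_eq_dirD hcq, laplacian_eq_dirD hq]
  rw [dirD_dirD_comp_real hH hH' hq, dirD_dirD_comp_real hH hH' hq]
  ring

/-- A positive second derivative along a line would make the maximum a local minimum as well, so the
restriction would be locally constant and its second derivative zero. -/
lemma dirD_dirD_nonpos {φ : ℂ → ℝ} {z v : ℂ} (hφ : ContDiffAt ℝ 2 φ z) (h : IsLocalMax φ z) :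
    dirD v (dirD v φ) z ≤ 0 := by
  by_contra! hpos
  let γ : ℝ → ℂ := fun t => z + t • v
  have hγ0 : γ 0 = z := by simp [γ]
  have hγc : Continuous γ := by fun_prop
  have hγd : ∀ t, HasDerivAt γ v t := fun t => by
    simpa [γ] using ((hasDerivAt_id t).smul_const v).const_add z
  have ev0 : ∀ᶠ t in 𝓝 (0 : ℝ), ContDiffAt ℝ 2 φ (γ t) := by
    apply (hγc.continuousAt (x := 0)).eventually
    rw [hγ0]; exact hφ.eventually (by simp)
  have d1 : deriv (fun t => φ (γ t)) =ᶠ[𝓝 0] fun t => dirD v φ (γ t) := by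
    filter_upwards [ev0] with t ht
    exact ((ht.differentiableAt (by norm_num)).hasFDerivAt.comp_hasDerivAt t (hγd t)).deriv
  have d2 : deriv (deriv (fun t => φ (γ t))) 0 = dirD v (dirD v φ) z := by
    rw [d1.deriv_eq]
    have hd : DifferentiableAt ℝ (dirD v φ) (γ 0) := by
      rw [hγ0]
      exact (contDiffAt_dirD (m := 1) hφ (by norm_num)).differentiableAt (by norm_num)
    have := (hd.hasFDerivAt.comp_hasDerivAt 0 (hγd 0)).deriv
    rw [hγ0] at this
    exact this
  have hmax : IsLocalMax (fun t => φ (γ t)) 0 := by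
    have : Tendsto γ (𝓝 0) (𝓝 z) := by simpa [hγ0] using hγc.tendsto 0
    have := this.eventually h
    simpa [IsLocalMax, IsMaxFilter, hγ0] using this
  have hmin : IsLocalMin (fun t => φ (γ t)) 0 := by
    refine isLocalMin_of_deriv_deriv_pos (by rw [d2]; exact hpos) hmax.deriv_eq_zero ?_
    exact ContinuousAt.comp (by rw [hγ0]; exact hφ.continuousAt) hγc.continuousAt
  have hconst : (fun t => φ (γ t)) =ᶠ[𝓝 0] fun _ => φ (γ 0) := by
    filter_upwards [hmax, hmin] with t h1 h2 using le_antisymm h1 h2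
  have : deriv (deriv (fun t => φ (γ t))) 0 = 0 := by
    have h1 := hconst.deriv
    rw [h1.deriv_eq]
    simp
  linarith

/-- At an interior maximum the Laplacian is nonpositive. -/
lemma laplacian_nonpos_of_isLocalMax {φ : ℂ → ℝ} {z : ℂ} (hφ : ContDiffAt ℝ 2 φ z)
    (h : IsLocalMax φ z) : (Δ φ) z ≤ 0 := by
  rw [laplacian_eq_dirD hφ]
  exact add_nonpos (dirD_dirD_nonpos hφ h) (dirD_dirD_nonpos hφ h)

/-- Second order Taylor expansion. -/
lemma taylor_two {φ : ℂ → ℝ} {z : ℂ} (hφ : ContDiffAt ℝ 2 φ z) {η : ℝ} (hη : 0 < η) :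
    ∀ᶠ w in 𝓝 (0 : ℂ), |φ (z + w) - φ z - fderiv ℝ φ z w -
      (1 / 2) * fderiv ℝ (fderiv ℝ φ) z w w| ≤ η * ‖w‖ ^ 2 := by
  set B := fderiv ℝ (fderiv ℝ φ) z with hB
  have hsymm : ∀ v w, B v w = B w v := (hφ.isSymmSndFDerivAt (by simp)).eq
  have hd : DifferentiableAt ℝ (fderiv ℝ φ) z :=
    (hφ.fderiv_right (m := 1) (by norm_num)).differentiableAt (by norm_num)
  have h1 := (hasFDerivAt_iff_isLittleO_nhds_zero.1 hd.hasFDerivAt).def hη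
  have h2 : ∀ᶠ w in 𝓝 (0 : ℂ), ContDiffAt ℝ 2 φ (z + w) := by
    have hc : Tendsto (fun w => z + w) (𝓝 (0 : ℂ)) (𝓝 z) := by
      simpa using (continuous_const_add z).tendsto 0
    exact hc.eventually (hφ.eventually (by simp))
  obtain ⟨δ, hδ, hball⟩ := Metric.eventually_nhds_iff_ball.1 (h1.and h2)
  filter_upwards [Metric.ball_mem_nhds (0 : ℂ) hδ] with w hw
  -- The Taylor remainder has derivative `R'`, by symmetry of the second derivative, and `R'` is
  -- `o(‖w‖)`; the mean value inequality on the segment finishes.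
  let R : ℂ → ℝ := fun w => φ (z + w) - φ z - fderiv ℝ φ z w - (1 / 2) * B w w
  let R' : ℂ → ℂ →L[ℝ] ℝ := fun y => fderiv ℝ φ (z + y) - fderiv ℝ φ z - B y
  have hR : ∀ y ∈ Metric.ball (0 : ℂ) δ, HasFDerivAt R (R' y) y := by
    intro y hy
    have e1 : HasFDerivAt (fun y => φ (z + y)) (fderiv ℝ φ (z + y)) y := by
      have := ((hball y hy).2.differentiableAt (by norm_num)).hasFDerivAt
      exact this.comp y ((hasFDerivAt_id y).const_add z)
    have e2 : HasFDerivAt (fun y => B y y) _ y := B.hasFDerivAt_of_bilinear (hasFDerivAt_id y)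
      (hasFDerivAt_id y)
    have := ((e1.sub_const (φ z)).sub (fderiv ℝ φ z).hasFDerivAt).sub (e2.const_mul (1 / 2 : ℝ))
    refine this.congr_fderiv ?_
    ext v
    simp [R', hsymm v y]
    ring
  have hseg : ∀ y ∈ segment ℝ 0 w, y ∈ Metric.ball (0 : ℂ) δ := fun y hy =>
    (convex_ball (0 : ℂ) δ).segment_subset (Metric.mem_ball_self hδ) hw hy
  have hle : ∀ y ∈ segment ℝ 0 w, ‖R' y‖ ≤ η * ‖w‖ := by
    intro y hy
    refine ((hball y (hseg y hy)).1).trans ?_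
    gcongr
    obtain ⟨t, ht, rfl⟩ := (segment_eq_image ℝ (0 : ℂ) w) ▸ hy
    simp only [smul_zero, zero_add, norm_smul, Real.norm_eq_abs, abs_of_nonneg ht.1]
    nlinarith [norm_nonneg w, ht.2]
  have key := (convex_segment (𝕜 := ℝ) (0 : ℂ) w).norm_image_sub_le_of_norm_hasFDerivWithin_le
    (f := R) (fun y hy => (hR y (hseg y hy)).hasFDerivWithinAt) hle (left_mem_segment ℝ 0 w)
    (right_mem_segment ℝ 0 w)
  have hR0 : R 0 = 0 := by simp [R]
  rw [hR0, sub_zero, sub_zero, Real.norm_eq_abs] at key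
  calc |R w| ≤ η * ‖w‖ * ‖w‖ := key
    _ = η * ‖w‖ ^ 2 := by ring

lemma laplacian_fun_add {f g : ℂ → E} {z : ℂ} (hf : ContDiffAt ℝ 2 f z)
    (hg : ContDiffAt ℝ 2 g z) : (Δ (fun w => f w + g w)) z = (Δ f) z + (Δ g) z :=
  hf.laplacian_add hg

lemma laplacian_fun_sub {f g : ℂ → E} {z : ℂ} (hf : ContDiffAt ℝ 2 f z)
    (hg : ContDiffAt ℝ 2 g z) : (Δ (fun w => f w - g w)) z = (Δ f) z - (Δ g) z :=
  hf.laplacian_sub hg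

lemma laplacian_const_mul {f : ℂ → ℝ} {z : ℂ} (c : ℝ) (hf : ContDiffAt ℝ 2 f z) :
    (Δ (fun w => c * f w)) z = c * (Δ f) z :=
  InnerProductSpace.laplacian_smul c hf

lemma laplacian_fun_const (c : E) (z : ℂ) : (Δ (fun _ : ℂ => c)) z = 0 := by
  have := congrFun (InnerProductSpace.laplacian_const (E := ℂ) (c := c)) z
  exact this

/-- The inner product of a real inner product space as a bilinear map. -/
noncomputable def innerBilin (V : Type*) [NormedAddCommGroup V] [InnerProductSpace ℝ V] :
    V →L[ℝ] V →L[ℝ] ℝ :=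
  LinearMap.mkContinuous₂ (innerₗ V) 1 fun x y => by
    simpa using abs_real_inner_le_norm x y

lemma innerBilin_apply {V : Type*} [NormedAddCommGroup V] [InnerProductSpace ℝ V] (x y : V) :
    innerBilin V x y = inner ℝ x y := by
  simp [innerBilin]

lemma innerBilin_self {V : Type*} [NormedAddCommGroup V] [InnerProductSpace ℝ V] (x : V) :
    innerBilin V x x = ‖x‖ ^ 2 := by
  rw [innerBilin_apply, real_inner_self_eq_norm_sq]

lemma dirD_id (v z : ℂ) : dirD v (fun w : ℂ => w) z = v := by
  unfold dirD; simp

lemma laplacian_quadratic (b : ℂ →L[ℝ] ℂ →L[ℝ] ℝ) (z : ℂ) :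
    (Δ (fun w => b w w)) z = 2 * (b 1 1 + b Complex.I Complex.I) := by
  have hid : ContDiffAt ℝ 2 (fun w : ℂ => w) z := contDiffAt_id
  have h0 : (Δ (fun w : ℂ => w)) z = 0 := by
    have : ∀ v : ℂ, dirD v (dirD v (fun w : ℂ => w)) z = 0 := fun v => by
      have : dirD v (fun w : ℂ => w) = fun _ => v := funext (dirD_id v)
      rw [this]; simp [dirD]
    rw [laplacian_eq_dirD hid, this, this, add_zero]
  rw [laplacian_bilin b hid hid, h0]
  simp [dirD_id]

lemma laplacian_clm (ℓ : ℂ →L[ℝ] ℝ) (z : ℂ) : (Δ (fun w => ℓ w)) z = 0 := by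
  have : ∀ v : ℂ, dirD v (dirD v (fun w : ℂ => ℓ w)) z = 0 := fun v => by
    have : dirD v (fun w : ℂ => ℓ w) = fun _ => ℓ v := funext fun z => by simp [dirD]
    rw [this]; simp [dirD]
  rw [laplacian_eq_dirD ℓ.contDiff.contDiffAt, this, this, add_zero]

/-- A subharmonic function satisfies the differential inequality `Δ ≥ 0` in the sense of test
functions touching it from above. -/
lemma SubharmonicOn.laplacian_nonneg_of_touching {g : ℂ → EReal} {G φ : ℂ → ℝ}
    (hg : SubharmonicOn g disc) (hG : ∀ᶠ z in 𝓝 (0 : ℂ), g z = (G z : EReal))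
    (hφ : ContDiffAt ℝ 2 φ 0) (hmax : IsLocalMax (fun z => G z - φ z) 0) : 0 ≤ (Δ φ) 0 := by
  by_contra! hneg
  set c := (Δ φ) 0 with hc
  set B := fderiv ℝ (fderiv ℝ φ) 0 with hB
  have hcB : c = B 1 1 + B Complex.I Complex.I := by
    rw [hc, laplacian_eq_dirD hφ, dirD_dirD hφ, dirD_dirD hφ]
  have ht := taylor_two hφ (η := -c / 8) (by linarith)
  have hdisc : disc ∈ 𝓝 (0 : ℂ) := Metric.ball_mem_nhds 0 one_pos
  obtain ⟨δ, hδ, hball⟩ := Metric.eventually_nhds_iff_ball.1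
    (((ht.and hG).and hmax).and hdisc)
  set r := δ / 2 with hr
  have hr0 : 0 < r := by positivity
  have hsub : Metric.closedBall (0 : ℂ) r ⊆ Metric.ball 0 δ :=
    Metric.closedBall_subset_ball (by linarith)
  -- With `c = Δφ(0) < 0`, subtracting `(c/4)|w|²` makes the Taylor quadratic trace free, hence
  -- harmonic, and raises it by `-(c/4) r²` on the circle. The Taylor error uses up half of this;
  -- the other half allows the constant `G 0 + (c/8) r²`, so `h` dominates on the circle but lies
  -- below `G 0` at the centre.
  let b : ℂ →L[ℝ] ℂ →L[ℝ] ℝ := (1 / 2 : ℝ) • B - (c / 4) • innerBilin ℂ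
  let h : ℂ → ℝ := fun w => (G 0 + c / 8 * r ^ 2) + (fderiv ℝ φ 0 w + b w w)
  have hb : ∀ w, b w w = (1 / 2) * B w w - c / 4 * ‖w‖ ^ 2 := fun w => by
    simp [b, innerBilin_self]
  have hbc : ContDiff ℝ 2 (fun w => b w w) :=
    contDiff_iff_contDiffAt.2 fun z => contDiffAt_bilin b contDiffAt_id contDiffAt_id
  have hlap : ∀ z, (Δ h) z = 0 := by
    intro z
    have h1 : (Δ (fun w => b w w)) z = 0 := by
      rw [laplacian_quadratic, hb, hb]
      simp; linarith
    have c1 : ContDiffAt ℝ 2 (fun w => fderiv ℝ φ 0 w) z := (fderiv ℝ φ 0).contDiff.contDiffAt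
    rw [laplacian_fun_add contDiffAt_const (c1.add hbc.contDiffAt),
      laplacian_fun_add c1 hbc.contDiffAt, laplacian_fun_const, h1, laplacian_clm]
    simp
  have hhc : ContDiff ℝ 2 h := contDiff_const.add ((fderiv ℝ φ 0).contDiff.add hbc)
  have hharm : InnerProductSpace.HarmonicContOnCl h (Metric.ball 0 r) :=
    ⟨fun z _ => ⟨hhc.contDiffAt, Filter.Eventually.of_forall hlap⟩, hhc.continuous.continuousOn⟩
  have key := hg.le_of_le_on_sphere 0 r hr0 (fun z hz => (hball z (hsub hz)).2) h hharm ?_ 0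
    (Metric.mem_ball_self hr0)
  · rw [(hball 0 (Metric.mem_ball_self hδ)).1.1.2, EReal.coe_le_coe_iff] at key
    simp [h] at key
    nlinarith [pow_pos hr0 2]
  · intro z hz
    obtain ⟨⟨⟨h1, h2⟩, h3⟩, -⟩ := hball z (hsub (Metric.sphere_subset_closedBall hz))
    rw [h2, EReal.coe_le_coe_iff]
    have hz' : ‖z‖ = r := by simpa using hz
    rw [zero_add, hz'] at h1
    have := (abs_le.1 h1).2
    simp only [h, hb, hz']
    simp only at h3
    linarith

end PlaneCalculus


/-! ### Polar sets: unique continuation and removability -/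

section Polar

open Laplacian Filter

variable {Y : Type*} [NormedAddCommGroup Y] [InnerProductSpace ℝ Y]

lemma contDiffAt_normSq {f : ℂ → Y} {z : ℂ} {n : ℕ∞ω} (hf : ContDiffAt ℝ n f z) :
    ContDiffAt ℝ n (fun w => ‖f w‖ ^ 2) z := by
  simp only [← innerBilin_self]
  exact contDiffAt_bilin _ hf hf

lemma dirD_normSq {f : ℂ → Y} {z v : ℂ} (hf : DifferentiableAt ℝ f z) :
    dirD v (fun w => ‖f w‖ ^ 2) z = 2 * inner ℝ (dirD v f z) (f z) := by
  simp only [← innerBilin_self]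
  rw [dirD_bilin _ hf hf]
  simp only [innerBilin_apply]
  rw [real_inner_comm (f z)]; ring

lemma laplacian_normSq {f : ℂ → Y} {z : ℂ} (hf : ContDiffAt ℝ 2 f z) :
    (Δ (fun w => ‖f w‖ ^ 2)) z = 2 * inner ℝ ((Δ f) z) (f z) +
      2 * (‖dirD 1 f z‖ ^ 2 + ‖dirD Complex.I f z‖ ^ 2) := by
  have e : (fun w => ‖f w‖ ^ 2) = fun w => innerBilin Y (f w) (f w) := by
    ext w; rw [innerBilin_self]
  rw [e, laplacian_bilin _ hf hf]
  simp only [innerBilin_apply, smul_eq_mul, real_inner_self_eq_norm_sq]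
  rw [real_inner_comm (f z)]; ring

lemma dirD_sub_const {v c z : ℂ} : dirD v (fun w : ℂ => w - c) z = v := by
  unfold dirD; rw [fderiv_sub_const]; simp

lemma laplacian_sub_const {c z : ℂ} : (Δ (fun w : ℂ => w - c)) z = 0 := by
  have : ∀ v : ℂ, dirD v (dirD v (fun w : ℂ => w - c)) z = 0 := fun v => by
    have : dirD v (fun w : ℂ => w - c) = fun _ => v := funext fun _ => dirD_sub_const
    rw [this]; simp [dirD]
  rw [laplacian_eq_dirD (by fun_prop), this, this, add_zero]

lemma laplacian_normSq_sub (c z : ℂ) : (Δ (fun w : ℂ => ‖w - c‖ ^ 2)) z = 4 := by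
  rw [laplacian_normSq (by fun_prop), laplacian_sub_const]
  simp [dirD_sub_const]; norm_num

lemma contDiffAt_normSq_sub (c z : ℂ) {n : ℕ∞ω} : ContDiffAt ℝ n (fun w : ℂ => ‖w - c‖ ^ 2) z :=
  contDiffAt_normSq (by fun_prop)

lemma grad_normSq_sub (c z : ℂ) : (dirD 1 (fun w : ℂ => ‖w - c‖ ^ 2) z) ^ 2 +
    (dirD Complex.I (fun w : ℂ => ‖w - c‖ ^ 2) z) ^ 2 = 4 * ‖z - c‖ ^ 2 := by
  rw [dirD_normSq (by fun_prop), dirD_normSq (by fun_prop), dirD_sub_const, dirD_sub_const,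
    Complex.sq_norm, Complex.normSq_apply]
  simp [Complex.inner]
  ring

lemma contDiffAt_log_norm_sub {c z : ℂ} (h : z ≠ c) :
    ContDiffAt ℝ 2 (fun w : ℂ => Real.log (‖w - c‖ ^ 2)) z :=
  (contDiffAt_normSq_sub c z).log (by simpa [sub_eq_zero] using h)

lemma laplacian_log_norm_sub {c z : ℂ} (h : z ≠ c) :
    (Δ (fun w : ℂ => Real.log (‖w - c‖ ^ 2))) z = 0 := by
  have hpos : 0 < ‖z - c‖ ^ 2 := by
    have := norm_pos_iff.2 (sub_ne_zero.2 h); positivity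
  have h1 : ∀ᶠ t in 𝓝 (‖z - c‖ ^ 2), HasDerivAt Real.log (t⁻¹) t := by
    filter_upwards [lt_mem_nhds hpos] with t ht using Real.hasDerivAt_log ht.ne'
  rw [laplacian_comp_real (H := Real.log) (H' := fun t => t⁻¹) (Real.contDiffAt_log.2 hpos.ne')
    h1 (hasDerivAt_inv hpos.ne') (contDiffAt_normSq_sub c z), laplacian_normSq_sub,
    grad_normSq_sub]
  field_simp
  ring

/-- `S` is polar near `z`, in a quantitative form: there are functions with Laplacian bounded below
that are as negative as we please on `S` and stay bounded at each point outside `S`. -/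
def LocallyPolarAt (S : Set ℂ) (z : ℂ) : Prop :=
  ∃ R > 0, ∃ (L : ℝ → ℂ → ℝ) (C : ℝ),
    (∀ τ ∈ Set.Ioc (0 : ℝ) 1, ∀ w ∈ Metric.ball z R,
      ContDiffAt ℝ 2 (L τ) w ∧ -C ≤ (Δ (L τ)) w ∧ L τ w ≤ 0) ∧
    (∀ b : ℝ, ∃ τ ∈ Set.Ioc (0 : ℝ) 1, ∀ w ∈ Metric.ball z R, w ∈ S → L τ w ≤ b) ∧
    (∀ w ∈ Metric.ball z R, w ∉ S → ∃ c : ℝ, ∀ τ ∈ Set.Ioc (0 : ℝ) 1, c ≤ L τ w)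

/-- Unique continuation across points where a set with interior is locally polar. -/
lemma LocallyPolarAt.mem_nhds {S : Set ℂ} {z₁ : ℂ} (h : LocallyPolarAt S z₁)
    (hz : z₁ ∈ closure (interior S)) : S ∈ 𝓝 z₁ := by
  obtain ⟨R, hR, L, C, h1, h2, h3⟩ := h
  obtain ⟨w₀, hw₀, hdist⟩ := Metric.mem_closure_iff.1 hz (R / 4) (by positivity)
  obtain ⟨s', hs', hball⟩ := Metric.isOpen_iff.1 isOpen_interior w₀ hw₀
  refine Filter.mem_of_superset (Metric.isOpen_ball.mem_nhds
    (show z₁ ∈ Metric.ball w₀ (R / 2) by rw [Metric.mem_ball]; linarith)) ?_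
  intro z₂ hz₂
  by_contra hS
  set ρ := R / 2 with hρ
  set s := min (s' / 2) (ρ / 2) with hs
  have hs0 : 0 < s := by positivity
  have hsS : ∀ z, ‖z - w₀‖ ≤ s → z ∈ S := fun z hz => by
    apply interior_subset (hball _)
    rw [Metric.mem_ball, dist_eq_norm]
    have := min_le_left (s' / 2) (ρ / 2)
    linarith
  have hsub : ∀ z, ‖z - w₀‖ ≤ ρ → z ∈ Metric.ball z₁ R := fun z hz => by
    rw [Metric.mem_ball]
    have := dist_triangle z w₀ z₁
    rw [dist_eq_norm z w₀] at this
    rw [dist_comm] at hdist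
    linarith
  have hz₂ρ : ‖z₂ - w₀‖ < ρ := by rwa [Metric.mem_ball, dist_eq_norm] at hz₂
  have hz₂s : s < ‖z₂ - w₀‖ := by
    by_contra! hle; exact hS (hsS z₂ hle)
  obtain ⟨c, hc⟩ := h3 z₂ (hsub z₂ hz₂ρ.le) hS
  -- A Hopf type argument on the annulus `s ≤ |z - w₀| ≤ ρ`, whose inner circle lies in `S`. The
  -- term `κ|z - w₀|²` has Laplacian `|C| + 1`, which makes the Laplacian of `Φ` positive and
  -- excludes an interior maximum.
  set κ := (|C| + 1) / 4 with hκ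
  have hκ0 : 0 < κ := by positivity
  have hlog2 : Real.log (‖z₂ - w₀‖ ^ 2) < Real.log (ρ ^ 2) := by
    apply Real.log_lt_log (by have := hs0.trans hz₂s; positivity)
    have := hs0.trans hz₂s
    gcongr
  -- `A` makes the value at `z₂` exceed that on the outer circle, where `L ≤ 0`. Only then is `τ`
  -- chosen, so that the value exceeds that on the inner circle; the lower bound `c` at `z₂` holds
  -- for all `τ`.
  obtain ⟨A, hA⟩ : ∃ A : ℝ, κ * ρ ^ 2 - c <
      A * (Real.log (ρ ^ 2) - Real.log (‖z₂ - w₀‖ ^ 2)) := by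
    refine ⟨(κ * ρ ^ 2 - c + 1) / (Real.log (ρ ^ 2) - Real.log (‖z₂ - w₀‖ ^ 2)), ?_⟩
    rw [div_mul_cancel₀ _ (by linarith)]
    linarith
  obtain ⟨τ, hτ, hτS⟩ := h2 (c - A * Real.log (‖z₂ - w₀‖ ^ 2) - κ * ρ ^ 2 +
    A * Real.log (s ^ 2) - 1)
  let Φ : ℂ → ℝ := fun z => (L τ z + κ * ‖z - w₀‖ ^ 2) - A * Real.log (‖z - w₀‖ ^ 2)
  let K : Set ℂ := {z | s ≤ ‖z - w₀‖} ∩ Metric.closedBall w₀ ρ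
  have hKc : IsCompact K := (isCompact_closedBall w₀ ρ).inter_left
    (isClosed_le continuous_const (by fun_prop))
  have hne : ∀ z ∈ K, z ≠ w₀ := fun z hz heq => by
    have : s ≤ ‖z - w₀‖ := hz.1
    rw [heq, sub_self, norm_zero] at this
    linarith
  have hKb : ∀ z ∈ K, ‖z - w₀‖ ≤ ρ := fun z hz => by
    simpa [dist_eq_norm] using hz.2
  have c1 : ∀ z ∈ K, ContDiffAt ℝ 2 (fun z => L τ z + κ * ‖z - w₀‖ ^ 2) z := fun z hz =>
    (h1 τ hτ z (hsub z (hKb z hz))).1.add (contDiffAt_const.mul (contDiffAt_normSq_sub w₀ z))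
  have c2 : ∀ z ∈ K, ContDiffAt ℝ 2 (fun z => A * Real.log (‖z - w₀‖ ^ 2)) z := fun z hz =>
    contDiffAt_const.mul (contDiffAt_log_norm_sub (hne z hz))
  have hz₂K : z₂ ∈ K := ⟨hz₂s.le, by simpa [dist_eq_norm] using hz₂ρ.le⟩
  obtain ⟨z₃, hz₃, hmax⟩ := hKc.exists_isMaxOn ⟨z₂, hz₂K⟩
    (fun z hz => ((c1 z hz).sub (c2 z hz)).continuousAt.continuousWithinAt : ContinuousOn Φ K)
  have hval : c - A * Real.log (‖z₂ - w₀‖ ^ 2) ≤ Φ z₃ := by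
    refine le_trans ?_ (hmax hz₂K)
    have := hc τ hτ
    change _ ≤ (L τ z₂ + κ * ‖z₂ - w₀‖ ^ 2) - A * Real.log (‖z₂ - w₀‖ ^ 2)
    nlinarith [sq_nonneg ‖z₂ - w₀‖]
  have hLle := (h1 τ hτ z₃ (hsub z₃ (hKb z₃ hz₃))).2.2
  have hκle : κ * ‖z₃ - w₀‖ ^ 2 ≤ κ * ρ ^ 2 := by
    have := hKb z₃ hz₃; gcongr
  rcases eq_or_lt_of_le (show s ≤ ‖z₃ - w₀‖ from hz₃.1) with heq | hlt
  · have := hτS z₃ (hsub z₃ (hKb z₃ hz₃)) (hsS z₃ heq.ge)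
    simp only [Φ, ← heq] at hval
    rw [← heq] at hκle
    linarith
  rcases eq_or_lt_of_le (hKb z₃ hz₃) with heq | hlt'
  · simp only [Φ, heq] at hval
    linarith
  · have hloc : IsLocalMax Φ z₃ := by
      apply hmax.isLocalMax
      have o1 : IsOpen {z : ℂ | s < ‖z - w₀‖ ∧ ‖z - w₀‖ < ρ} :=
        (isOpen_lt continuous_const (f := fun _ : ℂ => s) (g := fun z => ‖z - w₀‖)
          (by fun_prop)).inter
          (isOpen_lt (f := fun z => ‖z - w₀‖) (g := fun _ : ℂ => ρ) (by fun_prop) continuous_const)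
      refine Filter.mem_of_superset (o1.mem_nhds ⟨hlt, hlt'⟩) ?_
      intro z hz
      exact ⟨hz.1.le, by simpa [dist_eq_norm] using hz.2.le⟩
    have hle := laplacian_nonpos_of_isLocalMax ((c1 z₃ hz₃).sub (c2 z₃ hz₃)) hloc
    obtain ⟨e1, e2, -⟩ := h1 τ hτ z₃ (hsub z₃ (hKb z₃ hz₃))
    have : (Δ Φ) z₃ = ((Δ (L τ)) z₃ + κ * 4) - A * 0 := by
      rw [laplacian_fun_sub (c1 z₃ hz₃) (c2 z₃ hz₃),
        laplacian_fun_add e1 (contDiffAt_const.mul (contDiffAt_normSq_sub w₀ z₃)),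
        laplacian_const_mul _ (contDiffAt_normSq_sub w₀ z₃), laplacian_normSq_sub,
        laplacian_const_mul _ (contDiffAt_log_norm_sub (hne z₃ hz₃)),
        laplacian_log_norm_sub (hne z₃ hz₃)]
    change (Δ Φ) z₃ ≤ 0 at hle
    rw [this] at hle
    have := le_abs_self C
    simp only [hκ] at hle
    linarith

/-- `r` satisfies `Δ r ≥ m` at `z` in the sense of test functions touching `r` from above. -/
def ViscAt (r : ℂ → ℝ) (m : ℝ) (z : ℂ) : Prop :=
  ∀ φ : ℂ → ℝ, ContDiffAt ℝ 2 φ z → IsLocalMax (fun w => r w - φ w) z → m ≤ (Δ φ) z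

/-- The upper regularization of `r` from the complement of `S`. -/
noncomputable def regularize (S : Set ℂ) (r : ℂ → ℝ) (z : ℂ) : ℝ := limsup r (𝓝[Sᶜ] z)

/-! ### Upper regularization across a polar set -/

section Regularize

variable {S Ω : Set ℂ} {r : ℂ → ℝ}

lemma isCoboundedUnder_regularize (hΩ : IsOpen Ω) (h0 : ∀ z ∈ Ω, 0 ≤ r z) {z : ℂ} (hz : z ∈ Ω)
    [NeBot (𝓝[Sᶜ] z)] : IsCoboundedUnder (· ≤ ·) (𝓝[Sᶜ] z) r := by
  refine IsBoundedUnder.isCoboundedUnder_le ⟨0, ?_⟩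
  rw [eventually_map]
  filter_upwards [mem_nhdsWithin_of_mem_nhds (hΩ.mem_nhds hz)] with w hw using h0 w hw

lemma isBoundedUnder_regularize (hΩ : IsOpen Ω) (hr : UpperSemicontinuousOn r Ω) {z : ℂ}
    (hz : z ∈ Ω) : IsBoundedUnder (· ≤ ·) (𝓝[Sᶜ] z) r := by
  refine ⟨r z + 1, ?_⟩
  rw [eventually_map]
  have := hr z hz (r z + 1) (by linarith)
  rw [hΩ.nhdsWithin_eq hz] at this
  exact (this.filter_mono nhdsWithin_le_nhds).mono fun w hw => hw.le

lemma regularize_le (hΩ : IsOpen Ω) (h0 : ∀ z ∈ Ω, 0 ≤ r z) {z : ℂ} (hz : z ∈ Ω)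
    [NeBot (𝓝[Sᶜ] z)] {c : ℝ} (h : ∀ᶠ w in 𝓝[Sᶜ] z, r w ≤ c) : regularize S r z ≤ c :=
  limsup_le_of_le (isCoboundedUnder_regularize hΩ h0 hz) h

lemma regularize_nonneg (hΩ : IsOpen Ω) (h0 : ∀ z ∈ Ω, 0 ≤ r z) (hr : UpperSemicontinuousOn r Ω)
    {z : ℂ} (hz : z ∈ Ω) [NeBot (𝓝[Sᶜ] z)] : 0 ≤ regularize S r z := by
  refine le_limsup_of_frequently_le ?_ (isBoundedUnder_regularize hΩ hr hz)
  apply Eventually.frequently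
  filter_upwards [mem_nhdsWithin_of_mem_nhds (hΩ.mem_nhds hz)] with w hw using h0 w hw

lemma le_regularize (hΩ : IsOpen Ω) (hr : UpperSemicontinuousOn r Ω) {z : ℂ} (hz : z ∈ Ω)
    (hS : z ∉ S) : r z ≤ regularize S r z := by
  refine le_limsup_of_frequently_le ?_ (isBoundedUnder_regularize hΩ hr hz)
  intro h
  have := mem_of_mem_nhdsWithin (show z ∈ Sᶜ from hS) h
  simp at this

lemma eventually_lt_of_regularize_lt (hΩ : IsOpen Ω) (hr : UpperSemicontinuousOn r Ω) {z : ℂ}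
    (hz : z ∈ Ω) {c : ℝ} (h : regularize S r z < c) : ∀ᶠ w in 𝓝[Sᶜ] z, r w < c :=
  eventually_lt_of_limsup_lt h (isBoundedUnder_regularize hΩ hr hz)

lemma frequently_lt_of_lt_regularize (hΩ : IsOpen Ω) (h0 : ∀ z ∈ Ω, 0 ≤ r z) {z : ℂ}
    (hz : z ∈ Ω) [NeBot (𝓝[Sᶜ] z)] {c : ℝ} (h : c < regularize S r z) :
    ∃ᶠ w in 𝓝[Sᶜ] z, c < r w :=
  frequently_lt_of_lt_limsup (isCoboundedUnder_regularize hΩ h0 hz) h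

lemma upperSemicontinuousOn_regularize (hΩ : IsOpen Ω) (h0 : ∀ z ∈ Ω, 0 ≤ r z)
    (hr : UpperSemicontinuousOn r Ω) (hne : ∀ z ∈ Ω, NeBot (𝓝[Sᶜ] z)) :
    UpperSemicontinuousOn (regularize S r) Ω := by
  intro z hz c hc
  obtain ⟨c', hc', hc''⟩ := exists_between hc
  have h1 := eventually_lt_of_regularize_lt hΩ hr hz hc'
  have h2 := eventually_nhdsWithin_iff.1 h1
  rw [hΩ.nhdsWithin_eq hz]
  filter_upwards [h2.eventually_nhds, hΩ.mem_nhds hz] with w hw hwΩ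
  have := hne w hwΩ
  refine lt_of_le_of_lt (regularize_le hΩ h0 hwΩ (c := c') ?_) hc''
  filter_upwards [eventually_nhdsWithin_iff.2 hw] with y hy using hy.le

/-- Removal of a locally polar set from the domain of a differential inequality. -/
lemma viscAt_regularize {m : ℂ → ℝ} (hΩ : IsOpen Ω) (h0 : ∀ z ∈ Ω, 0 ≤ r z)
    (hr : UpperSemicontinuousOn r Ω) (hne : ∀ z ∈ Ω, NeBot (𝓝[Sᶜ] z))
    (hpol : ∀ z ∈ Ω, LocallyPolarAt S z) (hm : ContinuousOn m Ω)
    (hv : ∀ z ∈ Ω, z ∉ S → ViscAt r (m z) z) {z₁ : ℂ} (hz₁ : z₁ ∈ Ω) :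
    ViscAt (regularize S r) (m z₁) z₁ := by
  intro φ hφ hmax
  have := hne z₁ hz₁
  by_contra! hlt
  obtain ⟨R, hR, L, C, h1, h2, h3⟩ := hpol z₁ hz₁
  -- Of the slack `6σ`, four parts pay for `σ|z - z₁|²`, which makes the maximum strict, one for the
  -- polar perturbation, and one for continuity.
  obtain ⟨σ, hσ, hσlt⟩ : ∃ σ > 0, (Δ φ) z₁ + 6 * σ < m z₁ :=
    ⟨(m z₁ - (Δ φ) z₁) / 7, by linarith, by linarith⟩
  have hlapc : ContinuousAt (Δ φ) z₁ := by
    have e : (Δ φ) =ᶠ[𝓝 z₁] fun z => dirD 1 (dirD 1 φ) z + dirD Complex.I (dirD Complex.I φ) z := by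
      filter_upwards [hφ.eventually (by simp)] with z hz using laplacian_eq_dirD hz
    refine ContinuousAt.congr ?_ e.symm
    have : ∀ v, ContinuousAt (dirD v (dirD v φ)) z₁ := fun v =>
      (contDiffAt_dirD (m := 0) (contDiffAt_dirD (m := 1) hφ (by norm_num))
        (by norm_num)).continuousAt
    exact (this 1).add (this Complex.I)
  have hmc : ContinuousAt m z₁ := hm.continuousAt (hΩ.mem_nhds hz₁)
  have hev : ∀ᶠ z in 𝓝 z₁, (Δ φ) z + 5 * σ < m z := by
    have : ContinuousAt (fun z => m z - (Δ φ) z) z₁ := hmc.sub hlapc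
    filter_upwards [this.eventually (lt_mem_nhds (show 5 * σ < m z₁ - (Δ φ) z₁ by linarith))]
      with z hz
    linarith
  set v₀ := regularize S r z₁ - φ z₁ with hv₀
  obtain ⟨ϱ', hϱ', hball'⟩ := Metric.eventually_nhds_iff_ball.1
    ((((hev.and (hφ.eventually (by simp))).and hmax).and (hΩ.mem_nhds hz₁)).and
      (Metric.ball_mem_nhds z₁ hR))
  set ϱ := ϱ' / 2 with hϱ
  have hϱ0 : 0 < ϱ := by positivity
  have hin : ∀ z, ‖z - z₁‖ ≤ ϱ → z ∈ Metric.ball z₁ ϱ' := fun z hz => by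
    rw [Metric.mem_ball, dist_eq_norm]; linarith
  let φ₁ : ℂ → ℝ := fun z => φ z + σ * ‖z - z₁‖ ^ 2
  have hφ₁ : ∀ z ∈ Metric.ball z₁ ϱ', ContDiffAt ℝ 2 φ₁ z := fun z hz =>
    (hball' z hz).1.1.1.2.add (contDiffAt_const.mul (contDiffAt_normSq_sub z₁ z))
  have hφ₁Δ : ∀ z ∈ Metric.ball z₁ ϱ', (Δ φ₁) z = (Δ φ) z + σ * 4 := fun z hz => by
    rw [laplacian_fun_add (hball' z hz).1.1.1.2
      (contDiffAt_const.mul (contDiffAt_normSq_sub z₁ z)),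
      laplacian_const_mul _ (contDiffAt_normSq_sub z₁ z), laplacian_normSq_sub]
  obtain ⟨w, hwS, hwϱ, hwval⟩ : ∃ w, w ∉ S ∧ ‖w - z₁‖ < ϱ ∧ v₀ - σ * ϱ ^ 2 / 2 < r w - φ₁ w := by
    have hφ₁z : φ₁ z₁ = φ z₁ := by simp [φ₁]
    have hc := (hφ₁ z₁ (Metric.mem_ball_self hϱ')).continuousAt
    have e1 : ∀ᶠ w in 𝓝[Sᶜ] z₁, φ₁ w < φ z₁ + σ * ϱ ^ 2 / 4 := by
      refine (hc.eventually (gt_mem_nhds ?_)).filter_mono nhdsWithin_le_nhds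
      rw [hφ₁z]
      have : 0 < σ * ϱ ^ 2 := by positivity
      linarith
    have e2 : ∀ᶠ w in 𝓝[Sᶜ] z₁, ‖w - z₁‖ < ϱ := by
      filter_upwards [mem_nhdsWithin_of_mem_nhds (Metric.ball_mem_nhds z₁ hϱ0)] with w hw
      rwa [Metric.mem_ball, dist_eq_norm] at hw
    have e3 : ∃ᶠ w in 𝓝[Sᶜ] z₁, regularize S r z₁ - σ * ϱ ^ 2 / 4 < r w := by
      apply frequently_lt_of_lt_regularize hΩ h0 hz₁
      have : 0 < σ * ϱ ^ 2 := by positivity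
      linarith
    obtain ⟨w, hw3, ⟨hw1, hw2⟩, hw4⟩ :=
      (e3.and_eventually ((e1.and e2).and self_mem_nhdsWithin)).exists
    exact ⟨w, hw4, hw2, by linarith⟩
  obtain ⟨c, hc⟩ := h3 w (hball' w (hin w hwϱ.le)).2 hwS
  -- `δ` depends on the bound `c` at the near-maximal point `w`, which is uniform in `τ`. Thus `δ L
  -- τ` costs little at `w` whatever `τ` is.
  obtain ⟨δ, hδ, hδ1, hδ2⟩ : ∃ δ > 0, δ * |c| < σ * ϱ ^ 2 / 4 ∧ δ * |C| < σ := by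
    refine ⟨min (σ * ϱ ^ 2 / 4 / (|c| + 1)) (σ / (|C| + 1)), by positivity, ?_, ?_⟩
    · calc _ ≤ σ * ϱ ^ 2 / 4 / (|c| + 1) * |c| := by gcongr; exact min_le_left _ _
        _ < σ * ϱ ^ 2 / 4 / (|c| + 1) * (|c| + 1) := by gcongr; linarith
        _ = _ := by field_simp
    · calc _ ≤ σ / (|C| + 1) * |C| := by gcongr; exact min_le_right _ _
        _ < σ / (|C| + 1) * (|C| + 1) := by gcongr; linarith
        _ = _ := by field_simp
  have hKc := isCompact_closedBall z₁ ϱ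
  have hKin : ∀ z ∈ Metric.closedBall z₁ ϱ, z ∈ Metric.ball z₁ ϱ' := fun z hz =>
    hin z (by simpa [dist_eq_norm] using hz)
  have husc : UpperSemicontinuousOn (fun z => r z - φ₁ z) (Metric.closedBall z₁ ϱ) := by
    have : UpperSemicontinuousOn r (Metric.closedBall z₁ ϱ) := hr.mono fun z hz =>
      (hball' z (hKin z hz)).1.2
    have e : (fun z => r z - φ₁ z) = fun z => r z + (-φ₁ z) := by ext; ring
    rw [e]
    refine this.add ?_
    exact ContinuousOn.upperSemicontinuousOn fun z hz =>
      (hφ₁ z (hKin z hz)).continuousAt.neg.continuousWithinAt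
  obtain ⟨M, hM⟩ := husc.bddAbove_of_isCompact hKc
  have hM' : ∀ z ∈ Metric.closedBall z₁ ϱ, r z - φ₁ z ≤ M := fun z hz => hM ⟨z, hz, rfl⟩
  -- With `δ` fixed, `τ` pushes the perturbed function on `S` below `v₀ - σϱ²`, hence below its
  -- value at `w`. The bounding sphere is excluded by `σ|z - z₁|²`, so the maximum is interior and
  -- off `S`, where the hypothesis on `r` applies.
  obtain ⟨τ, hτ, hτS⟩ := h2 ((v₀ - σ * ϱ ^ 2 - M) / δ)
  have husc2 : UpperSemicontinuousOn (fun z => (r z - φ₁ z) + δ * L τ z)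
      (Metric.closedBall z₁ ϱ) := by
    refine husc.add (ContinuousOn.upperSemicontinuousOn fun z hz => ?_)
    exact (continuousAt_const.mul
      (h1 τ hτ z (hball' z (hKin z hz)).2).1.continuousAt).continuousWithinAt
  obtain ⟨z₂, hz₂, hmax₂⟩ := husc2.exists_isMaxOn ⟨z₁, Metric.mem_closedBall_self hϱ0.le⟩ hKc
  have hwK : w ∈ Metric.closedBall z₁ ϱ := by simpa [dist_eq_norm] using hwϱ.le
  have hval : v₀ - σ * ϱ ^ 2 * (3 / 4) < (r z₂ - φ₁ z₂) + δ * L τ z₂ := by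
    refine lt_of_lt_of_le ?_ (hmax₂ hwK)
    have h4 : δ * (-|c|) ≤ δ * L τ w := by
      gcongr
      exact (neg_abs_le c).trans (hc τ hτ)
    simp only
    linarith
  obtain ⟨k1, k2, k3⟩ := h1 τ hτ z₂ (hball' z₂ (hKin z₂ hz₂)).2
  have hz₂S : z₂ ∉ S := by
    intro hS
    have := hτS z₂ (hball' z₂ (hKin z₂ hz₂)).2 hS
    have h5 : δ * L τ z₂ ≤ v₀ - σ * ϱ ^ 2 - M := by
      rw [le_div_iff₀ hδ] at this; linarith
    have h6 := hM' z₂ hz₂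
    have : 0 < σ * ϱ ^ 2 := by positivity
    linarith
  have hδL : δ * L τ z₂ ≤ 0 := mul_nonpos_of_nonneg_of_nonpos hδ.le k3
  have hz₂lt : ‖z₂ - z₁‖ < ϱ := by
    refine lt_of_le_of_ne (by simpa [dist_eq_norm] using hz₂) fun heq => ?_
    have hb := hball' z₂ (hKin z₂ hz₂)
    have h5 := le_regularize hΩ hr hb.1.2 hz₂S
    have h6 := hb.1.1.2
    simp only [φ₁, heq] at hval
    simp only at h6
    have : 0 < σ * ϱ ^ 2 := by positivity
    linarith
  have hloc : IsLocalMax (fun z => r z - (φ₁ z - δ * L τ z)) z₂ := by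
    have := hmax₂.isLocalMax (Filter.mem_of_superset (Metric.isOpen_ball.mem_nhds
      (show z₂ ∈ Metric.ball z₁ ϱ by rwa [Metric.mem_ball, dist_eq_norm]))
      Metric.ball_subset_closedBall)
    filter_upwards [this] with z hz
    linarith
  have cφ := hφ₁ z₂ (hKin z₂ hz₂)
  have hfin := hv z₂ (hball' z₂ (hKin z₂ hz₂)).1.2 hz₂S _
    (cφ.sub (contDiffAt_const.mul k1)) hloc
  rw [laplacian_fun_sub cφ (contDiffAt_const.mul k1), laplacian_const_mul _ k1,
    hφ₁Δ z₂ (hKin z₂ hz₂)] at hfin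
  have h7 := (hball' z₂ (hKin z₂ hz₂)).1.1.1.1
  have h8 : δ * (-|C|) ≤ δ * (Δ (L τ)) z₂ := by
    gcongr
    exact (neg_le_neg (le_abs_self C)).trans k2
  linarith

end Regularize

end Polar


/-! ### The critical set of a harmonic map is polar -/

section HarmonicPolar

open Laplacian Filter

variable {Y : Type*} [NormedAddCommGroup Y] [InnerProductSpace ℝ Y]

noncomputable instance normedAddCommGroupCLM₂ (X Z : Type*) [NormedAddCommGroup X]
    [NormedSpace ℝ X] [NormedAddCommGroup Z] [NormedSpace ℝ Z] :
    NormedAddCommGroup (X →L[ℝ] X →L[ℝ] Z) := ContinuousLinearMap.toNormedAddCommGroup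

noncomputable instance normedSpaceCLM₂ (X Z : Type*) [NormedAddCommGroup X]
    [NormedSpace ℝ X] [NormedAddCommGroup Z] [NormedSpace ℝ Z] :
    NormedSpace ℝ (X →L[ℝ] X →L[ℝ] Z) := ContinuousLinearMap.toNormedSpace

noncomputable instance normedAddCommGroupCLM₃ (X Z : Type*) [NormedAddCommGroup X]
    [NormedSpace ℝ X] [NormedAddCommGroup Z] [NormedSpace ℝ Z] :
    NormedAddCommGroup (X →L[ℝ] X →L[ℝ] X →L[ℝ] Z) := ContinuousLinearMap.toNormedAddCommGroup

lemma le_of_sq_le_sq_right {a b : ℝ} (h : a ^ 2 ≤ b ^ 2) (hb : 0 ≤ b) : a ≤ b :=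
  (abs_le_of_sq_le_sq' h hb).2

/-- The squared length of the gradient. -/
noncomputable def gradSq (f : ℂ → Y) (z : ℂ) : ℝ := ‖dirD 1 f z‖ ^ 2 + ‖dirD Complex.I f z‖ ^ 2

lemma gradSq_nonneg (f : ℂ → Y) (z : ℂ) : 0 ≤ gradSq f z := by unfold gradSq; positivity

lemma contDiffAt_gradSq {f : ℂ → Y} {z : ℂ} (hf : ContDiffAt ℝ 3 f z) :
    ContDiffAt ℝ 2 (gradSq f) z :=
  (contDiffAt_normSq (contDiffAt_dirD hf (by norm_num))).add
    (contDiffAt_normSq (contDiffAt_dirD hf (by norm_num)))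

lemma dirD_laplacian {f : ℂ → Y} {z v : ℂ} (hf : ContDiffAt ℝ 3 f z) :
    (Δ (dirD v f)) z = dirD v (Δ f) z := by
  have hf2 : ∀ᶠ w in 𝓝 z, ContDiffAt ℝ 2 f w := (hf.of_le (by norm_num)).eventually (by simp)
  have hd : ∀ u, ContDiffAt ℝ 2 (dirD u f) z := fun u => contDiffAt_dirD hf (by norm_num)
  have key : ∀ u, dirD u (dirD u (dirD v f)) z = dirD v (dirD u (dirD u f)) z := fun u => by
    have ev : dirD u (dirD v f) =ᶠ[𝓝 z] dirD v (dirD u f) := by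
      filter_upwards [hf2] with w hw using dirD_comm hw
    rw [dirD_congr ev, dirD_comm (hd u)]
  have ev : (Δ f) =ᶠ[𝓝 z] fun w => dirD 1 (dirD 1 f) w + dirD Complex.I (dirD Complex.I f) w := by
    filter_upwards [hf2] with w hw using laplacian_eq_dirD hw
  have hdd : ∀ u, DifferentiableAt ℝ (dirD u (dirD u f)) z := fun u =>
    (contDiffAt_dirD (m := 1) (hd u) (by norm_num)).differentiableAt (by norm_num)
  rw [laplacian_eq_dirD (hd v), dirD_congr ev, dirD_add (hdd 1) (hdd Complex.I), key, key]

/-- Cauchy–Schwarz in the complexification, for `A - iB` and `P + iQ`. Estimating the two squares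
separately would lose a factor 2, which the exact cancellation in `logLog_laplacian_bound` does not
allow. -/
lemma sq_inner_add_sq_inner_le {A B P Q : Y} :
    (inner ℝ A P + inner ℝ B Q) ^ 2 + (inner ℝ B P - inner ℝ A Q) ^ 2 ≤
      (‖A‖ ^ 2 + ‖B‖ ^ 2) * (‖P‖ ^ 2 + ‖Q‖ ^ 2) := by
  set x := inner ℝ A P + inner ℝ B Q with hx
  set y := inner ℝ B P - inner ℝ A Q with hy
  set U := x • P - y • Q with hU
  set V := x • Q + y • P with hV
  have h1 : x ^ 2 + y ^ 2 = inner ℝ A U + inner ℝ B V := by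
    simp only [hU, hV, inner_sub_right, inner_add_right, inner_smul_right]
    rw [hx, hy]; ring
  have h2 : ‖U‖ ^ 2 + ‖V‖ ^ 2 = (x ^ 2 + y ^ 2) * (‖P‖ ^ 2 + ‖Q‖ ^ 2) := by
    rw [hU, hV, norm_sub_sq_real, norm_add_sq_real]
    simp only [norm_smul, inner_smul_left, inner_smul_right, mul_pow, Real.norm_eq_abs, sq_abs,
      conj_trivial]
    rw [real_inner_comm P Q]; ring
  have h3 : inner ℝ A U + inner ℝ B V ≤ ‖A‖ * ‖U‖ + ‖B‖ * ‖V‖ :=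
    add_le_add (real_inner_le_norm _ _) (real_inner_le_norm _ _)
  have h4 : (‖A‖ * ‖U‖ + ‖B‖ * ‖V‖) ^ 2 ≤ (‖A‖ ^ 2 + ‖B‖ ^ 2) * (‖U‖ ^ 2 + ‖V‖ ^ 2) := by
    nlinarith [sq_nonneg (‖A‖ * ‖V‖ - ‖B‖ * ‖U‖)]
  have h0 : 0 ≤ x ^ 2 + y ^ 2 := by positivity
  rcases h0.eq_or_lt with h | h
  · rw [← h]; positivity
  · have h5 : (x ^ 2 + y ^ 2) ^ 2 ≤ (‖A‖ ^ 2 + ‖B‖ ^ 2) *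
        ((x ^ 2 + y ^ 2) * (‖P‖ ^ 2 + ‖Q‖ ^ 2)) := by
      rw [← h2]
      refine le_trans ?_ h4
      rw [← h1] at h3
      gcongr
    have h6 : (x ^ 2 + y ^ 2) * (x ^ 2 + y ^ 2) ≤ (x ^ 2 + y ^ 2) *
        ((‖A‖ ^ 2 + ‖B‖ ^ 2) * (‖P‖ ^ 2 + ‖Q‖ ^ 2)) := by nlinarith
    exact le_of_mul_le_mul_left h6 h

/-- `P, Q` stand for `f_x, f_y`; `A, B, D` for `f_xx, f_xy, f_yy`; `E, Ex, Ey` for `Δf` and its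
derivatives. If `E = 0` then `P - iQ` is holomorphic, and `q = |P|² + |Q|²` has `Δq = 4α²` and
`|∇q|² ≤ 4s²α²`. In general `D = E - A` with `E = O(s)`, which only adds the terms with constant `8c
+ 4c²`. -/
lemma almost_cauchyRiemann_bounds {A B D P Q E Ex Ey : Y} {c s α : ℝ} (hs : 0 ≤ s)
    (hα : 0 ≤ α) (hc : 0 ≤ c) (hAD : A + D = E) (hPQ : ‖P‖ ^ 2 + ‖Q‖ ^ 2 = s ^ 2)
    (hAB : ‖A‖ ^ 2 + ‖B‖ ^ 2 = α ^ 2) (hE : ‖E‖ ≤ c * s) (hEx : ‖Ex‖ ≤ c * (α + s))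
    (hEy : ‖Ey‖ ≤ c * (α + s)) :
    4 * α ^ 2 - (8 * c + 4 * c ^ 2) * s * α - (8 * c + 4 * c ^ 2) * s ^ 2 ≤
      (2 * inner ℝ Ex P + 2 * (‖A‖ ^ 2 + ‖B‖ ^ 2)) +
        (2 * inner ℝ Ey Q + 2 * (‖B‖ ^ 2 + ‖D‖ ^ 2)) ∧
    (2 * inner ℝ A P + 2 * inner ℝ B Q) ^ 2 + (2 * inner ℝ B P + 2 * inner ℝ D Q) ^ 2 ≤
      4 * s ^ 2 * α ^ 2 + (8 * c + 4 * c ^ 2) * s ^ 3 * α + (8 * c + 4 * c ^ 2) * s ^ 4 := by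
  have hP : ‖P‖ ≤ s := by
    refine le_of_sq_le_sq_right ?_ hs
    nlinarith [sq_nonneg ‖Q‖]
  have hQ : ‖Q‖ ≤ s := by
    refine le_of_sq_le_sq_right ?_ hs
    nlinarith [sq_nonneg ‖P‖]
  have hA : ‖A‖ ≤ α := by
    refine le_of_sq_le_sq_right ?_ hα
    nlinarith [sq_nonneg ‖B‖]
  have hD : D = E - A := by rw [← hAD]; abel
  have h1 : |inner ℝ Ex P| ≤ c * (α + s) * s :=
    (abs_real_inner_le_norm _ _).trans (by gcongr)
  have h2 : |inner ℝ Ey Q| ≤ c * (α + s) * s :=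
    (abs_real_inner_le_norm _ _).trans (by gcongr)
  have h3 : |inner ℝ E A| ≤ c * s * α :=
    (abs_real_inner_le_norm _ _).trans (by gcongr)
  have h4 : |inner ℝ E Q| ≤ c * s * s :=
    (abs_real_inner_le_norm _ _).trans (by gcongr)
  have hsα : 0 ≤ s * α := by positivity
  constructor
  · have h5 : ‖D‖ ^ 2 = ‖E‖ ^ 2 - 2 * inner ℝ E A + ‖A‖ ^ 2 := by
      rw [hD, norm_sub_sq_real]
    have := (abs_le.1 h1).1
    have := (abs_le.1 h2).1
    have := (abs_le.1 h3).2
    have : 0 ≤ c ^ 2 * (s * α) := by positivity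
    have : 0 ≤ c ^ 2 * s ^ 2 := by positivity
    have : 0 ≤ c * s ^ 2 := by positivity
    nlinarith [sq_nonneg ‖E‖]
  · have h5 := sq_inner_add_sq_inner_le (A := A) (B := B) (P := P) (Q := Q)
    rw [hAB, hPQ] at h5
    set x := inner ℝ A P + inner ℝ B Q with hx
    set y := inner ℝ B P - inner ℝ A Q with hy
    set e := inner ℝ E Q with he
    have h6 : inner ℝ B P + inner ℝ D Q = y + e := by
      rw [hD, inner_sub_left, hy, he]; ring
    have h7 : |y| ≤ α * s := by
      apply abs_le_of_sq_le_sq _ (by positivity)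
      nlinarith [sq_nonneg x]
    have h8 : y * e ≤ (α * s) * (c * s * s) := by
      calc y * e ≤ |y * e| := le_abs_self _
        _ = |y| * |e| := abs_mul _ _
        _ ≤ _ := by gcongr
    have h9 : e ^ 2 ≤ (c * s * s) ^ 2 := by
      rw [← sq_abs e]; gcongr
    have e1 : (2 * inner ℝ A P + 2 * inner ℝ B Q) ^ 2 + (2 * inner ℝ B P + 2 * inner ℝ D Q) ^ 2 =
        4 * (x ^ 2 + y ^ 2) + 8 * (y * e) + 4 * e ^ 2 := by
      rw [← mul_add, ← mul_add, h6, ← hx]; ring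
    rw [e1]
    have k1 : 0 ≤ c ^ 2 * (s ^ 3 * α) := by positivity
    have k2 : 0 ≤ c * s ^ 4 := by positivity
    nlinarith

/-- The right side is `Δ H(q)` for `H(t) = -log(Λ - log(t + τ))`, with `κ² = q + τ` and `l = Λ - log
κ²`. For `log(q + τ)` alone the leading terms can cancel, leaving an error of order `X = α/κ`, which
is unbounded. The outer logarithm leaves a surplus `4X²/l²`, which absorbs this error by completing
the square. -/
lemma logLog_laplacian_bound {C s κ l α lap gr : ℝ} (hC : 0 ≤ C) (hs : 0 ≤ s) (hκ : 0 < κ)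
    (hsκ : s ≤ κ) (hl : 1 ≤ l) (hα : 0 ≤ α) (hlap : 4 * α ^ 2 - C * s * α - C * s ^ 2 ≤ lap)
    (hgr : gr ≤ 4 * s ^ 2 * α ^ 2 + C * s ^ 3 * α + C * s ^ 4) :
    -(C ^ 2 / 4 + 2 * C) ≤ -(l - 1) / (κ ^ 2 * l) ^ 2 * gr + (κ ^ 2 * l)⁻¹ * lap := by
  set X := α / κ with hX
  have hX0 : 0 ≤ X := by positivity
  have hαX : α = X * κ := by rw [hX]; field_simp
  have h1 : κ ^ 2 * (4 * X ^ 2 - C * X - C) ≤ lap := by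
    refine le_trans ?_ hlap
    have a1 : C * s * α ≤ C * κ * α := by gcongr
    have a2 : C * s ^ 2 ≤ C * κ ^ 2 := by gcongr
    rw [hαX] at a1 ⊢
    nlinarith
  have h2 : gr ≤ κ ^ 4 * (4 * X ^ 2 + C * X + C) := by
    refine hgr.trans ?_
    have a1 : 4 * s ^ 2 * α ^ 2 ≤ 4 * κ ^ 2 * α ^ 2 := by gcongr
    have a2 : C * s ^ 3 * α ≤ C * κ ^ 3 * α := by gcongr
    have a3 : C * s ^ 4 ≤ C * κ ^ 4 := by gcongr
    rw [hαX] at a1 a2 ⊢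
    nlinarith
  have hl0 : 0 < l := by linarith
  have h3 : -(l - 1) / (κ ^ 2 * l) ^ 2 * (κ ^ 4 * (4 * X ^ 2 + C * X + C)) ≤
      -(l - 1) / (κ ^ 2 * l) ^ 2 * gr := by
    apply mul_le_mul_of_nonpos_left h2
    apply div_nonpos_of_nonpos_of_nonneg (by linarith) (by positivity)
  have h4 : (κ ^ 2 * l)⁻¹ * (κ ^ 2 * (4 * X ^ 2 - C * X - C)) ≤ (κ ^ 2 * l)⁻¹ * lap := by
    gcongr
  refine le_trans ?_ (add_le_add h3 h4)
  have e : -(l - 1) / (κ ^ 2 * l) ^ 2 * (κ ^ 4 * (4 * X ^ 2 + C * X + C)) +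
      (κ ^ 2 * l)⁻¹ * (κ ^ 2 * (4 * X ^ 2 - C * X - C)) =
      (4 * X ^ 2 - (2 * l - 1) * (C * X + C)) / l ^ 2 := by
    field_simp
    ring
  rw [e, le_div_iff₀ (by positivity)]
  have k1 : 0 ≤ C * X := by positivity
  have k2 : 0 ≤ C * (l - 1) * l := by
    have : 0 ≤ l - 1 := by linarith
    positivity
  nlinarith [sq_nonneg (2 * X - C * l / 2)]

/-- The map `f` solves an elliptic system `Δ f = 𝔅(f)(∂f, ∂f)` with quadratic right-hand side. -/
def QuadraticSystemAt (𝔅 : Y → Y →L[ℝ] Y →L[ℝ] Y) (f : ℂ → Y) (z : ℂ) : Prop :=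
  (Δ f) z = 𝔅 (f z) (dirD 1 f z) (dirD 1 f z) +
    𝔅 (f z) (dirD Complex.I f z) (dirD Complex.I f z)

lemma dirD_trilinear {T : ℂ → Y →L[ℝ] Y →L[ℝ] Y} {P : ℂ → Y} {z v : ℂ}
    (hT : DifferentiableAt ℝ T z) (hP : DifferentiableAt ℝ P z) :
    dirD v (fun w => T w (P w) (P w)) z = dirD v T z (P z) (P z) + T z (dirD v P z) (P z) +
      T z (P z) (dirD v P z) := by
  have h1 := dirD_bilin (ContinuousLinearMap.id ℝ (Y →L[ℝ] Y →L[ℝ] Y)) (v := v) hT hP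
  have h2 := dirD_bilin (ContinuousLinearMap.id ℝ (Y →L[ℝ] Y)) (v := v) (hT.clm_apply hP) hP
  simp only [ContinuousLinearMap.id_apply] at h1 h2
  rw [h2, h1]
  rfl

lemma norm_bilin_le {X₁ : Type*} [NormedAddCommGroup X₁] [NormedSpace ℝ X₁]
    {T : Y →L[ℝ] Y →L[ℝ] X₁} {x y : Y} {b s t : ℝ}
    (hT : ‖T‖ ≤ b) (hx : ‖x‖ ≤ s) (hy : ‖y‖ ≤ t) : ‖T x y‖ ≤ b * s * t := by
  have hs : 0 ≤ s := (norm_nonneg _).trans hx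
  have hb : 0 ≤ b := (norm_nonneg _).trans hT
  calc ‖T x y‖ ≤ ‖T‖ * ‖x‖ * ‖y‖ := T.le_opNorm₂ x y
    _ ≤ b * s * t := by gcongr

lemma eventually_bounds {𝔅 : Y → Y →L[ℝ] Y →L[ℝ] Y} {f : ℂ → Y} {z₁ : ℂ}
    (hf : ContDiffAt ℝ 3 f z₁) (hB : ContDiffAt ℝ 1 𝔅 (f z₁)) :
    ∃ b : ℝ, 1 ≤ b ∧ ∀ᶠ z in 𝓝 z₁, ‖𝔅 (f z)‖ ≤ b ∧ (∀ v, ‖fderiv ℝ 𝔅 (f z) v‖ ≤ b * ‖v‖) ∧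
      ‖dirD 1 f z‖ ≤ b ∧ ‖dirD Complex.I f z‖ ≤ b := by
  have hfc := hf.continuousAt
  have bdd : ∀ {W : Type _} [NormedAddCommGroup W] (g : ℂ → W), ContinuousAt g z₁ →
      ∀ᶠ z in 𝓝 z₁, ‖g z‖ ≤ 1 + ‖g z₁‖ := fun g hg =>
    (hg.norm.eventually (gt_mem_nhds (lt_one_add _))).mono fun z hz => hz.le
  have h1 := bdd _ (hB.continuousAt.comp hfc)
  have h2 := bdd _ (((hB.fderiv_right (m := 0) (by norm_num)).continuousAt).comp hfc)
  have cD : ∀ v, ContinuousAt (dirD v f) z₁ := fun v =>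
    (contDiffAt_dirD (m := 0) hf (by norm_num)).continuousAt
  have h3 := bdd _ (cD 1)
  have h4 := bdd _ (cD Complex.I)
  simp only [Function.comp_apply] at h1 h2
  have n1 := norm_nonneg (𝔅 (f z₁))
  have n2 := norm_nonneg (fderiv ℝ 𝔅 (f z₁))
  have n3 := norm_nonneg (dirD 1 f z₁)
  have n4 := norm_nonneg (dirD Complex.I f z₁)
  refine ⟨1 + ‖𝔅 (f z₁)‖ + ‖fderiv ℝ 𝔅 (f z₁)‖ + ‖dirD 1 f z₁‖ + ‖dirD Complex.I f z₁‖,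
    by linarith, ?_⟩
  filter_upwards [h1, h2, h3, h4] with z b1 b2 b3 b4
  refine ⟨by linarith, fun v => ((fderiv ℝ 𝔅 (f z)).le_opNorm v).trans ?_, by linarith, by linarith⟩
  gcongr
  linarith

lemma dirD_comp_clm {X Z : Type*} [NormedAddCommGroup X] [NormedSpace ℝ X]
    [NormedAddCommGroup Z] [NormedSpace ℝ Z] {g : X → Z} {f : ℂ → X} {z v : ℂ}
    (hg : DifferentiableAt ℝ g (f z)) (hf : DifferentiableAt ℝ f z) :
    dirD v (fun w => g (f w)) z = fderiv ℝ g (f z) (dirD v f z) := by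
  unfold dirD
  have := fderiv_comp z hg hf
  change fderiv ℝ (g ∘ f) z v = _
  rw [this]; rfl

lemma norm_trilinear_deriv_le {T T' : Y →L[ℝ] Y →L[ℝ] Y} {p p' : Y} {b s t : ℝ}
    (hT : ‖T‖ ≤ b) (hT' : ‖T'‖ ≤ b * b) (hp : ‖p‖ ≤ b) (hps : ‖p‖ ≤ s)
    (hp' : ‖p'‖ ≤ t) : ‖T' p p + T p' p + T p p'‖ ≤ b ^ 3 * s + 2 * b ^ 2 * t := by
  have e1 := norm_bilin_le hT' hp hps
  have e2 := norm_bilin_le hT hp' hp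
  have e3 := norm_bilin_le hT hp hp'
  calc _ ≤ ‖T' p p‖ + ‖T p' p‖ + ‖T p p'‖ := norm_add₃_le
    _ ≤ b * b * b * s + b * t * b + b * b * t := by gcongr
    _ = _ := by ring

lemma norm_dirD_laplacian_le {𝔅 : Y → Y →L[ℝ] Y →L[ℝ] Y} {f : ℂ → Y} {z v : ℂ} {b s t t' : ℝ}
    (hf : ContDiffAt ℝ 3 f z) (hB : ContDiffAt ℝ 1 𝔅 (f z))
    (hsys : ∀ᶠ z in 𝓝 z, QuadraticSystemAt 𝔅 f z) (hb : 0 ≤ b) (b1 : ‖𝔅 (f z)‖ ≤ b)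
    (b2 : ∀ v, ‖fderiv ℝ 𝔅 (f z) v‖ ≤ b * ‖v‖) (b3 : ‖dirD 1 f z‖ ≤ b)
    (b4 : ‖dirD Complex.I f z‖ ≤ b) (hPs : ‖dirD 1 f z‖ ≤ s) (hQs : ‖dirD Complex.I f z‖ ≤ s)
    (hv1 : ‖dirD v f z‖ ≤ b) (hv2 : ‖dirD v (dirD 1 f) z‖ ≤ t)
    (hv3 : ‖dirD v (dirD Complex.I f) z‖ ≤ t') :
    ‖dirD v (Δ f) z‖ ≤ 2 * b ^ 3 * s + 2 * b ^ 2 * (t + t') := by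
  have dP : DifferentiableAt ℝ (dirD 1 f) z :=
    (contDiffAt_dirD (m := 1) hf (by norm_num)).differentiableAt (by norm_num)
  have dQ : DifferentiableAt ℝ (dirD Complex.I f) z :=
    (contDiffAt_dirD (m := 1) hf (by norm_num)).differentiableAt (by norm_num)
  have df : DifferentiableAt ℝ f z := hf.differentiableAt (by norm_num)
  have dB : DifferentiableAt ℝ 𝔅 (f z) := hB.differentiableAt (by norm_num)
  have hTd : DifferentiableAt ℝ (fun w => 𝔅 (f w)) z := dB.comp z df
  have ev : (Δ f) =ᶠ[𝓝 z] fun w => 𝔅 (f w) (dirD 1 f w) (dirD 1 f w) +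
    𝔅 (f w) (dirD Complex.I f w) (dirD Complex.I f w) := hsys
  have hT' : ‖dirD v (fun w => 𝔅 (f w)) z‖ ≤ b * b := by
    rw [dirD_comp_clm dB df]
    exact (b2 _).trans (by gcongr)
  rw [dirD_congr ev, dirD_add ((hTd.clm_apply dP).clm_apply dP)
    ((hTd.clm_apply dQ).clm_apply dQ), dirD_trilinear hTd dP, dirD_trilinear hTd dQ]
  have e1 := norm_trilinear_deriv_le b1 hT' b3 hPs hv2
  have e2 := norm_trilinear_deriv_le b1 hT' b4 hQs hv3
  refine (norm_add_le _ _).trans ((add_le_add e1 e2).trans (le_of_eq ?_))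
  ring

lemma gradSq_bounds_at {𝔅 : Y → Y →L[ℝ] Y →L[ℝ] Y} {f : ℂ → Y} {z : ℂ} {b : ℝ}
    (hf : ContDiffAt ℝ 3 f z) (hB : ContDiffAt ℝ 1 𝔅 (f z))
    (hsys : ∀ᶠ z in 𝓝 z, QuadraticSystemAt 𝔅 f z) (hb1 : 1 ≤ b) (b1 : ‖𝔅 (f z)‖ ≤ b)
    (b2 : ∀ v, ‖fderiv ℝ 𝔅 (f z) v‖ ≤ b * ‖v‖) (b3 : ‖dirD 1 f z‖ ≤ b)
    (b4 : ‖dirD Complex.I f z‖ ≤ b) {c : ℝ} (hcdef : c = 10 * b ^ 4) :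
    ∃ s α : ℝ, 0 ≤ s ∧ 0 ≤ α ∧ gradSq f z = s ^ 2 ∧
      4 * α ^ 2 - (8 * c + 4 * c ^ 2) * s * α - (8 * c + 4 * c ^ 2) * s ^ 2 ≤ (Δ (gradSq f)) z ∧
      (dirD 1 (gradSq f) z) ^ 2 + (dirD Complex.I (gradSq f) z) ^ 2 ≤
        4 * s ^ 2 * α ^ 2 + (8 * c + 4 * c ^ 2) * s ^ 3 * α + (8 * c + 4 * c ^ 2) * s ^ 4 := by
  have hb0 : 0 ≤ b := by linarith
  have hb2 : b ^ 2 ≤ b ^ 4 := pow_le_pow_right₀ hb1 (by norm_num)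
  have hb3 : b ^ 3 ≤ b ^ 4 := pow_le_pow_right₀ hb1 (by norm_num)
  have hc0 : 0 ≤ c := by rw [hcdef]; positivity
  have hfz2 : ContDiffAt ℝ 2 f z := hf.of_le (by norm_num)
  have cP : ContDiffAt ℝ 2 (dirD 1 f) z := contDiffAt_dirD hf (by norm_num)
  have cQ : ContDiffAt ℝ 2 (dirD Complex.I f) z := contDiffAt_dirD hf (by norm_num)
  have hBsymm : dirD Complex.I (dirD 1 f) z = dirD 1 (dirD Complex.I f) z := dirD_comm hfz2
  have hAD : dirD 1 (dirD 1 f) z + dirD Complex.I (dirD Complex.I f) z = (Δ f) z :=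
    (laplacian_eq_dirD hfz2).symm
  obtain ⟨s, hs0, hs2⟩ : ∃ s : ℝ, 0 ≤ s ∧ gradSq f z = s ^ 2 :=
    ⟨√(gradSq f z), Real.sqrt_nonneg _, (Real.sq_sqrt (gradSq_nonneg f z)).symm⟩
  obtain ⟨α, hα0, hα2⟩ : ∃ α : ℝ, 0 ≤ α ∧
      ‖dirD 1 (dirD 1 f) z‖ ^ 2 + ‖dirD 1 (dirD Complex.I f) z‖ ^ 2 = α ^ 2 :=
    ⟨√(‖dirD 1 (dirD 1 f) z‖ ^ 2 + ‖dirD 1 (dirD Complex.I f) z‖ ^ 2), Real.sqrt_nonneg _,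
      (Real.sq_sqrt (by positivity)).symm⟩
  have hPQ : ‖dirD 1 f z‖ ^ 2 + ‖dirD Complex.I f z‖ ^ 2 = s ^ 2 := hs2
  have hPs : ‖dirD 1 f z‖ ≤ s :=
    le_of_sq_le_sq_right (by nlinarith [sq_nonneg ‖dirD Complex.I f z‖]) hs0
  have hQs : ‖dirD Complex.I f z‖ ≤ s :=
    le_of_sq_le_sq_right (by nlinarith [sq_nonneg ‖dirD 1 f z‖]) hs0
  have hAα : ‖dirD 1 (dirD 1 f) z‖ ≤ α :=
    le_of_sq_le_sq_right (by nlinarith [sq_nonneg ‖dirD 1 (dirD Complex.I f) z‖]) hα0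
  have hBα : ‖dirD 1 (dirD Complex.I f) z‖ ≤ α :=
    le_of_sq_le_sq_right (by nlinarith [sq_nonneg ‖dirD 1 (dirD 1 f) z‖]) hα0
  have hEb : ‖(Δ f) z‖ ≤ 2 * b ^ 2 * s := by
    have hz : QuadraticSystemAt 𝔅 f z := hsys.self_of_nhds
    unfold QuadraticSystemAt at hz
    rw [hz]
    refine (norm_add_le _ _).trans ?_
    have h1 := norm_bilin_le b1 b3 hPs
    have h2 := norm_bilin_le b1 b4 hQs
    refine (add_le_add h1 h2).trans (le_of_eq ?_)
    ring
  have hDb : ‖dirD Complex.I (dirD Complex.I f) z‖ ≤ 2 * b ^ 2 * s + α := by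
    have : dirD Complex.I (dirD Complex.I f) z = (Δ f) z - dirD 1 (dirD 1 f) z := by
      rw [← hAD]; abel
    rw [this]
    exact (norm_sub_le _ _).trans (add_le_add hEb hAα)
  have k1 : b ^ 2 * α ≤ b ^ 4 * α := by gcongr
  have k2 : b ^ 3 * s ≤ b ^ 4 * s := by gcongr
  have k3 : 0 ≤ b ^ 4 * α := by positivity
  have k4 : 0 ≤ b ^ 4 * s := by positivity
  have k5 : b ^ 2 * s ≤ b ^ 4 * s := by gcongr
  have hEx : ‖dirD 1 (Δ f) z‖ ≤ c * (α + s) := by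
    refine (norm_dirD_laplacian_le hf hB hsys hb0 b1 b2 b3 b4 hPs hQs b3 hAα hBα).trans ?_
    rw [hcdef]; linarith
  have hEy : ‖dirD Complex.I (Δ f) z‖ ≤ c * (α + s) := by
    refine (norm_dirD_laplacian_le hf hB hsys hb0 b1 b2 b3 b4 hPs hQs b4
      (hBsymm ▸ hBα) hDb).trans ?_
    rw [hcdef]; nlinarith
  have hEc : ‖(Δ f) z‖ ≤ c * s := hEb.trans (by rw [hcdef]; linarith)
  have key := almost_cauchyRiemann_bounds hs0 hα0 hc0 hAD hPQ hα2 hEc hEx hEy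
  refine ⟨s, α, hs0, hα0, hs2, ?_, ?_⟩
  · have e : (Δ (gradSq f)) z = (Δ (fun w => ‖dirD 1 f w‖ ^ 2)) z +
        (Δ (fun w => ‖dirD Complex.I f w‖ ^ 2)) z :=
      laplacian_fun_add (contDiffAt_normSq cP) (contDiffAt_normSq cQ)
    rw [e, laplacian_normSq cP, laplacian_normSq cQ, dirD_laplacian hf, dirD_laplacian hf,
      hBsymm]
    exact key.1
  · have e : ∀ v, dirD v (gradSq f) z = 2 * inner ℝ (dirD v (dirD 1 f) z) (dirD 1 f z) +
        2 * inner ℝ (dirD v (dirD Complex.I f) z) (dirD Complex.I f z) := fun v => by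
      rw [← dirD_normSq (cP.differentiableAt (by norm_num)),
        ← dirD_normSq (cQ.differentiableAt (by norm_num))]
      exact dirD_add ((contDiffAt_normSq cP).differentiableAt (by norm_num))
        ((contDiffAt_normSq cQ).differentiableAt (by norm_num))
    rw [e, e, hBsymm]
    exact key.2

/-- Differential inequalities for the squared length of the gradient of a solution of an elliptic
system with quadratic right-hand side. -/
lemma gradSq_bounds {𝔅 : Y → Y →L[ℝ] Y →L[ℝ] Y} {f : ℂ → Y} {z₁ : ℂ}
    (hf : ContDiffAt ℝ 3 f z₁) (hB : ContDiffAt ℝ 1 𝔅 (f z₁))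
    (hsys : ∀ᶠ z in 𝓝 z₁, QuadraticSystemAt 𝔅 f z) :
    ∃ C q₁ : ℝ, 0 ≤ C ∧ 0 ≤ q₁ ∧ ∀ᶠ z in 𝓝 z₁, gradSq f z ≤ q₁ ∧ ∃ s α : ℝ, 0 ≤ s ∧ 0 ≤ α ∧
      gradSq f z = s ^ 2 ∧
      4 * α ^ 2 - C * s * α - C * s ^ 2 ≤ (Δ (gradSq f)) z ∧
      (dirD 1 (gradSq f) z) ^ 2 + (dirD Complex.I (gradSq f) z) ^ 2 ≤
        4 * s ^ 2 * α ^ 2 + C * s ^ 3 * α + C * s ^ 4 := by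
  obtain ⟨b, hb1, hev⟩ := eventually_bounds hf hB
  refine ⟨8 * (10 * b ^ 4) + 4 * (10 * b ^ 4) ^ 2, 2 * b ^ 2, by positivity, by positivity, ?_⟩
  filter_upwards [hev, hf.eventually (by simp), hf.continuousAt.eventually (hB.eventually (by simp)),
    hsys.eventually_nhds] with z ⟨b1, b2, b3, b4⟩ hfz hBz hsysz
  refine ⟨?_, gradSq_bounds_at hfz hBz hsysz hb1 b1 b2 b3 b4 rfl⟩
  have h1 : ‖dirD 1 f z‖ ^ 2 ≤ b ^ 2 := by gcongr
  have h2 : ‖dirD Complex.I f z‖ ^ 2 ≤ b ^ 2 := by gcongr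
  unfold gradSq
  linarith

/-- The critical set of a solution of an elliptic system with quadratic right-hand side is locally
polar. -/
lemma locallyPolarAt_of_quadraticSystem {𝔅 : Y → Y →L[ℝ] Y →L[ℝ] Y} {f : ℂ → Y} {z₁ : ℂ}
    {S : Set ℂ} (hf : ContDiffAt ℝ 3 f z₁) (hB : ContDiffAt ℝ 1 𝔅 (f z₁))
    (hsys : ∀ᶠ z in 𝓝 z₁, QuadraticSystemAt 𝔅 f z)
    (hS : ∀ᶠ z in 𝓝 z₁, z ∈ S ↔ gradSq f z = 0) : LocallyPolarAt S z₁ := by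
  obtain ⟨C, q₁, hC, hq₁, hev⟩ := gradSq_bounds hf hB hsys
  obtain ⟨R, hR, hball⟩ := Metric.eventually_nhds_iff_ball.1
    ((hev.and hS).and (hf.eventually (by simp)))
  -- This makes `Λ - log(q + τ) ≥ 1` for all `q ≤ q₁` and `τ ≤ 1`, so `H τ` is defined and
  -- nonpositive, while on the zero set of `q` it tends to `-∞` as `τ → 0`.
  set Λ := 1 + Real.log (q₁ + 1) with hΛ
  let H : ℝ → ℝ → ℝ := fun τ t => -Real.log (Λ - Real.log (t + τ))
  have hl : ∀ τ ∈ Set.Ioc (0 : ℝ) 1, ∀ z ∈ Metric.ball z₁ R,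
      1 ≤ Λ - Real.log (gradSq f z + τ) := by
    intro τ hτ z hz
    have h1 := gradSq_nonneg f z
    have := Real.log_le_log (by linarith [hτ.1])
      (add_le_add (hball z hz).1.1.1 hτ.2)
    rw [hΛ]; linarith
  refine ⟨R, hR, fun τ z => H τ (gradSq f z), C ^ 2 / 4 + 2 * C, ?_, ?_, ?_⟩
  · intro τ hτ z hz
    have hlz := hl τ hτ z hz
    obtain ⟨⟨⟨-, s, α, hs, hα, hqs, hlap, hgr⟩, -⟩, hfz⟩ := hball z hz
    have hcq := contDiffAt_gradSq hfz
    have hq0 := gradSq_nonneg f z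
    have hτ0 := hτ.1
    have hne : gradSq f z + τ ≠ 0 := by linarith
    have hcH : ContDiffAt ℝ 2 (H τ) (gradSq f z) := by
      apply ContDiffAt.neg
      apply ContDiffAt.log
      · exact contDiffAt_const.sub ((contDiffAt_id.add contDiffAt_const).log hne)
      · linarith
    refine ⟨hcH.comp z hcq, ?_, ?_⟩
    · have hlog : ∀ t : ℝ, t + τ ≠ 0 →
          HasDerivAt (fun t => Λ - Real.log (t + τ)) (-(t + τ)⁻¹) t := fun t ht => by
        have := (((hasDerivAt_id t).add_const τ).log ht).const_sub Λ
        simpa using this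
      have hd1 : ∀ᶠ t in 𝓝 (gradSq f z), HasDerivAt (H τ)
          (((t + τ) * (Λ - Real.log (t + τ)))⁻¹) t := by
        have o1 : ∀ᶠ t in 𝓝 (gradSq f z), t + τ ≠ 0 :=
          (continuousAt_id.add continuousAt_const).eventually_ne hne
        have o2 : ∀ᶠ t in 𝓝 (gradSq f z), Λ - Real.log (t + τ) ≠ 0 :=
          (hlog _ hne).continuousAt.eventually_ne (by linarith)
        filter_upwards [o1, o2] with t h1 h2
        have := ((hlog t h1).log h2).neg
        refine this.congr_deriv ?_
        field_simp
      have hd2 : HasDerivAt (fun t => ((t + τ) * (Λ - Real.log (t + τ)))⁻¹)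
          (-((Λ - Real.log (gradSq f z + τ)) - 1) /
            ((gradSq f z + τ) * (Λ - Real.log (gradSq f z + τ))) ^ 2) (gradSq f z) := by
        have h1 := ((hasDerivAt_id (gradSq f z)).add_const τ).mul (hlog _ hne)
        have h2 := h1.inv (mul_ne_zero hne (by linarith))
        refine h2.congr_deriv ?_
        simp only [id]
        congr 1
        field_simp
        ring
      rw [laplacian_comp_real hcH hd1 hd2 hcq]
      have hκ : gradSq f z + τ = √(gradSq f z + τ) ^ 2 := (Real.sq_sqrt (by linarith)).symm
      have := logLog_laplacian_bound (κ := √(gradSq f z + τ)) hC hs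
        (Real.sqrt_pos.2 (by linarith)) (by
          apply Real.le_sqrt_of_sq_le; linarith) hlz hα hlap hgr
      rwa [← hκ] at this
    · simp only [H]
      have := Real.log_nonneg hlz
      linarith
  · intro b
    -- With `log τ ≤ Λ - exp(-b)`, the value `-log(Λ - log τ)` on `S` is at most `b`.
    refine ⟨min 1 (Real.exp (Λ - Real.exp (-b))), ⟨by positivity, min_le_left _ _⟩, ?_⟩
    intro w hw hwS
    have h0 := (hball w hw).1.2.1 hwS
    simp only [H, h0, zero_add]
    have h1 : Real.log (min 1 (Real.exp (Λ - Real.exp (-b)))) ≤ Λ - Real.exp (-b) := by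
      rw [← Real.log_exp (Λ - Real.exp (-b))]
      apply Real.log_le_log (by positivity)
      rw [Real.log_exp]
      exact min_le_right _ _
    have h2 : -b ≤ Real.log (Λ - Real.log (min 1 (Real.exp (Λ - Real.exp (-b))))) := by
      rw [Real.le_log_iff_exp_le]
      · linarith
      · linarith [Real.exp_pos (-b)]
    linarith
  · intro w hw hwS
    have hq : 0 < gradSq f w := lt_of_le_of_ne (gradSq_nonneg f w)
      (fun h => hwS ((hball w hw).1.2.2 h.symm))
    refine ⟨-Real.log (Λ - Real.log (gradSq f w)), fun τ hτ => ?_⟩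
    simp only [H]
    apply neg_le_neg
    have := hl τ hτ w hw
    apply Real.log_le_log (by linarith)
    have : Real.log (gradSq f w) ≤ Real.log (gradSq f w + τ) :=
      Real.log_le_log hq (by linarith [hτ.1])
    linarith

end HarmonicPolar


/-! ### Linear decay of subsolutions at the boundary arc -/

section Boundary

open Laplacian Filter

/-- `θ + arg(b/a)` is a parameter for `b` that is continuous at `b = a`; no bound on the length of
the arc is needed. -/
lemma eventually_mem_openArc {α β : ℝ} {a : ℂ} (ha : a ∈ openArc α β) :
    ∃ r > 0, ∀ b : ℂ, ‖b‖ = 1 → ‖b - a‖ < r → b ∈ openArc α β := by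
  obtain ⟨θ, hθ, rfl⟩ := ha
  set a := Complex.exp (θ * Complex.I) with ha
  have ha1 : ‖a‖ = 1 := Complex.norm_exp_ofReal_mul_I θ
  have ha0 : a ≠ 0 := Complex.exp_ne_zero _
  have hc : ContinuousAt (fun b : ℂ => θ + Complex.arg (b / a)) a := by
    refine continuousAt_const.add (ContinuousAt.comp (g := Complex.arg) ?_ (by fun_prop (disch := exact ha0)))
    rw [div_self ha0]
    exact Complex.continuousAt_arg (by simp [Complex.slitPlane])
  have hev : ∀ᶠ b in 𝓝 a, θ + Complex.arg (b / a) ∈ Set.Ioo α β := by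
    apply hc.eventually
    simp only [div_self ha0, Complex.arg_one, add_zero]
    exact isOpen_Ioo.mem_nhds hθ
  obtain ⟨r, hr, hball⟩ := Metric.eventually_nhds_iff_ball.1 hev
  refine ⟨r, hr, fun b hb hba => ⟨_, hball b (by rwa [Metric.mem_ball, dist_eq_norm]), ?_⟩⟩
  have h1 : ‖b / a‖ = 1 := by rw [norm_div, hb, ha1, div_one]
  have h2 := Complex.norm_mul_exp_arg_mul_I (b / a)
  rw [h1, Complex.ofReal_one, one_mul] at h2
  simp only
  push_cast
  rw [add_mul, Complex.exp_add, h2, ← ha]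
  field_simp

lemma isOpen_disc : IsOpen disc := Metric.isOpen_ball

lemma mem_disc {z : ℂ} : z ∈ disc ↔ ‖z‖ < 1 := by simp [disc]

lemma norm_openArc {α β : ℝ} {b : ℂ} (hb : b ∈ openArc α β) : ‖b‖ = 1 := by
  obtain ⟨θ, -, rfl⟩ := hb
  exact Complex.norm_exp_ofReal_mul_I θ

/-- A nonnegative subsolution on the disc which vanishes on an arc of the circle is bounded by a
multiple of the distance to the circle. -/
lemma le_mul_dist_boundary {rr : ℂ → ℝ} {α β : ℝ} {a : ℂ} (ha : a ∈ openArc α β)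
    (husc : UpperSemicontinuousOn rr disc)
    (hv : ∀ z ∈ disc, ViscAt rr 0 z)
    (hlim : ∀ b ∈ openArc α β, Tendsto rr (𝓝[disc] b) (𝓝 0)) :
    ∃ r₁ > 0, ∃ C₀ > 0, ∀ z ∈ disc, ‖z - a‖ < r₁ → rr z ≤ C₀ * (1 - ‖z‖) := by
  obtain ⟨r', hr', harc⟩ := eventually_mem_openArc ha
  have ha1 := norm_openArc ha
  set r := min (r' / 2) 1 with hr
  have hr0 : 0 < r := by positivity
  have hrr' : r < r' := (min_le_left _ _).trans_lt (by linarith)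
  have hr1 : r ≤ 1 := min_le_right _ _
  classical
  -- Extension by `0` across the arc is upper semicontinuous exactly because `rr` tends to `0`
  -- there; compactness then gives an upper bound `M` near `a`.
  let R : ℂ → ℝ := fun z => if z ∈ disc then rr z else 0
  have hRd : ∀ z ∈ disc, R z = rr z := fun z hz => if_pos hz
  have hRn : ∀ z ∉ disc, R z = 0 := fun z hz => if_neg hz
  let K : Set ℂ := Metric.closedBall 0 1 ∩ Metric.closedBall a r
  have hKc : IsCompact K := (isCompact_closedBall 0 1).inter_right Metric.isClosed_closedBall
  have hRusc : UpperSemicontinuousOn R K := by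
    intro z hz y hy
    by_cases hzd : z ∈ disc
    · rw [hRd z hzd] at hy
      have := husc z hzd y hy
      rw [isOpen_disc.nhdsWithin_eq hzd] at this
      refine Filter.Eventually.filter_mono nhdsWithin_le_nhds ?_
      filter_upwards [this, isOpen_disc.mem_nhds hzd] with w hw hwd
      rwa [hRd w hwd]
    · rw [hRn z hzd] at hy
      have hz1 : ‖z‖ = 1 := by
        have h1 : ‖z‖ ≤ 1 := by simpa using hz.1
        rw [mem_disc] at hzd; linarith
      have hz2 : ‖z - a‖ ≤ r := by simpa [dist_eq_norm] using hz.2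
      have := (hlim z (harc z hz1 (by linarith))).eventually (gt_mem_nhds hy)
      rw [eventually_nhdsWithin_iff] at this
      refine Filter.Eventually.filter_mono nhdsWithin_le_nhds ?_
      filter_upwards [this] with w hw
      by_cases hwd : w ∈ disc
      · rw [hRd w hwd]; exact hw hwd
      · rwa [hRn w hwd]
  obtain ⟨M', hM'⟩ := hRusc.bddAbove_of_isCompact hKc
  set M := |M'| + 1 with hM
  have hM0 : 0 < M := by positivity
  have hRM : ∀ z ∈ K, R z ≤ M := fun z hz => by
    have := hM' ⟨z, hz, rfl⟩
    have := le_abs_self M'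
    linarith
  set m := M / (r / 2) ^ 2 with hm
  have hm0 : 0 < m := by positivity
  refine ⟨r / 4, by positivity, 5 * m, by positivity, fun z₀ hz₀ hz₀a => ?_⟩
  have hz₀1 : ‖z₀‖ < 1 := mem_disc.1 hz₀
  have hd : 1 - ‖z₀‖ ≤ ‖z₀ - a‖ := by
    have := norm_sub_norm_le a z₀
    rw [ha1, norm_sub_rev] at this
    exact this
  have hz₀0 : 0 < ‖z₀‖ := by linarith
  set b : ℂ := ((‖z₀‖⁻¹ : ℝ) : ℂ) * z₀ with hb
  have hb1 : ‖b‖ = 1 := by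
    rw [hb, norm_mul, Complex.norm_real, Real.norm_eq_abs, abs_of_pos (by positivity)]
    field_simp
  have hbz : ‖z₀ - b‖ = 1 - ‖z₀‖ := by
    have : z₀ - b = ((1 - ‖z₀‖⁻¹ : ℝ) : ℂ) * z₀ := by rw [hb]; push_cast; ring
    rw [this, norm_mul, Complex.norm_real, Real.norm_eq_abs, abs_of_nonpos]
    · field_simp; ring
    · have := one_le_inv_iff₀.2 ⟨hz₀0, hz₀1.le⟩
      linarith
  have hba : ‖b - a‖ ≤ r / 2 := by
    have : b - a = (z₀ - a) - (z₀ - b) := by ring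
    rw [this]
    refine (norm_sub_le _ _).trans ?_
    rw [hbz]; linarith
  let K' : Set ℂ := Metric.closedBall 0 1 ∩ Metric.closedBall b (r / 2)
  have hK'K : K' ⊆ K := fun z hz => ⟨hz.1, by
    have h2 : ‖z - b‖ ≤ r / 2 := by simpa [dist_eq_norm] using hz.2
    have : z - a = (z - b) + (b - a) := by ring
    rw [Metric.mem_closedBall, dist_eq_norm, this]
    exact (norm_add_le _ _).trans (by linarith)⟩
  have hK'c : IsCompact K' := (isCompact_closedBall 0 1).inter_right Metric.isClosed_closedBall
  -- The barrier is `m|z - b|² + 2m(1 - |z|²)`, with `b` the foot of `z₀` on the circle. Its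
  -- Laplacian is `4m - 8m < 0`; it is nonnegative on the circle, at least `M` where `|z - b| =
  -- r/2`, and at most `5m(1 - |z₀|)` at `z₀`.
  let h : ℂ → ℝ := fun z => (m * ‖z - b‖ ^ 2 - 2 * m * ‖z - 0‖ ^ 2) + 2 * m
  have hc1 : ∀ z, ContDiffAt ℝ 2 (fun z => m * ‖z - b‖ ^ 2) z := fun z =>
    contDiffAt_const.mul (contDiffAt_normSq_sub b z)
  have hc2 : ∀ z, ContDiffAt ℝ 2 (fun z : ℂ => 2 * m * ‖z - 0‖ ^ 2) z := fun z =>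
    contDiffAt_const.mul (contDiffAt_normSq_sub 0 z)
  have hhc : ∀ z, ContDiffAt ℝ 2 h z := fun z => ((hc1 z).sub (hc2 z)).add contDiffAt_const
  have hΔ : ∀ z, (Δ h) z = -4 * m := fun z => by
    rw [laplacian_fun_add ((hc1 z).sub (hc2 z)) contDiffAt_const, laplacian_fun_const,
      laplacian_fun_sub (hc1 z) (hc2 z), laplacian_const_mul _ (contDiffAt_normSq_sub b z),
      laplacian_const_mul _ (contDiffAt_normSq_sub 0 z), laplacian_normSq_sub,
      laplacian_normSq_sub]
    ring
  have hz₀K' : z₀ ∈ K' := ⟨by simpa using hz₀1.le, by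
    rw [Metric.mem_closedBall, dist_eq_norm, hbz]; linarith⟩
  have husc' : UpperSemicontinuousOn (fun z => R z + (-h z)) K' :=
    (hRusc.mono hK'K).add (ContinuousOn.upperSemicontinuousOn fun z _ =>
      (hhc z).continuousAt.neg.continuousWithinAt)
  obtain ⟨z₁, hz₁, hmax⟩ := husc'.exists_isMaxOn ⟨z₀, hz₀K'⟩ hK'c
  have hz₁1 : ‖z₁‖ ≤ 1 := by simpa using hz₁.1
  have hz₁b : ‖z₁ - b‖ ≤ r / 2 := by simpa [dist_eq_norm] using hz₁.2
  have hle : R z₁ - h z₁ ≤ 0 := by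
    rcases hz₁1.eq_or_lt with heq | hlt
    · rw [hRn z₁ (by rw [mem_disc]; linarith)]
      simp only [h, sub_zero, heq]
      have : 0 ≤ m * ‖z₁ - b‖ ^ 2 := by positivity
      linarith
    rcases hz₁b.eq_or_lt with heq | hlt'
    · have h1 := hRM z₁ (hK'K hz₁)
      have h2 : m * ‖z₁ - b‖ ^ 2 = M := by rw [heq, hm]; field_simp
      have h3 : m * ‖z₁‖ ^ 2 ≤ m * 1 := by
        gcongr
        nlinarith [norm_nonneg z₁]
      simp only [h, sub_zero]
      linarith
    · exfalso
      have hloc : IsLocalMax (fun z => rr z - h z) z₁ := by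
        have o : IsOpen (disc ∩ Metric.ball b (r / 2)) := isOpen_disc.inter Metric.isOpen_ball
        have hz₁o : z₁ ∈ disc ∩ Metric.ball b (r / 2) :=
          ⟨mem_disc.2 hlt, by rwa [Metric.mem_ball, dist_eq_norm]⟩
        filter_upwards [o.mem_nhds hz₁o] with z hz
        have := hmax (show z ∈ K' from ⟨Metric.ball_subset_closedBall hz.1,
          Metric.ball_subset_closedBall hz.2⟩)
        simp only [Set.mem_ofPred_eq] at this
        rw [hRd z hz.1, hRd z₁ hz₁o.1] at this
        linarith
      have := hv z₁ (mem_disc.2 hlt) h (hhc z₁) hloc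
      rw [hΔ] at this
      linarith
  have hfin : R z₀ + (-h z₀) ≤ R z₁ + (-h z₁) := hmax hz₀K'
  rw [hRd z₀ hz₀] at hfin
  have h1 : rr z₀ ≤ h z₀ := by linarith
  refine h1.trans ?_
  simp only [h, sub_zero, hbz]
  have hd0 : 0 ≤ 1 - ‖z₀‖ := by linarith
  have h2 : m * (1 - ‖z₀‖) ^ 2 ≤ m * (1 - ‖z₀‖) := by
    gcongr; nlinarith
  have h3 : m * (1 - ‖z₀‖ ^ 2) ≤ m * (2 * (1 - ‖z₀‖)) := by
    gcongr; nlinarith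
  linarith

end Boundary

/-! ### Logarithmic poles along conformal maps -/

section Pole

open Laplacian Filter

variable {Y : Type*} [NormedAddCommGroup Y] [InnerProductSpace ℝ Y]

/-- The bilinear forms `g y`, `‖y‖ < R`, are symmetric, uniformly elliptic and Lipschitz in `y`. -/
structure MetricBounds (g : Y → Y →L[ℝ] Y →L[ℝ] ℝ) (R m Mg Lg : ℝ) : Prop where
  m_pos : 0 < m
  Mg_nonneg : 0 ≤ Mg
  Lg_nonneg : 0 ≤ Lg
  symm : ∀ y, ‖y‖ < R → ∀ v w, g y v w = g y w v
  lower : ∀ y, ‖y‖ < R → ∀ v, m ^ 2 * ‖v‖ ^ 2 ≤ g y v v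
  upper : ∀ y, ‖y‖ < R → ∀ v w, |g y v w| ≤ Mg * ‖v‖ * ‖w‖
  lipschitz : ∀ y, ‖y‖ < R → ∀ c, ‖c‖ < R → ∀ v w, |g y v w - g c v w| ≤
    Lg * ‖y - c‖ * ‖v‖ * ‖w‖

lemma MetricBounds.cauchySchwarz {g : Y → Y →L[ℝ] Y →L[ℝ] ℝ} {R m Mg Lg : ℝ}
    (hg : MetricBounds g R m Mg Lg) {c : Y} (hc : ‖c‖ < R) (v w : Y) :
    (g c v w) ^ 2 ≤ g c v v * g c w w := by
  have hpos : ∀ x, 0 ≤ g c x x := fun x =>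
    (by positivity : (0 : ℝ) ≤ m ^ 2 * ‖x‖ ^ 2).trans (hg.lower c hc x)
  have key : ∀ t : ℝ, 0 ≤ g c w w * (t * t) + (2 * g c v w) * t + g c v v := fun t => by
    have := hpos (v + t • w)
    simp only [map_add, map_smul, _root_.add_apply, _root_.smul_apply, smul_eq_mul]
      at this
    rw [hg.symm c hc w v] at this
    linarith
  have := discrim_le_zero key
  unfold discrim at this
  nlinarith

/-- A regularization of `log ‖f - c‖`, plus a multiple of `‖f - c‖`, both with respect to the
scalar product `g c`. -/
noncomputable def poleFn (g : Y → Y →L[ℝ] Y →L[ℝ] ℝ) (c : Y) (τ K₁ : ℝ) (f : ℂ → Y) (z : ℂ) : ℝ :=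
  1 / 2 * Real.log (g c (f z - c) (f z - c) + τ) + K₁ * √(g c (f z - c) (f z - c) + τ)

/-- Here `N = n²` is the regularized `|f - c|²`, `lapN` and `grN` are its Laplacian and squared
gradient, `w = |f - c|`, `q = |df|²`, and `lam` is the conformal factor. In the logarithm the
leading terms `4 lam` cancel, leaving errors of order `w q / N` from freezing the metric at `c` and
from `Δf ≠ 0`. The term `K₁ √N` contributes `K₁ lam / n`, which dominates them because `m w ≤ n`:
the size of `K₁` handles its error-free part, and the smallness of `ρ` the errors that `K₁ √N`
itself produces. -/
lemma pole_algebra {N n q lam w lapN grN a Lg m K₁ ρ G : ℝ} (hn : 0 < n) (hN : N = n ^ 2)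
    (hm : 0 < m) (hq : 0 ≤ q) (hw : 0 ≤ w) (ha : 0 ≤ a) (hL : 0 ≤ Lg) (hK : 0 ≤ K₁)
    (hlam : m ^ 2 * q ≤ 2 * lam) (hwn : m * w ≤ n) (hwρ : w ≤ ρ)
    (hρ : ρ * (a + Lg) ≤ m ^ 2 / 4) (hK₁ : 4 * (a + 2 * Lg) ≤ K₁ * m ^ 3)
    (hlap : 4 * lam - 2 * a * w * q ≤ lapN) (hG : G ≤ N)
    (hgr : grN ≤ 4 * (G * (lam + Lg * w * q))) :
    0 ≤ (-1 / (2 * N ^ 2) - K₁ / (4 * N * n)) * grN + (1 / (2 * N) + K₁ / (2 * n)) * lapN := by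
  have hlam0 : 0 ≤ lam := by nlinarith [mul_nonneg (sq_nonneg m) hq]
  have h1 : grN ≤ 4 * (N * (lam + Lg * w * q)) := hgr.trans (by
    have : 0 ≤ lam + Lg * w * q := by positivity
    gcongr)
  have h2 : (-1 / (2 * N ^ 2) - K₁ / (4 * N * n)) * (4 * (N * (lam + Lg * w * q))) ≤
      (-1 / (2 * N ^ 2) - K₁ / (4 * N * n)) * grN := by
    apply mul_le_mul_of_nonpos_left h1
    have e1 : 0 ≤ 1 / (2 * N ^ 2) := by positivity
    have e2 : 0 ≤ K₁ / (4 * N * n) := by rw [hN]; positivity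
    rw [neg_div]; linarith
  have h3 : (1 / (2 * N) + K₁ / (2 * n)) * (4 * lam - 2 * a * w * q) ≤
      (1 / (2 * N) + K₁ / (2 * n)) * lapN := by
    have : 0 ≤ 1 / (2 * N) + K₁ / (2 * n) := by rw [hN]; positivity
    gcongr
  refine le_trans ?_ (add_le_add h2 h3)
  have e : (-1 / (2 * N ^ 2) - K₁ / (4 * N * n)) * (4 * (N * (lam + Lg * w * q))) +
      (1 / (2 * N) + K₁ / (2 * n)) * (4 * lam - 2 * a * w * q) =
      (K₁ * n * lam - w * q * ((a + 2 * Lg) + K₁ * n * (a + Lg))) / n ^ 2 := by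
    rw [hN]; field_simp; ring
  rw [e]
  apply div_nonneg _ (by positivity)
  have k1 : w * q * (a + 2 * Lg) ≤ n * q * (K₁ * m ^ 2 / 4) := by
    have : m * (w * q * (a + 2 * Lg)) ≤ m * (n * q * (K₁ * m ^ 2 / 4)) := by
      calc m * (w * q * (a + 2 * Lg)) = (m * w) * (q * (a + 2 * Lg)) := by ring
        _ ≤ n * (q * (K₁ * m ^ 3 / 4)) := by
            gcongr
            linarith
        _ = _ := by ring
    exact le_of_mul_le_mul_left this hm
  have k2 : w * q * (K₁ * n * (a + Lg)) ≤ K₁ * n * q * (m ^ 2 / 4) := by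
    calc w * q * (K₁ * n * (a + Lg)) = K₁ * n * q * (w * (a + Lg)) := by ring
      _ ≤ K₁ * n * q * (m ^ 2 / 4) := by
          gcongr
          refine le_trans ?_ hρ
          gcongr
  have k3 : K₁ * n * (m ^ 2 * q) ≤ K₁ * n * (2 * lam) := by gcongr
  linarith

variable {g : Y → Y →L[ℝ] Y →L[ℝ] ℝ} {R m Mg Lg : ℝ}

/-- Bessel's inequality: conformality makes `P` and `Q` orthogonal and of equal length for `g y`,
and replacing `g y` by `g c` costs the Lipschitz term. Without conformality the bound would contain
`g y P P + g y Q Q`, twice as much, and the logarithm would not be subharmonic. The proof is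
Cauchy–Schwarz against `V = x₁ P + x₂ Q`. -/
lemma MetricBounds.sq_add_sq_le (hg : MetricBounds g R m Mg Lg) {y c P Q : Y} (hy : ‖y‖ < R)
    (hc : ‖c‖ < R) (hconf : g y P P = g y Q Q) (hconf' : g y P Q = 0) (w : Y) :
    (g c w P) ^ 2 + (g c w Q) ^ 2 ≤
      g c w w * (g y P P + Lg * ‖y - c‖ * (‖P‖ ^ 2 + ‖Q‖ ^ 2)) := by
  obtain ⟨x₁, hx₁⟩ : ∃ x, g c w P = x := ⟨_, rfl⟩
  obtain ⟨x₂, hx₂⟩ : ∃ x, g c w Q = x := ⟨_, rfl⟩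
  obtain ⟨V, hV⟩ : ∃ V, V = x₁ • P + x₂ • Q := ⟨_, rfl⟩
  have hLg := hg.Lg_nonneg
  rw [hx₁, hx₂]
  have h1 : x₁ ^ 2 + x₂ ^ 2 = g c w V := by
    rw [hV, map_add, map_smul, map_smul, smul_eq_mul, smul_eq_mul, hx₁, hx₂]; ring
  have h2 := hg.cauchySchwarz hc w V
  have h3 : g y V V = g y P P * (x₁ ^ 2 + x₂ ^ 2) := by
    simp only [hV, map_add, map_smul, smul_eq_mul, _root_.add_apply, _root_.smul_apply]
    rw [hg.symm _ hy Q P, hconf', ← hconf]; ring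
  have h4 : ‖V‖ ^ 2 ≤ (x₁ ^ 2 + x₂ ^ 2) * (‖P‖ ^ 2 + ‖Q‖ ^ 2) := by
    have : ‖V‖ ≤ |x₁| * ‖P‖ + |x₂| * ‖Q‖ := by
      rw [hV]
      refine (norm_add_le _ _).trans ?_
      rw [norm_smul, norm_smul, Real.norm_eq_abs, Real.norm_eq_abs]
    have h5 : ‖V‖ ^ 2 ≤ (|x₁| * ‖P‖ + |x₂| * ‖Q‖) ^ 2 := by gcongr
    have := sq_abs x₁
    have := sq_abs x₂
    nlinarith [sq_nonneg (|x₁| * ‖Q‖ - |x₂| * ‖P‖)]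
  have h5 := (abs_le.1 (hg.lipschitz y hy c hc V V)).1
  have h6 : g c V V ≤ (x₁ ^ 2 + x₂ ^ 2) * (g y P P + Lg * ‖y - c‖ * (‖P‖ ^ 2 + ‖Q‖ ^ 2)) := by
    have : Lg * ‖y - c‖ * ‖V‖ ^ 2 ≤
        Lg * ‖y - c‖ * ((x₁ ^ 2 + x₂ ^ 2) * (‖P‖ ^ 2 + ‖Q‖ ^ 2)) := by gcongr
    rw [h3] at h5
    linarith
  have hw0 : 0 ≤ g c w w :=
    (by positivity : (0 : ℝ) ≤ m ^ 2 * ‖w‖ ^ 2).trans (hg.lower c hc w)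
  have hP0 : 0 ≤ g y P P :=
    (by positivity : (0 : ℝ) ≤ m ^ 2 * ‖P‖ ^ 2).trans (hg.lower y hy P)
  rw [← h1] at h2
  have h7 : (x₁ ^ 2 + x₂ ^ 2) * (x₁ ^ 2 + x₂ ^ 2) ≤ (x₁ ^ 2 + x₂ ^ 2) *
      (g c w w * (g y P P + Lg * ‖y - c‖ * (‖P‖ ^ 2 + ‖Q‖ ^ 2))) := by
    have := mul_le_mul_of_nonneg_left h6 hw0
    linarith
  have h0 : 0 ≤ x₁ ^ 2 + x₂ ^ 2 := by positivity
  rcases h0.eq_or_lt with h | h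
  · rw [← h]; positivity
  · exact le_of_mul_le_mul_left h7 h

lemma contDiffAt_logSqrt (K₁ : ℝ) {t : ℝ} (ht : 0 < t) :
    ContDiffAt ℝ 2 (fun t => 1 / 2 * Real.log t + K₁ * √t) t :=
  (contDiffAt_const.mul (Real.contDiffAt_log.2 ht.ne')).add
    (contDiffAt_const.mul (Real.contDiffAt_sqrt ht.ne'))

lemma hasDerivAt_logSqrt (K₁ : ℝ) {t : ℝ} (ht : 0 < t) :
    HasDerivAt (fun t => 1 / 2 * Real.log t + K₁ * √t) (1 / (2 * t) + K₁ / (2 * √t)) t := by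
  have := ((Real.hasDerivAt_log ht.ne').const_mul (1 / 2)).add
    ((Real.hasDerivAt_sqrt ht.ne').const_mul K₁)
  refine this.congr_deriv ?_
  field_simp

lemma hasDerivAt_logSqrt_deriv (K₁ : ℝ) {t : ℝ} (ht : 0 < t) :
    HasDerivAt (fun t => 1 / (2 * t) + K₁ / (2 * √t)) (-1 / (2 * t ^ 2) - K₁ / (4 * t * √t)) t := by
  have hs0 : 0 < √t := Real.sqrt_pos.2 ht
  have hss : √t ^ 2 = t := Real.sq_sqrt ht.le
  have d1 := (hasDerivAt_const t (1 : ℝ)).fun_div ((hasDerivAt_id' t).const_mul 2) (by positivity)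
  have d2 := (hasDerivAt_const t K₁).fun_div ((Real.hasDerivAt_sqrt ht.ne').const_mul 2)
    (by positivity)
  refine (d1.fun_add d2).congr_deriv ?_
  have h3 : √t ^ 3 = t * √t := by rw [pow_succ, hss]
  field_simp
  rw [hss]
  linear_combination (-8) * h3

section SymmetricForm

variable {b : Y →L[ℝ] Y →L[ℝ] ℝ} {f : ℂ → Y} {z : ℂ} {c : Y} {τ : ℝ}

lemma dirD_fun_sub_const (v x : ℂ) (f : ℂ → Y) (c : Y) :
    dirD v (fun z => f z - c) x = dirD v f x := by
  unfold dirD; rw [fderiv_sub_const]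

lemma laplacian_fun_sub_const (hf : ContDiffAt ℝ 2 f z) (c : Y) :
    (Δ (fun z => f z - c)) z = (Δ f) z := by
  rw [laplacian_eq_dirD (hf.sub contDiffAt_const), laplacian_eq_dirD hf]
  have e : ∀ v, dirD v (fun z => f z - c) = dirD v f := fun v =>
    funext fun x => dirD_fun_sub_const v x f c
  rw [e, e]

lemma contDiffAt_form (b : Y →L[ℝ] Y →L[ℝ] ℝ) (c : Y) (τ : ℝ) (hf : ContDiffAt ℝ 2 f z) :
    ContDiffAt ℝ 2 (fun z => b (f z - c) (f z - c) + τ) z :=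
  (contDiffAt_bilin b (hf.sub contDiffAt_const) (hf.sub contDiffAt_const)).add contDiffAt_const

lemma laplacian_form (hb : ∀ v w, b v w = b w v) (c : Y) (τ : ℝ) (hf : ContDiffAt ℝ 2 f z) :
    (Δ (fun z => b (f z - c) (f z - c) + τ)) z = 2 * b (f z - c) ((Δ f) z) +
      2 * (b (dirD 1 f z) (dirD 1 f z) + b (dirD Complex.I f z) (dirD Complex.I f z)) := by
  have hfc : ContDiffAt ℝ 2 (fun z => f z - c) z := hf.sub contDiffAt_const
  rw [laplacian_fun_add (contDiffAt_bilin b hfc hfc) contDiffAt_const, laplacian_fun_const,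
    laplacian_bilin b hfc hfc, laplacian_fun_sub_const hf, dirD_fun_sub_const,
    dirD_fun_sub_const, hb _ (f z - c)]
  simp only [smul_eq_mul]
  ring

lemma dirD_form (hb : ∀ v w, b v w = b w v) (c : Y) (τ : ℝ) (hf : ContDiffAt ℝ 2 f z) (v : ℂ) :
    dirD v (fun z => b (f z - c) (f z - c) + τ) z = 2 * b (f z - c) (dirD v f z) := by
  have hdf : DifferentiableAt ℝ (fun z => f z - c) z :=
    (hf.sub contDiffAt_const).differentiableAt (by norm_num)
  have e : dirD v (fun z => b (f z - c) (f z - c) + τ) z =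
      dirD v (fun z => b (f z - c) (f z - c)) z := by
    unfold dirD; rw [fderiv_add_const]
  rw [e, dirD_bilin b hdf hdf, dirD_fun_sub_const, hb (dirD v f z)]
  ring

end SymmetricForm

lemma contDiffAt_poleFn (hg : MetricBounds g R m Mg Lg) {f : ℂ → Y} {z : ℂ} {c : Y} {τ : ℝ}
    (K₁ : ℝ) (hf : ContDiffAt ℝ 2 f z) (hc : ‖c‖ < R) (hτ : 0 < τ) :
    ContDiffAt ℝ 2 (poleFn g c τ K₁ f) z := by
  have hgw := hg.lower c hc (f z - c)
  have hN0 : 0 < g c (f z - c) (f z - c) + τ := by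
    have : 0 ≤ m ^ 2 * ‖f z - c‖ ^ 2 := by positivity
    linarith
  exact (contDiffAt_logSqrt K₁ hN0).comp z (contDiffAt_form (g c) c τ hf)

/-- The regularized logarithmic pole is subharmonic along a conformal solution of the system. -/
lemma laplacian_poleFn_nonneg (hg : MetricBounds g R m Mg Lg) {f : ℂ → Y} {z : ℂ} {c : Y}
    {K K₁ τ : ℝ} (hK : 0 ≤ K) (hK₁0 : 0 ≤ K₁)
    (hf : ContDiffAt ℝ 2 f z) (hfz : ‖f z‖ < R) (hc : ‖c‖ < R) (hτ : 0 < τ)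
    (hΔ : ‖(Δ f) z‖ ≤ K * gradSq f z)
    (hconf : g (f z) (dirD 1 f z) (dirD 1 f z) =
      g (f z) (dirD Complex.I f z) (dirD Complex.I f z))
    (hconf' : g (f z) (dirD 1 f z) (dirD Complex.I f z) = 0)
    (hR : 2 * R * ((Lg + Mg * K) + Lg) ≤ m ^ 2 / 4)
    (hK₁ : 4 * ((Lg + Mg * K) + 2 * Lg) ≤ K₁ * m ^ 3) :
    0 ≤ (Δ (poleFn g c τ K₁ f)) z := by
  have hm := hg.m_pos
  have hMg := hg.Mg_nonneg
  have hLg := hg.Lg_nonneg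
  have hsymm := hg.symm c hc
  obtain ⟨N, hN⟩ : ∃ N, g c (f z - c) (f z - c) + τ = N := ⟨_, rfl⟩
  have hgw := hg.lower c hc (f z - c)
  have hN0 : 0 < N := by
    have : 0 ≤ m ^ 2 * ‖f z - c‖ ^ 2 := by positivity
    linarith
  have hwN : m * ‖f z - c‖ ≤ √N := by
    apply Real.le_sqrt_of_sq_le
    rw [mul_pow]; linarith
  have hq : gradSq f z = ‖dirD 1 f z‖ ^ 2 + ‖dirD Complex.I f z‖ ^ 2 := rfl
  have hlamq : m ^ 2 * gradSq f z ≤ 2 * g (f z) (dirD 1 f z) (dirD 1 f z) := by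
    have h1 := hg.lower _ hfz (dirD 1 f z)
    have h2 := hg.lower _ hfz (dirD Complex.I f z)
    rw [← hconf] at h2
    rw [hq]; linarith
  have hlap' : 4 * g (f z) (dirD 1 f z) (dirD 1 f z) -
      2 * (Lg + Mg * K) * ‖f z - c‖ * gradSq f z ≤
      (Δ (fun z => g c (f z - c) (f z - c) + τ)) z := by
    have h1 := (abs_le.1 (hg.lipschitz (f z) hfz c hc (dirD 1 f z) (dirD 1 f z))).2
    have h2 := (abs_le.1 (hg.lipschitz (f z) hfz c hc (dirD Complex.I f z)
      (dirD Complex.I f z))).2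
    have h3 : |g c (f z - c) ((Δ f) z)| ≤ Mg * ‖f z - c‖ * (K * gradSq f z) :=
      (hg.upper c hc _ _).trans (by gcongr)
    have h4 := (abs_le.1 h3).1
    rw [laplacian_form hsymm c τ hf]
    rw [← hconf] at h2
    rw [hq] at *
    linarith
  have hgr : (dirD 1 (fun z => g c (f z - c) (f z - c) + τ) z) ^ 2 +
      (dirD Complex.I (fun z => g c (f z - c) (f z - c) + τ) z) ^ 2 ≤
      4 * (g c (f z - c) (f z - c) *
        (g (f z) (dirD 1 f z) (dirD 1 f z) + Lg * ‖f z - c‖ * gradSq f z)) := by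
    rw [dirD_form hsymm c τ hf, dirD_form hsymm c τ hf, hq]
    have := hg.sq_add_sq_le hfz hc hconf hconf' (f z - c)
    linarith
  have hlapG : (Δ (poleFn g c τ K₁ f)) z = _ := laplacian_comp_real
    (H := fun t => 1 / 2 * Real.log t + K₁ * √t)
    (H' := fun t => 1 / (2 * t) + K₁ / (2 * √t)) (H'' := -1 / (2 * N ^ 2) - K₁ / (4 * N * √N))
    (q := fun z => g c (f z - c) (f z - c) + τ) (z := z)
    (by rw [hN]; exact contDiffAt_logSqrt K₁ hN0)
    (by
      rw [hN]
      filter_upwards [lt_mem_nhds hN0] with t ht using hasDerivAt_logSqrt K₁ ht)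
    (by rw [hN]; exact hasDerivAt_logSqrt_deriv K₁ hN0)
    (contDiffAt_form (g c) c τ hf)
  rw [hlapG, hN]
  exact pole_algebra (Real.sqrt_pos.2 hN0) (Real.sq_sqrt hN0.le).symm hm (gradSq_nonneg f z)
    (norm_nonneg (f z - c)) (by positivity) hLg hK₁0 hlamq hwN (ρ := 2 * R)
    ((norm_sub_le _ _).trans (by linarith)) hR hK₁ hlap' (G := g c (f z - c) (f z - c))
    (by linarith) hgr

end Pole


/-! ### Gluing a local subsolution to zero by a maximum -/

section Glue

open Laplacian Filter

/-- The function `T` where `ν < s`, glued to `0` where `2 s < ν` by a maximum. -/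
noncomputable def glue (Ω : Set ℂ) (ν T : ℂ → ℝ) (s : ℝ) (z : ℂ) : ℝ := by
  classical exact if z ∈ Ω ∧ ν z < s then T z else if z ∈ Ω ∧ ν z ≤ 2 * s then max (T z) 0 else 0

variable {Ω : Set ℂ} {ν T : ℂ → ℝ} {s : ℝ} {z : ℂ}

lemma glue_of_lt (hz : z ∈ Ω) (h : ν z < s) : glue Ω ν T s z = T z := by
  unfold glue; rw [if_pos ⟨hz, h⟩]

lemma glue_of_le (hz : z ∈ Ω) (h : s ≤ ν z) (h' : ν z ≤ 2 * s) :
    glue Ω ν T s z = max (T z) 0 := by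
  unfold glue; rw [if_neg (fun H => absurd H.2 (not_lt.2 h)), if_pos ⟨hz, h'⟩]

lemma glue_of_not (hs : 0 ≤ s) (h : ¬ (z ∈ Ω ∧ ν z ≤ 2 * s)) : glue Ω ν T s z = 0 := by
  unfold glue; rw [if_neg (fun H => h ⟨H.1, by linarith [H.2]⟩), if_neg h]

lemma glue_le (hs : 0 ≤ s) {b : ℝ} (hb : 0 ≤ b) (h : z ∈ Ω → ν z ≤ 2 * s → T z ≤ b) :
    glue Ω ν T s z ≤ b := by
  by_cases h1 : z ∈ Ω ∧ ν z ≤ 2 * s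
  · rcases lt_or_ge (ν z) s with h2 | h2
    · rw [glue_of_lt h1.1 h2]; exact h h1.1 h1.2
    · rw [glue_of_le h1.1 h2 h1.2]; exact max_le (h h1.1 h1.2) hb
  · rw [glue_of_not hs h1]; exact hb

lemma le_glue (hz : z ∈ Ω) (h : ν z ≤ 2 * s) : T z ≤ glue Ω ν T s z := by
  rcases lt_or_ge (ν z) s with h2 | h2
  · rw [glue_of_lt hz h2]
  · rw [glue_of_le hz h2 h]; exact le_max_left _ _

lemma glue_le_max (hs : 0 ≤ s) : glue Ω ν T s z ≤ max (T z) 0 := by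
  by_cases h1 : z ∈ Ω ∧ ν z ≤ 2 * s
  · rcases lt_or_ge (ν z) s with h2 | h2
    · rw [glue_of_lt h1.1 h2]; exact le_max_left _ _
    · rw [glue_of_le h1.1 h2 h1.2]
  · rw [glue_of_not hs h1]; exact le_max_right _ _

lemma mem_of_glue_neg (hs : 0 ≤ s) (h : glue Ω ν T s z < 0) : z ∈ Ω ∧ ν z < s := by
  by_contra h1
  by_cases h2 : z ∈ Ω ∧ ν z ≤ 2 * s
  · rw [glue_of_le h2.1 (not_lt.1 fun h3 => h1 ⟨h2.1, h3⟩) h2.2] at h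
    exact absurd h (not_lt.2 (le_max_right _ _))
  · rw [glue_of_not hs h2] at h; exact lt_irrefl _ h

lemma upperSemicontinuousAt_glue (hΩ : IsOpen Ω) (hs : 0 ≤ s)
    (hν : ∀ z ∈ Ω, ContinuousAt ν z) (hT : ∀ z ∈ Ω, ContinuousAt T z)
    (hcl : ¬ (z ∈ Ω ∧ ν z ≤ 2 * s) → ∀ᶠ w in 𝓝 z, ¬ (w ∈ Ω ∧ ν w ≤ 2 * s)) :
    UpperSemicontinuousAt (glue Ω ν T s) z := by
  intro y hy
  by_cases h1 : z ∈ Ω ∧ ν z ≤ 2 * s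
  · rcases lt_or_ge (ν z) s with h2 | h2
    · rw [glue_of_lt h1.1 h2] at hy
      filter_upwards [hΩ.mem_nhds h1.1, (hν z h1.1).eventually (gt_mem_nhds h2),
        (hT z h1.1).eventually (gt_mem_nhds hy)] with w w1 w2 w3
      rwa [glue_of_lt w1 w2]
    · rw [glue_of_le h1.1 h2 h1.2] at hy
      have hc : ContinuousAt (fun w => max (T w) 0) z := (hT z h1.1).max continuousAt_const
      filter_upwards [hc.eventually (gt_mem_nhds hy)] with w hw
      exact (glue_le_max hs).trans_lt hw
  · rw [glue_of_not hs h1] at hy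
    filter_upwards [hcl h1] with w hw
    rwa [glue_of_not hs hw]

/-- The glued function inherits the maximum principle. -/
lemma not_isLocalMax_glue {rr ψ : ℂ → ℝ} {d m : ℝ} (hΩ : IsOpen Ω) (hs : 0 ≤ s) (hd : 0 < d)
    (hν : ∀ z ∈ Ω, ContinuousAt ν z)
    (hT : z ∈ Ω → ContDiffAt ℝ 2 T z)
    (hcl : ¬ (z ∈ Ω ∧ ν z ≤ 2 * s) → ∀ᶠ w in 𝓝 z, ¬ (w ∈ Ω ∧ ν w ≤ 2 * s))
    (hpos : z ∈ Ω → ν z = s → 0 < T z) (hneg : z ∈ Ω → ν z = 2 * s → T z < 0)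
    (hv0 : ViscAt rr 0 z) (hv : z ∈ Ω → ViscAt rr m z) (hm : z ∈ Ω → 0 ≤ m + d * (Δ T) z)
    (hψ : ContDiffAt ℝ 2 ψ z) (hψΔ : 0 < (Δ ψ) z) :
    ¬ IsLocalMax (fun w => rr w / d + glue Ω ν T s w + ψ w) z := by
  intro hmax
  -- If the glued function equals `T` at the point and is at least `T` nearby, a local maximum of
  -- the sum is also one with `T` in place of the glued function, and `T` is smooth enough to serve
  -- in a test function. The same is done with `0` in `case0`.
  have caseT : z ∈ Ω → glue Ω ν T s z = T z → (∀ᶠ w in 𝓝 z, T w ≤ glue Ω ν T s w) → False := by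
    intro hz he hev
    have hloc : IsLocalMax (fun w => rr w - (-d * (T w + ψ w))) z := by
      filter_upwards [hmax, hev] with w h1 h2
      rw [he] at h1
      have h3 : rr w / d + T w + ψ w ≤ rr z / d + T z + ψ z := by linarith
      have h4 := mul_le_mul_of_nonneg_left h3 hd.le
      have e : ∀ x, d * (rr x / d + T x + ψ x) = rr x - (-d * (T x + ψ x)) := fun x => by
        field_simp; ring
      rwa [e, e] at h4
    have := hv hz _ (contDiffAt_const.mul ((hT hz).add hψ)) hloc
    rw [laplacian_const_mul _ ((hT hz).add hψ), laplacian_fun_add (hT hz) hψ] at this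
    have := hm hz
    nlinarith
  have case0 : glue Ω ν T s z = 0 → (∀ᶠ w in 𝓝 z, 0 ≤ glue Ω ν T s w) → False := by
    intro he hev
    have hloc : IsLocalMax (fun w => rr w - (-d * ψ w)) z := by
      filter_upwards [hmax, hev] with w h1 h2
      rw [he] at h1
      have h3 : rr w / d + ψ w ≤ rr z / d + ψ z := by linarith
      have h4 := mul_le_mul_of_nonneg_left h3 hd.le
      have e : ∀ x, d * (rr x / d + ψ x) = rr x - (-d * ψ x) := fun x => by
        field_simp; ring
      rwa [e, e] at h4
    have := hv0 _ (contDiffAt_const.mul hψ) hloc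
    rw [laplacian_const_mul _ hψ] at this
    nlinarith
  by_cases h1 : z ∈ Ω ∧ ν z ≤ 2 * s
  · rcases lt_or_ge (ν z) s with h2 | h2
    · apply caseT h1.1 (glue_of_lt h1.1 h2)
      filter_upwards [hΩ.mem_nhds h1.1, (hν z h1.1).eventually (gt_mem_nhds h2)] with w w1 w2
      rw [glue_of_lt w1 w2]
    -- In the overlap the sign of `T` decides. A positive `T` keeps `z` off the outer edge `ν = 2s`,
    -- where `T < 0`; a nonpositive `T` keeps it off the inner edge `ν = s`, where `T > 0`.
    · rcases lt_or_ge 0 (T z) with h3 | h3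
      · have hlt : ν z < 2 * s := lt_of_le_of_ne h1.2 fun h => by linarith [hneg h1.1 h]
        apply caseT h1.1
        · rw [glue_of_le h1.1 h2 h1.2, max_eq_left h3.le]
        · filter_upwards [hΩ.mem_nhds h1.1, (hν z h1.1).eventually (gt_mem_nhds hlt)] with w w1 w2
          exact le_glue w1 w2.le
      · have hlt : s < ν z := lt_of_le_of_ne h2 fun h => by linarith [hpos h1.1 h.symm]
        apply case0
        · rw [glue_of_le h1.1 h2 h1.2, max_eq_right h3]
        · filter_upwards [(hν z h1.1).eventually (lt_mem_nhds hlt)] with w w2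
          by_contra hn
          have := (mem_of_glue_neg hs (not_le.1 hn)).2
          linarith
  · apply case0 (glue_of_not hs h1)
    filter_upwards [hcl h1] with w hw
    rw [glue_of_not hs hw]

end Glue

/-! ### The key estimate at the scale of the distance to the boundary -/

section KeyEstimate

open Laplacian Filter

variable {Y : Type*} [NormedAddCommGroup Y] [InnerProductSpace ℝ Y]

/-- The part `Ω` of the disc which a conformal harmonic disc maps into the coordinate ball of
radius `R`, together with the coordinate expression `f` of the disc. -/
structure ConformalModel (g : Y → Y →L[ℝ] Y →L[ℝ] ℝ) (f : ℂ → Y) (Ω : Set ℂ) (R K : ℝ) :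
    Prop where
  isOpen : IsOpen Ω
  subset : Ω ⊆ disc
  contDiffAt : ∀ z ∈ Ω, ContDiffAt ℝ 2 f z
  norm_lt : ∀ z ∈ Ω, ‖f z‖ < R
  system : ∀ z ∈ Ω, ‖(Δ f) z‖ ≤ K * gradSq f z
  conformal : ∀ z ∈ Ω, g (f z) (dirD 1 f z) (dirD 1 f z) =
    g (f z) (dirD Complex.I f z) (dirD Complex.I f z)
  orthogonal : ∀ z ∈ Ω, g (f z) (dirD 1 f z) (dirD Complex.I f z) = 0
  closed : ∀ ρ < R, ∀ z ∈ disc, z ∉ Ω → ∀ᶠ w in 𝓝 z, ¬ (w ∈ Ω ∧ ‖f w‖ ≤ ρ)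

variable {g : Y → Y →L[ℝ] Y →L[ℝ] ℝ} {R m Mg Lg K K₁ : ℝ} {f : ℂ → Y} {Ω : Set ℂ}

/-- The local comparison function with a logarithmic pole at `c`. -/
noncomputable def poleBarrier (g : Y → Y →L[ℝ] Y →L[ℝ] ℝ) (c : Y) (τ K₁ ε η d : ℝ) (f : ℂ → Y)
    (z : ℂ) : ℝ :=
  (ε - ε / 2 / d * ‖f z - c‖ ^ 2) + η * (poleFn g c τ K₁ f z - 1 / 2 * Real.log d)

lemma poleBarrier_contDiffAt (hg : MetricBounds g R m Mg Lg) {c : Y} {τ ε η d : ℝ} {z : ℂ}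
    (hf : ContDiffAt ℝ 2 f z) (hc : ‖c‖ < R) (hτ : 0 < τ) :
    ContDiffAt ℝ 2 (poleBarrier g c τ K₁ ε η d f) z :=
  (contDiffAt_const.sub (contDiffAt_const.mul (contDiffAt_normSq (hf.sub contDiffAt_const)))).add
    (contDiffAt_const.mul ((contDiffAt_poleFn hg K₁ hf hc hτ).sub contDiffAt_const))

lemma laplacian_poleBarrier (hg : MetricBounds g R m Mg Lg) {c : Y} {τ ε η d : ℝ} {z : ℂ}
    (hf : ContDiffAt ℝ 2 f z) (hc : ‖c‖ < R) (hτ : 0 < τ) :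
    (Δ (poleBarrier g c τ K₁ ε η d f)) z =
      -(ε / 2 / d) * (Δ (fun w => ‖f w - c‖ ^ 2)) z + η * (Δ (poleFn g c τ K₁ f)) z := by
  have hcp := contDiffAt_poleFn hg K₁ hf hc hτ
  have hfc : ContDiffAt ℝ 2 (fun w => f w - c) z := hf.sub contDiffAt_const
  have hn := contDiffAt_normSq hfc
  have h1 : ContDiffAt ℝ 2 (fun w => ε / 2 / d * ‖f w - c‖ ^ 2) z := contDiffAt_const.mul hn
  have h0 : ContDiffAt ℝ 2 (fun w : ℂ => ε) z := contDiffAt_const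
  have h0' : ContDiffAt ℝ 2 (fun w => ε - ε / 2 / d * ‖f w - c‖ ^ 2) z := h0.sub h1
  have hl : ContDiffAt ℝ 2 (fun w : ℂ => 1 / 2 * Real.log d) z := contDiffAt_const
  have h2 : ContDiffAt ℝ 2 (fun w => poleFn g c τ K₁ f w - 1 / 2 * Real.log d) z := hcp.sub hl
  have h3 : ContDiffAt ℝ 2 (fun w => η * (poleFn g c τ K₁ f w - 1 / 2 * Real.log d)) z :=
    contDiffAt_const.mul h2
  have e0 := laplacian_fun_add h0' h3
  have e1 := laplacian_fun_sub h0 h1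
  have e2 := laplacian_const_mul (ε / 2 / d) hn
  have e3 := laplacian_const_mul η h2
  have e4 := laplacian_fun_sub hcp hl
  rw [laplacian_fun_const] at e1 e4
  unfold poleBarrier
  rw [e0, e1, e2, e3, e4]
  ring

/-- After multiplication by `d` the quadratic term contributes about `-ε|df|²`, against `2ε|df|²`
from `ε Δ|f|²`, which is where strictness of `ρ` is used. The terms containing `Δf` are at most `4KR
ε|df|²`, absorbed by `4KR ≤ 1`, and the pole contributes a nonnegative amount. -/
lemma poleBarrier_laplacian (hg : MetricBounds g R m Mg Lg) (hM : ConformalModel g f Ω R K)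
    {c : Y} {τ ε η d : ℝ} {z : ℂ} (hz : z ∈ Ω) (hK : 0 ≤ K) (hK₁0 : 0 ≤ K₁) (hc : ‖c‖ < R)
    (hτ : 0 < τ) (hε : 0 ≤ ε) (hη : 0 ≤ η) (hd : 0 < d)
    (hR : 2 * R * ((Lg + Mg * K) + Lg) ≤ m ^ 2 / 4)
    (hK₁ : 4 * ((Lg + Mg * K) + 2 * Lg) ≤ K₁ * m ^ 3) (hKR : 4 * (K * R) ≤ 1) :
    0 ≤ ε * (Δ (fun w => ‖f w‖ ^ 2)) z + d * (Δ (poleBarrier g c τ K₁ ε η d f)) z := by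
  have hf := hM.contDiffAt z hz
  have hfz := hM.norm_lt z hz
  have hpole := laplacian_poleFn_nonneg hg hK hK₁0 hf hfz hc hτ (hM.system z hz)
    (hM.conformal z hz) (hM.orthogonal z hz) hR hK₁
  have hfc : ContDiffAt ℝ 2 (fun w => f w - c) z := hf.sub contDiffAt_const
  have e1 : (Δ (fun w => ‖f w - c‖ ^ 2)) z = 2 * inner ℝ ((Δ f) z) (f z - c) +
      2 * gradSq f z := by
    rw [laplacian_normSq hfc, laplacian_fun_sub_const hf, dirD_fun_sub_const, dirD_fun_sub_const]
    rfl
  have e2 : (Δ (fun w => ‖f w‖ ^ 2)) z = 2 * inner ℝ ((Δ f) z) (f z) + 2 * gradSq f z :=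
    laplacian_normSq hf
  have e3 := laplacian_poleBarrier (ε := ε) (η := η) (d := d) hg (K₁ := K₁) hf hc hτ
  have hq := gradSq_nonneg f z
  have hsys := hM.system z hz
  have i1 : |inner ℝ ((Δ f) z) (f z)| ≤ K * gradSq f z * R :=
    (abs_real_inner_le_norm _ _).trans (by gcongr)
  have i2 : |inner ℝ ((Δ f) z) (f z - c)| ≤ K * gradSq f z * (2 * R) :=
    (abs_real_inner_le_norm _ _).trans (by
      gcongr
      exact (norm_sub_le _ _).trans (by linarith))
  have i1' := (abs_le.1 i1).1
  have i2' := (abs_le.1 i2).2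
  rw [e3, e1, e2]
  have e4 : d * (-(ε / 2 / d) * (2 * inner ℝ ((Δ f) z) (f z - c) + 2 * gradSq f z) +
      η * (Δ (poleFn g c τ K₁ f)) z) = -ε * (inner ℝ ((Δ f) z) (f z - c) + gradSq f z) +
      d * (η * (Δ (poleFn g c τ K₁ f)) z) := by field_simp
  rw [e4]
  have h1 : 0 ≤ d * (η * (Δ (poleFn g c τ K₁ f)) z) := by positivity
  have h2 : 0 ≤ 2 * inner ℝ ((Δ f) z) (f z) - inner ℝ ((Δ f) z) (f z - c) + gradSq f z := by
    have : gradSq f z * (4 * (K * R)) ≤ gradSq f z * 1 := by gcongr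
    linarith
  have h3 := mul_nonneg hε h2
  linarith

lemma poleFn_ge (hg : MetricBounds g R m Mg Lg) {c : Y} {τ : ℝ} {z : ℂ} (hc : ‖c‖ < R)
    (hτ : 0 < τ) (hK₁ : 0 ≤ K₁) (hw : 0 < ‖f z - c‖) :
    Real.log m + Real.log ‖f z - c‖ ≤ poleFn g c τ K₁ f z := by
  have hm := hg.m_pos
  have h1 := hg.lower c hc (f z - c)
  have h2 : Real.log ((m * ‖f z - c‖) ^ 2) ≤ Real.log (g c (f z - c) (f z - c) + τ) := by
    apply Real.log_le_log (by positivity)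
    rw [mul_pow]; linarith
  rw [Real.log_pow, Real.log_mul hm.ne' hw.ne'] at h2
  unfold poleFn
  have h3 : 0 ≤ K₁ * √(g c (f z - c) (f z - c) + τ) := by positivity
  push_cast at h2
  linarith

lemma poleFn_le (hg : MetricBounds g R m Mg Lg) {c : Y} {τ N : ℝ} {z : ℂ} (hc : ‖c‖ < R)
    (hτ : 0 < τ) (hK₁ : 0 ≤ K₁) (hN : Mg * ‖f z - c‖ ^ 2 + τ ≤ N) :
    poleFn g c τ K₁ f z ≤ 1 / 2 * Real.log N + K₁ * √N := by
  have h1 := (le_abs_self _).trans (hg.upper c hc (f z - c) (f z - c))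
  have h0 : 0 ≤ g c (f z - c) (f z - c) :=
    (by positivity : (0 : ℝ) ≤ m ^ 2 * ‖f z - c‖ ^ 2).trans (hg.lower c hc _)
  have h2 : g c (f z - c) (f z - c) + τ ≤ N := by
    rw [mul_assoc, ← sq] at h1; linarith
  unfold poleFn
  have h3 : Real.log (g c (f z - c) (f z - c) + τ) ≤ Real.log N :=
    Real.log_le_log (by linarith) h2
  gcongr

/-- The constants `ε, η` are adapted to the metric bounds. -/
structure BarrierConstants (m Mg K₁ ε η : ℝ) : Prop where
  ε_pos : 0 < ε
  η_pos : 0 < η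
  K₁_nonneg : 0 ≤ K₁
  low : η * |Real.log m| < ε / 2
  high : η * (1 / 2 * Real.log (4 * Mg + 1) + K₁ * √(4 * Mg + 1)) < ε

lemma exists_barrierConstants (m Mg K₁ : ℝ) {ε : ℝ} (hε : 0 < ε) (hMg : 0 ≤ Mg) (hK₁ : 0 ≤ K₁) :
    ∃ η, BarrierConstants m Mg K₁ ε η := by
  have hB : 0 ≤ 1 / 2 * Real.log (4 * Mg + 1) + K₁ * √(4 * Mg + 1) := by
    have := Real.log_nonneg (show 1 ≤ 4 * Mg + 1 by linarith)
    positivity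
  obtain ⟨B, hB'⟩ : ∃ B, B = 1 / 2 * Real.log (4 * Mg + 1) + K₁ * √(4 * Mg + 1) := ⟨_, rfl⟩
  rw [← hB'] at hB
  have hD : 0 < 2 * |Real.log m| + B + 1 := by positivity
  refine ⟨ε / (2 * |Real.log m| + B + 1), hε, by positivity, hK₁, ?_, hB' ▸ ?_⟩
  · rw [div_mul_eq_mul_div, div_lt_iff₀ hD]
    have := abs_nonneg (Real.log m)
    nlinarith
  · rw [div_mul_eq_mul_div, div_lt_iff₀ hD]
    have := abs_nonneg (Real.log m)
    nlinarith

variable {c : Y} {τ ε η d : ℝ} {z : ℂ}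

/-- At `|f - c| = √d` the quadratic part is exactly `ε/2`, and the normalization by `½ log d` bounds
the pole part below by `-η|log m|`, uniformly in `d` and `τ`. -/
lemma poleBarrier_pos (hg : MetricBounds g R m Mg Lg) (hb : BarrierConstants m Mg K₁ ε η)
    (hc : ‖c‖ < R) (hτ : 0 < τ) (hd : 0 < d) (hw : ‖f z - c‖ = √d) :
    0 < poleBarrier g c τ K₁ ε η d f z := by
  have h1 := poleFn_ge hg hc hτ hb.K₁_nonneg (f := f) (z := z) (by rw [hw]; positivity)
  rw [hw, Real.log_sqrt hd.le] at h1
  unfold poleBarrier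
  have h2 : ε / 2 / d * √d ^ 2 = ε / 2 := by rw [Real.sq_sqrt hd.le]; field_simp
  rw [hw, h2]
  have h3 : η * (-|Real.log m|) ≤ η * (poleFn g c τ K₁ f z - 1 / 2 * Real.log d) := by
    have := hb.η_pos
    gcongr
    have := neg_abs_le (Real.log m)
    linarith
  have := hb.low
  linarith

lemma poleFn_sub_le (hg : MetricBounds g R m Mg Lg) (hK₁ : 0 ≤ K₁)
    (hc : ‖c‖ < R) (hτ : 0 < τ) (hτd : τ ≤ d) (hd1 : d ≤ 1) (hw : ‖f z - c‖ ≤ 2 * √d) :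
    poleFn g c τ K₁ f z - 1 / 2 * Real.log d ≤
      1 / 2 * Real.log (4 * Mg + 1) + K₁ * √(4 * Mg + 1) := by
  have hMg := hg.Mg_nonneg
  have hd : 0 < d := hτ.trans_le hτd
  have h1 : Mg * ‖f z - c‖ ^ 2 + τ ≤ (4 * Mg + 1) * d := by
    have : ‖f z - c‖ ^ 2 ≤ (2 * √d) ^ 2 := by gcongr
    rw [mul_pow, Real.sq_sqrt hd.le] at this
    have := mul_le_mul_of_nonneg_left this hMg
    linarith
  have h2 := poleFn_le hg hc hτ hK₁ h1
  rw [Real.log_mul (by positivity) hd.ne'] at h2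
  have h3 : √((4 * Mg + 1) * d) ≤ √(4 * Mg + 1) := by
    apply Real.sqrt_le_sqrt
    exact mul_le_of_le_one_right (by positivity) hd1
  have := mul_le_mul_of_nonneg_left h3 hK₁
  linarith

lemma poleBarrier_le (hg : MetricBounds g R m Mg Lg) (hb : BarrierConstants m Mg K₁ ε η)
    (hc : ‖c‖ < R) (hτ : 0 < τ) (hτd : τ ≤ d) (hd1 : d ≤ 1) (hw : ‖f z - c‖ ≤ 2 * √d) :
    poleBarrier g c τ K₁ ε η d f z ≤ 2 * ε := by
  have h1 := poleFn_sub_le hg hb.K₁_nonneg hc hτ hτd hd1 hw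
  have h2 := mul_le_mul_of_nonneg_left h1 hb.η_pos.le
  have h3 := hb.high
  have h4 : 0 ≤ ε / 2 / d * ‖f z - c‖ ^ 2 := by
    have := hb.ε_pos
    have := hτ.trans_le hτd
    positivity
  unfold poleBarrier
  linarith

/-- At `|f - c| = 2√d` the quadratic part is exactly `-ε`, and the pole part is below `ε` by the
choice of `η`. -/
lemma poleBarrier_neg (hg : MetricBounds g R m Mg Lg) (hb : BarrierConstants m Mg K₁ ε η)
    (hc : ‖c‖ < R) (hτ : 0 < τ) (hτd : τ ≤ d) (hd1 : d ≤ 1) (hw : ‖f z - c‖ = 2 * √d) :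
    poleBarrier g c τ K₁ ε η d f z < 0 := by
  have h1 := poleFn_sub_le hg hb.K₁_nonneg hc hτ hτd hd1 hw.le
  have h2 := mul_le_mul_of_nonneg_left h1 hb.η_pos.le
  have h3 := hb.high
  have hd : 0 < d := hτ.trans_le hτd
  have h4 : ε / 2 / d * ‖f z - c‖ ^ 2 = 2 * ε := by
    rw [hw, mul_pow, Real.sq_sqrt hd.le]; field_simp
  unfold poleBarrier
  linarith

/-- The bound of the barrier close to the pole. -/
lemma poleBarrier_le_near (hg : MetricBounds g R m Mg Lg) (hb : BarrierConstants m Mg K₁ ε η)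
    (hc : ‖c‖ < R) (hd1 : d ≤ 1) {Lf δ : ℝ} (hδ : 0 < δ)
    (hδd : δ ^ 2 ≤ d) (hwδ : ‖f z - c‖ ≤ Lf * δ) (hw : ‖f z - c‖ ≤ 2 * √d) :
    poleBarrier g c (δ ^ 2) K₁ ε η d f z ≤
      2 * ε + η / 2 * (Real.log (Mg * Lf ^ 2 + 1) + 2 * Real.log δ - Real.log d) := by
  have hτ : 0 < δ ^ 2 := by positivity
  have hMg := hg.Mg_nonneg
  have hd : 0 < d := hτ.trans_le hδd
  have hη := hb.η_pos
  have hε := hb.ε_pos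
  have hN1 : Mg * ‖f z - c‖ ^ 2 + δ ^ 2 ≤ (Mg * Lf ^ 2 + 1) * δ ^ 2 := by
    have : ‖f z - c‖ ^ 2 ≤ (Lf * δ) ^ 2 := by gcongr
    rw [mul_pow] at this
    have := mul_le_mul_of_nonneg_left this hMg
    linarith
  have hN2 : Mg * ‖f z - c‖ ^ 2 + δ ^ 2 ≤ 4 * Mg + 1 := by
    have : ‖f z - c‖ ^ 2 ≤ (2 * √d) ^ 2 := by gcongr
    rw [mul_pow, Real.sq_sqrt hd.le] at this
    have := mul_le_mul_of_nonneg_left this hMg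
    nlinarith
  have h1 := poleFn_le hg hc hτ hb.K₁_nonneg (f := f) (z := z) le_rfl
  have h0 : 0 < Mg * ‖f z - c‖ ^ 2 + δ ^ 2 := by positivity
  have h2 : Real.log (Mg * ‖f z - c‖ ^ 2 + δ ^ 2) ≤
      Real.log (Mg * Lf ^ 2 + 1) + 2 * Real.log δ := by
    refine (Real.log_le_log h0 hN1).trans (le_of_eq ?_)
    rw [Real.log_mul (by positivity) (by positivity), Real.log_pow]; push_cast; ring
  have h3 : K₁ * √(Mg * ‖f z - c‖ ^ 2 + δ ^ 2) ≤ K₁ * √(4 * Mg + 1) := by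
    have := hb.K₁_nonneg
    gcongr
  have h4 := Real.log_nonneg (show 1 ≤ 4 * Mg + 1 by linarith)
  have h5 : poleFn g c (δ ^ 2) K₁ f z - 1 / 2 * Real.log d ≤
      1 / 2 * (Real.log (Mg * Lf ^ 2 + 1) + 2 * Real.log δ - Real.log d) +
        (1 / 2 * Real.log (4 * Mg + 1) + K₁ * √(4 * Mg + 1)) := by linarith
  have h6 := mul_le_mul_of_nonneg_left h5 hη.le
  have h7 := hb.high
  have h8 : 0 ≤ ε / 2 / d * ‖f z - c‖ ^ 2 := by positivity
  unfold poleBarrier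
  linarith

/-- The condition `|f - c| ≤ 2s` keeps `f` in a ball of radius `|c| + 2s < R`, so the set in
question is relatively closed in the disc even though `Ω` is open. -/
lemma ConformalModel.eventually_not (hM : ConformalModel g f Ω R K) {s : ℝ} (hc : ‖c‖ + 2 * s < R)
    (hz : z ∈ disc) (h : ¬ (z ∈ Ω ∧ ‖f z - c‖ ≤ 2 * s)) :
    ∀ᶠ w in 𝓝 z, ¬ (w ∈ Ω ∧ ‖f w - c‖ ≤ 2 * s) := by
  by_cases hzΩ : z ∈ Ω
  · have h1 : 2 * s < ‖f z - c‖ := not_le.1 fun h2 => h ⟨hzΩ, h2⟩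
    have hcont : ContinuousAt (fun w => ‖f w - c‖) z :=
      ((hM.contDiffAt z hzΩ).continuousAt.sub continuousAt_const).norm
    filter_upwards [hcont.eventually (lt_mem_nhds h1)] with w hw hn
    linarith [hn.2]
  · filter_upwards [hM.closed _ hc z hz hzΩ] with w hw hn
    refine hw ⟨hn.1, ?_⟩
    have : f w = c + (f w - c) := by abel
    rw [this]
    exact (norm_add_le _ _).trans (by linarith [hn.2])

/-- The comparison with the logarithmic pole on an annulus. -/
lemma glue_poleBarrier_le (hg : MetricBounds g R m Mg Lg) (hM : ConformalModel g f Ω R K)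
    (hb : BarrierConstants m Mg K₁ ε η) {rr : ℂ → ℝ} {Cr : ℝ} {z₀ : ℂ}
    (hK : 0 ≤ K) (hR : 2 * R * ((Lg + Mg * K) + Lg) ≤ m ^ 2 / 4)
    (hK₁ : 4 * ((Lg + Mg * K) + 2 * Lg) ≤ K₁ * m ^ 3) (hKR : 4 * (K * R) ≤ 1)
    (husc : UpperSemicontinuousOn rr disc) (hrr0 : ∀ z ∈ disc, 0 ≤ rr z)
    (hv0 : ∀ z ∈ disc, ViscAt rr 0 z)
    (hv : ∀ z ∈ Ω, ViscAt rr (ε * (Δ (fun w => ‖f w‖ ^ 2)) z) z)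
    (hz₀ : z₀ ∈ Ω) (hd : 0 < d) (hd1 : d ≤ 1) (hfz₀ : ‖f z₀‖ + 2 * √d < R)
    (hball : ∀ z, ‖z - z₀‖ ≤ d / 2 → z ∈ disc) (hCr : ∀ z, ‖z - z₀‖ ≤ d / 2 → rr z ≤ Cr * d)
    {z₂ : ℂ} (hz₂0 : 0 < ‖z₂ - z₀‖) (hz₂ : ‖z₂ - z₀‖ < d / 2) :
    ∃ δ > 0, glue Ω (fun z => ‖f z - f z₀‖) (poleBarrier g (f z₀) (δ ^ 2) K₁ ε η d f) (√d) z₂ ≤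
      Cr + 2 * ε + 1 + η / 4 * (Real.log (‖z₂ - z₀‖ ^ 2) - Real.log ((d / 2) ^ 2)) := by
  set c := f z₀ with hcdef
  have hsd : 0 < √d := Real.sqrt_pos.2 hd
  have hc : ‖c‖ < R := by linarith
  have hη := hb.η_pos
  have hε := hb.ε_pos
  have hMg := hg.Mg_nonneg
  have hdf : DifferentiableAt ℝ f z₀ := (hM.contDiffAt z₀ hz₀).differentiableAt (by norm_num)
  obtain ⟨Lf, hLf⟩ := hdf.hasFDerivAt.isBigO_sub.bound
  have hcf : ContinuousAt (fun z => ‖f z - c‖) z₀ :=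
    (hdf.continuousAt.sub continuousAt_const).norm
  have hev1 : ∀ᶠ z in 𝓝 z₀, ‖f z - c‖ < √d := hcf.eventually (gt_mem_nhds (by simpa [hcdef]))
  obtain ⟨δ₀, hδ₀, hδball⟩ := Metric.eventually_nhds_iff_ball.1
    ((hLf.and hev1).and (hM.isOpen.mem_nhds hz₀))
  set C₂ := Mg * Lf ^ 2 + 1 with hC₂
  have hC₂0 : 0 < C₂ := by positivity
  -- The Lipschitz constant `Lf` of `f` at `z₀` is not controlled, and neither is `C₂`. The barrier
  -- behaves like `η log δ` on the circle of radius `δ` but is compared with `(η/2) log δ` only; the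
  -- surplus swallows `log C₂` as soon as `δ ≤ 2/C₂`, so the final bound does not see `Lf`.
  obtain ⟨δ, hδ, hδ1, hδ2, hδ3, hδ4⟩ : ∃ δ > 0, δ < δ₀ ∧ δ < ‖z₂ - z₀‖ ∧ δ ≤ d ∧ δ ≤ 2 / C₂ := by
    refine ⟨min (min (δ₀ / 2) (‖z₂ - z₀‖ / 2)) (min d (2 / C₂)), by positivity, ?_, ?_, ?_, ?_⟩
    · exact ((min_le_left _ _).trans (min_le_left _ _)).trans_lt (by linarith)
    · exact ((min_le_left _ _).trans (min_le_right _ _)).trans_lt (by linarith)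
    · exact (min_le_right _ _).trans (min_le_left _ _)
    · exact (min_le_right _ _).trans (min_le_right _ _)
  have hδd : δ ^ 2 ≤ d := by nlinarith
  have hτ : 0 < δ ^ 2 := by positivity
  refine ⟨δ, hδ, ?_⟩
  let ν : ℂ → ℝ := fun z => ‖f z - c‖
  let T : ℂ → ℝ := poleBarrier g c (δ ^ 2) K₁ ε η d f
  -- The logarithm is harmonic off `z₀` and vanishes on the outer circle; `|z - z₀|²` makes `ψ`
  -- strictly subharmonic and accounts for the `+ 1` in the bound.
  let ψ : ℂ → ℝ := fun z => ‖z - z₀‖ ^ 2 - η / 4 * (Real.log (‖z - z₀‖ ^ 2) -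
    Real.log ((d / 2) ^ 2))
  have hνc : ∀ z ∈ Ω, ContinuousAt ν z := fun z hz =>
    ((hM.contDiffAt z hz).continuousAt.sub continuousAt_const).norm
  have hTc : ∀ z ∈ Ω, ContDiffAt ℝ 2 T z := fun z hz =>
    poleBarrier_contDiffAt hg (hM.contDiffAt z hz) hc hτ
  have hcl : ∀ z ∈ disc, ¬ (z ∈ Ω ∧ ν z ≤ 2 * √d) → ∀ᶠ w in 𝓝 z, ¬ (w ∈ Ω ∧ ν w ≤ 2 * √d) :=
    fun z hz h => hM.eventually_not hfz₀ hz h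
  let A : Set ℂ := {z | δ ≤ ‖z - z₀‖} ∩ Metric.closedBall z₀ (d / 2)
  have hAc : IsCompact A := (isCompact_closedBall z₀ (d / 2)).inter_left
    (isClosed_le continuous_const (by fun_prop))
  have hAne : ∀ z ∈ A, z ≠ z₀ := fun z hz heq => by
    have : δ ≤ ‖z - z₀‖ := hz.1
    rw [heq, sub_self, norm_zero] at this
    linarith
  have hAd : ∀ z ∈ A, ‖z - z₀‖ ≤ d / 2 := fun z hz => by simpa [dist_eq_norm] using hz.2
  have hψ1 : ∀ z, z ≠ z₀ → ContDiffAt ℝ 2 (fun z : ℂ => Real.log (‖z - z₀‖ ^ 2) -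
      Real.log ((d / 2) ^ 2)) z := fun z hz =>
    (contDiffAt_log_norm_sub hz).sub contDiffAt_const
  have hψ2 : ∀ z, z ≠ z₀ → ContDiffAt ℝ 2 (fun z : ℂ => η / 4 * (Real.log (‖z - z₀‖ ^ 2) -
      Real.log ((d / 2) ^ 2))) z := fun z hz => contDiffAt_const.mul (hψ1 z hz)
  have hψc : ∀ z ∈ A, ContDiffAt ℝ 2 ψ z := fun z hz =>
    (contDiffAt_normSq_sub z₀ z).sub (hψ2 z (hAne z hz))
  have hψΔ : ∀ z ∈ A, 0 < (Δ ψ) z := fun z hz => by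
    have hz' := hAne z hz
    rw [laplacian_fun_sub (contDiffAt_normSq_sub z₀ z) (hψ2 z hz'), laplacian_normSq_sub,
      laplacian_const_mul _ (hψ1 z hz'), laplacian_fun_sub (contDiffAt_log_norm_sub hz')
      contDiffAt_const, laplacian_log_norm_sub hz', laplacian_fun_const]
    norm_num
  have husc' : UpperSemicontinuousOn (fun w => rr w / d + glue Ω ν T (√d) w + ψ w) A := by
    refine UpperSemicontinuousOn.add (UpperSemicontinuousOn.add ?_ ?_) ?_
    · intro z hz y hy
      have hz' := husc z (hball z (hAd z hz)) (y * d) (by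
        change rr z / d < y at hy
        rw [div_lt_iff₀ hd] at hy; exact hy)
      refine (hz'.filter_mono (nhdsWithin_mono z fun w hw => hball w (hAd w hw))).mono ?_
      intro w hw
      change rr w / d < y
      rw [div_lt_iff₀ hd]; exact hw
    · intro z hz
      exact (upperSemicontinuousAt_glue hM.isOpen hsd.le hνc (fun z hz => (hTc z hz).continuousAt)
        (hcl z (hball z (hAd z hz)))).upperSemicontinuousWithinAt _
    · exact ContinuousOn.upperSemicontinuousOn fun z hz =>
        (hψc z hz).continuousAt.continuousWithinAt
  have hz₂A : z₂ ∈ A := ⟨hδ2.le, by simpa [dist_eq_norm] using hz₂.le⟩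
  obtain ⟨z₁, hz₁, hmax⟩ := husc'.exists_isMaxOn ⟨z₂, hz₂A⟩ hAc
  have hz₁disc := hball z₁ (hAd z₁ hz₁)
  have hrr : rr z₁ / d ≤ Cr := by
    rw [div_le_iff₀ hd]; exact hCr z₁ (hAd z₁ hz₁)
  have hsq : ‖z₁ - z₀‖ ^ 2 ≤ 1 := by
    have h1 := hAd z₁ hz₁
    have h2 := norm_nonneg (z₁ - z₀)
    nlinarith
  have hval : rr z₁ / d + glue Ω ν T (√d) z₁ + ψ z₁ ≤ Cr + 2 * ε + 1 := by
    rcases eq_or_lt_of_le (show δ ≤ ‖z₁ - z₀‖ from hz₁.1) with heq | hlt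
    · have hin : z₁ ∈ Metric.ball z₀ δ₀ := by rw [Metric.mem_ball, dist_eq_norm]; linarith
      obtain ⟨⟨k1, k2⟩, k3⟩ := hδball z₁ hin
      rw [← heq] at k1
      have hνs : ν z₁ < √d := k2
      have h1 : T z₁ ≤ _ := poleBarrier_le_near hg hb hc hd1 hδ hδd k1 (by linarith)
      rw [glue_of_lt k3 hνs]
      simp only [ψ]
      rw [← heq, Real.log_pow, Real.log_pow]
      have h2 : Real.log δ ≤ Real.log 2 - Real.log C₂ := by
        rw [← Real.log_div (by norm_num) hC₂0.ne']
        exact Real.log_le_log hδ hδ4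
      have h3 : Real.log (d / 2) = Real.log d - Real.log 2 := Real.log_div hd.ne' (by norm_num)
      rw [h3]
      have h4 : η / 2 * (Real.log C₂ + 2 * Real.log δ - Real.log d) ≤
          η / 2 * (Real.log δ - Real.log d + Real.log 2) := by
        gcongr
        linarith
      rw [← heq] at hsq
      push_cast
      linarith
    rcases eq_or_lt_of_le (hAd z₁ hz₁) with heq | hlt'
    · have h1 : glue Ω ν T (√d) z₁ ≤ 2 * ε := glue_le hsd.le (by linarith) fun _ h =>
        poleBarrier_le hg hb hc hτ hδd hd1 h
      simp only [ψ]
      rw [heq, sub_self, mul_zero, sub_zero]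
      rw [heq] at hsq
      linarith
    · exfalso
      have hloc : IsLocalMax (fun w => rr w / d + glue Ω ν T (√d) w + ψ w) z₁ := by
        apply hmax.isLocalMax
        have o1 : IsOpen {z : ℂ | δ < ‖z - z₀‖} :=
          isOpen_lt (f := fun _ : ℂ => δ) (g := fun z => ‖z - z₀‖) continuous_const (by fun_prop)
        have o2 : IsOpen {z : ℂ | ‖z - z₀‖ < d / 2} :=
          isOpen_lt (f := fun z : ℂ => ‖z - z₀‖) (g := fun _ => d / 2) (by fun_prop)
            continuous_const
        filter_upwards [o1.mem_nhds hlt, o2.mem_nhds hlt'] with z h1 h2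
        exact ⟨le_of_lt h1, by simpa [dist_eq_norm] using le_of_lt h2⟩
      exact not_isLocalMax_glue hM.isOpen hsd.le hd hνc (hTc z₁) (hcl z₁ hz₁disc)
        (fun _ h => poleBarrier_pos hg hb hc hτ hd h)
        (fun _ h => poleBarrier_neg hg hb hc hτ hδd hd1 h) (hv0 z₁ hz₁disc) (hv z₁)
        (fun h => poleBarrier_laplacian hg hM h hK hb.K₁_nonneg hc hτ hε.le hη.le hd hR hK₁ hKR)
        (hψc z₁ hz₁) (hψΔ z₁ hz₁) hloc
  have hfin : rr z₂ / d + glue Ω ν T (√d) z₂ + ψ z₂ ≤ _ := (hmax hz₂A).trans hval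
  have h1 : 0 ≤ rr z₂ / d := div_nonneg (hrr0 z₂ (hball z₂ hz₂.le)) hd.le
  have h2 : 0 ≤ ‖z₂ - z₀‖ ^ 2 := by positivity
  simp only [ψ] at hfin
  linarith

/-- The key estimate: near the boundary, a conformal disc is Hölder continuous of exponent `1/2`
at the scale of the distance to the boundary. -/
lemma holder_at_boundary_scale (hg : MetricBounds g R m Mg Lg) (hM : ConformalModel g f Ω R K)
    (hb : BarrierConstants m Mg K₁ ε η) {rr : ℂ → ℝ} {Cr : ℝ}
    (hK : 0 ≤ K) (hR : 2 * R * ((Lg + Mg * K) + Lg) ≤ m ^ 2 / 4)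
    (hK₁ : 4 * ((Lg + Mg * K) + 2 * Lg) ≤ K₁ * m ^ 3) (hKR : 4 * (K * R) ≤ 1)
    (husc : UpperSemicontinuousOn rr disc) (hrr0 : ∀ z ∈ disc, 0 ≤ rr z)
    (hv0 : ∀ z ∈ disc, ViscAt rr 0 z)
    (hv : ∀ z ∈ Ω, ViscAt rr (ε * (Δ (fun w => ‖f w‖ ^ 2)) z) z) (hCr0 : 0 ≤ Cr) :
    ∃ κ > 0, ∃ C > 0, κ ≤ 1 / 4 ∧ ∀ z₀ ∈ Ω, ∀ d : ℝ, 0 < d → d ≤ 1 → ‖f z₀‖ + 2 * √d < R →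
      (∀ z, ‖z - z₀‖ ≤ d / 2 → z ∈ disc) → (∀ z, ‖z - z₀‖ ≤ d / 2 → rr z ≤ Cr * d) →
      ∀ z, ‖z - z₀‖ ≤ κ * d → z ∈ Ω ∧ ‖f z - f z₀‖ ≤ C * √‖z - z₀‖ := by
  have hη := hb.η_pos
  have hε := hb.ε_pos
  have hm := hg.m_pos
  set B := Cr + 2 * ε + 1 with hB
  have hB0 : 0 < B := by positivity
  -- `κ` is small enough for the logarithm in the comparison to outweigh `B` when `|z - z₀| ≤ κd`;
  -- `C` comes from solving the resulting inequality for `|f z - f z₀|`.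
  refine ⟨1 / 4 * Real.exp (-(2 * B / η)), by positivity, √(2 * Real.exp (2 * B / η)) / m,
    by positivity, ?_, ?_⟩
  · have : Real.exp (-(2 * B / η)) ≤ 1 := Real.exp_le_one_iff.2 (by
      rw [neg_nonpos]; positivity)
    linarith
  intro z₀ hz₀ d hd hd1 hfz₀ hball hCr z hz
  rcases (norm_nonneg (z - z₀)).eq_or_lt with h0 | h0
  · have : z = z₀ := by rw [← sub_eq_zero, ← norm_eq_zero, h0]
    rw [this]
    refine ⟨hz₀, ?_⟩
    simp
  have hexp : Real.exp (-(2 * B / η)) ≤ 1 := Real.exp_le_one_iff.2 (by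
    rw [neg_nonpos]; positivity)
  have hlt : ‖z - z₀‖ < d / 2 := by nlinarith
  obtain ⟨δ, hδ, hle⟩ := glue_poleBarrier_le hg hM hb hK hR hK₁ hKR husc hrr0 hv0 hv hz₀ hd hd1
    hfz₀ hball hCr h0 hlt
  have hlog : Real.log ‖z - z₀‖ ≤ Real.log (d / 4) - 2 * B / η := by
    have := Real.log_le_log h0 hz
    rw [show 1 / 4 * Real.exp (-(2 * B / η)) * d = d / 4 * Real.exp (-(2 * B / η)) by ring,
      Real.log_mul (by positivity) (by positivity), Real.log_exp] at this
    linarith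
  have hlog4 : Real.log (d / 4) < Real.log (d / 2) := Real.log_lt_log (by positivity) (by linarith)
  rw [Real.log_pow, Real.log_pow] at hle
  push_cast at hle
  have hneg : B + η / 4 * (2 * Real.log ‖z - z₀‖ - 2 * Real.log (d / 2)) < 0 := by
    have h1 : η / 4 * (2 * Real.log ‖z - z₀‖ - 2 * Real.log (d / 2)) <
        η / 4 * (2 * (-(2 * B / η))) := by
      gcongr
      linarith
    have h2 : η / 4 * (2 * (-(2 * B / η))) = -B := by field_simp; ring
    linarith
  -- The glued function is negative only where it equals the barrier, so its negativity shows that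
  -- `z` lies in `Ω` and `|f z - f z₀| < √d`.
  have hmem := mem_of_glue_neg (Real.sqrt_nonneg d) (hle.trans_lt hneg)
  refine ⟨hmem.1, ?_⟩
  rw [glue_of_lt hmem.1 hmem.2] at hle
  rcases (norm_nonneg (f z - f z₀)).eq_or_lt with hw0 | hw0
  · rw [← hw0]; positivity
  have hc : ‖f z₀‖ < R := by linarith [Real.sqrt_nonneg d]
  have hpole := poleFn_ge hg hc (show 0 < δ ^ 2 by positivity) hb.K₁_nonneg hw0
  have hquad : ε / 2 / d * ‖f z - f z₀‖ ^ 2 ≤ ε := by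
    have h1 : ‖f z - f z₀‖ ^ 2 ≤ √d ^ 2 := by
      have := hmem.2.le
      gcongr
    rw [Real.sq_sqrt hd.le] at h1
    calc ε / 2 / d * ‖f z - f z₀‖ ^ 2 ≤ ε / 2 / d * d := by gcongr
      _ = ε / 2 := by field_simp
      _ ≤ ε := by linarith
  have hmain : η * (Real.log m + Real.log ‖f z - f z₀‖ - 1 / 2 * Real.log d) ≤
      B + η / 2 * (Real.log ‖z - z₀‖ - Real.log (d / 2)) := by
    have h1 : η * (Real.log m + Real.log ‖f z - f z₀‖ - 1 / 2 * Real.log d) ≤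
        η * (poleFn g (f z₀) (δ ^ 2) K₁ f z - 1 / 2 * Real.log d) := by gcongr
    unfold poleBarrier at hle
    linarith
  have hlog2 : Real.log (d / 2) = Real.log d - Real.log 2 := Real.log_div hd.ne' (by norm_num)
  -- The terms `½ log d` on the two sides cancel: the image scale `√d` on the left, half of the
  -- domain scale `d` on the right. This is the source of the exponent `1/2` with a constant
  -- independent of `d`.
  have hfinal : 2 * Real.log (m * ‖f z - f z₀‖) ≤
      Real.log (2 * Real.exp (2 * B / η) * ‖z - z₀‖) := by
    rw [Real.log_mul hm.ne' hw0.ne', Real.log_mul (by positivity) h0.ne',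
      Real.log_mul (by norm_num) (by positivity), Real.log_exp]
    have h1 : Real.log m + Real.log ‖f z - f z₀‖ - 1 / 2 * Real.log d ≤
        (B + η / 2 * (Real.log ‖z - z₀‖ - Real.log (d / 2))) / η := by
      rw [le_div_iff₀ hη]; linarith
    have h2 : (B + η / 2 * (Real.log ‖z - z₀‖ - Real.log (d / 2))) / η =
        B / η + 1 / 2 * (Real.log ‖z - z₀‖ - Real.log (d / 2)) := by field_simp
    rw [h2, hlog2] at h1
    have h3 : 2 * B / η = 2 * (B / η) := by ring
    rw [h3]
    linarith
  have hsq : (m * ‖f z - f z₀‖) ^ 2 ≤ 2 * Real.exp (2 * B / η) * ‖z - z₀‖ := by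
    have h1 : Real.log ((m * ‖f z - f z₀‖) ^ 2) ≤
        Real.log (2 * Real.exp (2 * B / η) * ‖z - z₀‖) := by
      rw [Real.log_pow]; push_cast; exact hfinal
    exact (Real.log_le_log_iff (by positivity) (by positivity)).1 h1
  rw [div_mul_eq_mul_div, le_div_iff₀ hm, ← Real.sqrt_mul (by positivity)]
  apply Real.le_sqrt_of_sq_le
  linarith

end KeyEstimate


/-! ### From the boundary scale to Hölder continuity up to the boundary -/

section Chaining

open Filter

variable {Y : Type*} [NormedAddCommGroup Y]

/-- Membership in `Ω`, and the smallness of `f`, propagate between `z` and `w`, with the increment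
of `f` bounded by `S`. -/
def Propagates (f : ℂ → Y) (Ω : Set ℂ) (R : ℝ) (z w : ℂ) (S : ℝ) : Prop :=
  (z ∈ Ω → ‖f z‖ + S ≤ R → w ∈ Ω ∧ ‖f w - f z‖ ≤ S) ∧
    (w ∈ Ω → ‖f w‖ + S ≤ R → z ∈ Ω ∧ ‖f z - f w‖ ≤ S)

variable {f : ℂ → Y} {Ω : Set ℂ} {R S T : ℝ} {z w v : ℂ}

lemma Propagates.symm (h : Propagates f Ω R z w S) : Propagates f Ω R w z S := ⟨h.2, h.1⟩

lemma Propagates.trans (h : Propagates f Ω R z w S) (h' : Propagates f Ω R w v T) (hS : 0 ≤ S)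
    (hT : 0 ≤ T) {U : ℝ} (hU : S + T ≤ U) : Propagates f Ω R z v U := by
  have key : ∀ {x y t : ℂ} {S T : ℝ}, 0 ≤ S → 0 ≤ T → S + T ≤ U →
      (x ∈ Ω → ‖f x‖ + S ≤ R → y ∈ Ω ∧ ‖f y - f x‖ ≤ S) →
      (y ∈ Ω → ‖f y‖ + T ≤ R → t ∈ Ω ∧ ‖f t - f y‖ ≤ T) →
      x ∈ Ω → ‖f x‖ + U ≤ R → t ∈ Ω ∧ ‖f t - f x‖ ≤ U := by
    intro x y t S T hS hT hU h1 h2 hx hR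
    obtain ⟨hy, h3⟩ := h1 hx (by linarith)
    have h4 : ‖f y‖ ≤ ‖f x‖ + ‖f y - f x‖ := by
      simpa using norm_add_le (f x) (f y - f x)
    obtain ⟨ht, h5⟩ := h2 hy (by linarith)
    refine ⟨ht, ?_⟩
    have : ‖f t - f x‖ ≤ ‖f t - f y‖ + ‖f y - f x‖ := norm_sub_le_norm_sub_add_norm_sub _ _ _
    linarith
  exact ⟨key hS hT hU h.1 h'.1, key hT hS (by linarith) h'.2 h.2⟩

lemma Propagates.refl (f : ℂ → Y) (Ω : Set ℂ) (R : ℝ) (z : ℂ) (hS : 0 ≤ S) :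
    Propagates f Ω R z z S := ⟨fun h _ => ⟨h, by simpa⟩, fun h _ => ⟨h, by simpa⟩⟩

/-- Hölder continuity near `a` at the scale of the distance to the unit circle. -/
def HolderAtScale (f : ℂ → Y) (Ω : Set ℂ) (R : ℝ) (a : ℂ) (r κ C : ℝ) : Prop :=
  ∀ z₀ ∈ Ω, ‖z₀ - a‖ < r → ‖f z₀‖ ≤ R → ∀ z, ‖z - z₀‖ ≤ κ * (1 - ‖z₀‖) →
    z ∈ Ω ∧ ‖f z - f z₀‖ ≤ C * √‖z - z₀‖

variable {a : ℂ} {r κ C : ℝ}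

lemma HolderAtScale.propagates (h : HolderAtScale f Ω R a r κ C) (hκ : 0 ≤ κ) (hκ1 : κ ≤ 1)
    (hC : 0 ≤ C) (hz : ‖z - a‖ < r) (hw : ‖w - a‖ < r) (hz1 : ‖z‖ ≤ 1)
    (hzw : ‖w - z‖ ≤ κ / 2 * (1 - ‖z‖)) : Propagates f Ω R z w (C * √‖w - z‖) := by
  have h0 : 0 ≤ C * √‖w - z‖ := by positivity
  have h1 : ‖w‖ ≤ ‖z‖ + ‖w - z‖ := by simpa using norm_add_le z (w - z)
  constructor
  · intro hzΩ hR
    exact h z hzΩ hz (by linarith) w (hzw.trans (by nlinarith [sub_nonneg.2 hz1]))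
  · intro hwΩ hR
    rw [norm_sub_rev w z] at *
    refine h w hwΩ hw (by linarith) z (hzw.trans ?_)
    have h2 : κ / 2 * (1 - ‖z‖) ≤ 1 / 2 * (1 - ‖z‖) := by gcongr
    nlinarith

/-- A radius is traversed in steps over which the depth changes by the factor `1 + κ/2`, each
admissible at its own scale. The increments `C√(depth)` form a geometric series, whose sum is
controlled by the condition on `A`. -/
lemma HolderAtScale.propagates_radial (h : HolderAtScale f Ω R a r κ C) (hκ : 0 < κ)
    (hκ1 : κ ≤ 1) (hC : 0 ≤ C) {A : ℝ} (hA : C + A / √(1 + κ / 2) ≤ A) (hA0 : 0 ≤ A)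
    {ζ : ℂ} (hζ : ‖ζ‖ = 1) (hζa : ‖ζ - a‖ < r / 2) (k : ℕ) :
    ∀ x y : ℝ, 0 < x → x ≤ y → y < r / 2 → y < 1 → y ≤ (1 + κ / 2) ^ k * x →
      Propagates f Ω R ((1 - y : ℝ) * ζ) ((1 - x : ℝ) * ζ) (A * √y) := by
  have hball : ∀ t : ℝ, 0 < t → t < r / 2 → ‖(1 - t : ℝ) * ζ - a‖ < r := by
    intro t ht0 ht
    have e : ((1 - t : ℝ) : ℂ) * ζ - a = (ζ - a) - (t : ℂ) * ζ := by push_cast; ring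
    rw [e]
    refine (norm_sub_le _ _).trans_lt ?_
    rw [norm_mul, hζ, Complex.norm_real, Real.norm_of_nonneg ht0.le]
    linarith
  have hnorm : ∀ t : ℝ, 0 < t → t < 1 → ‖((1 - t : ℝ) : ℂ) * ζ‖ = 1 - t := by
    intro t ht0 ht
    rw [norm_mul, hζ, Complex.norm_real, Real.norm_of_nonneg (by linarith), mul_one]
  have step : ∀ x y : ℝ, 0 < x → x ≤ y → y < r / 2 → y < 1 → y ≤ (1 + κ / 2) * x →
      Propagates f Ω R ((1 - y : ℝ) * ζ) ((1 - x : ℝ) * ζ) (C * √y) := by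
    intro x y hx hxy hyr hy1 hyx
    have hd : ‖((1 - x : ℝ) : ℂ) * ζ - ((1 - y : ℝ) : ℂ) * ζ‖ = y - x := by
      rw [← sub_mul, norm_mul, hζ, mul_one, ← Complex.ofReal_sub, Complex.norm_real,
        Real.norm_of_nonneg (by linarith)]
      ring
    have := h.propagates (z := ((1 - y : ℝ) : ℂ) * ζ) (w := ((1 - x : ℝ) : ℂ) * ζ) hκ.le hκ1 hC
      (hball y (by linarith) hyr) (hball x hx (by linarith))
      (by rw [hnorm y (by linarith) hy1]; linarith)
      (by rw [hnorm y (by linarith) hy1, hd]; nlinarith)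
    rw [hd] at this
    refine this.trans (Propagates.refl f Ω R _ le_rfl) (by positivity) le_rfl ?_
    rw [add_zero]
    gcongr
    linarith
  have hq : 1 < 1 + κ / 2 := by linarith
  have hCA : C ≤ A := by
    have : 0 ≤ A / √(1 + κ / 2) := by positivity
    linarith
  induction k with
  | zero =>
    intro x y hx hxy _ _ hyx
    have : y = x := by linarith
    rw [this]
    exact Propagates.refl f Ω R _ (by positivity)
  | succ k ih =>
    intro x y hx hxy hyr hy1 hyx
    have hy : 0 < y := by linarith
    rcases le_or_gt y ((1 + κ / 2) * x) with h1 | h1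
    · refine (step x y hx hxy hyr hy1 h1).trans (Propagates.refl f Ω R _ le_rfl) (by positivity)
        le_rfl ?_
      rw [add_zero]
      gcongr
    · have h2 : x ≤ y / (1 + κ / 2) := by rw [le_div_iff₀ (by linarith)]; linarith
      have h3 : y / (1 + κ / 2) ≤ (1 + κ / 2) ^ k * x := by
        rw [div_le_iff₀ (by linarith)]
        calc y ≤ _ := hyx
          _ = _ := by ring
      have h4 : y / (1 + κ / 2) ≤ y := div_le_self hy.le hq.le
      refine (step (y / (1 + κ / 2)) y (by positivity) h4 hyr hy1
        (le_of_eq (by field_simp))).trans (ih x _ hx h2 (by linarith) (by linarith) h3)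
        (by positivity) (by positivity) ?_
      rw [Real.sqrt_div hy.le]
      calc C * √y + A * (√y / √(1 + κ / 2)) = (C + A / √(1 + κ / 2)) * √y := by ring
        _ ≤ A * √y := by gcongr

lemma norm_radial_sub_le {z w : ℂ} (hz : 1 / 2 ≤ ‖z‖) (hw : 0 < ‖w‖) :
    ‖z / ‖z‖ - w / ‖w‖‖ ≤ 4 * ‖z - w‖ := by
  have hz0 : 0 < ‖z‖ := by linarith
  have e : z / ‖z‖ - w / ‖w‖ = (z - w) / ‖z‖ + w / ‖w‖ * ((‖w‖ - ‖z‖ : ℝ) / ‖z‖) := by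
    have h1 : (‖z‖ : ℂ) ≠ 0 := by exact_mod_cast hz0.ne'
    have h2 : (‖w‖ : ℂ) ≠ 0 := by exact_mod_cast hw.ne'
    push_cast
    field_simp
    ring
  rw [e]
  refine (norm_add_le _ _).trans ?_
  rw [norm_mul, norm_div, norm_div, norm_div, Complex.norm_real, Complex.norm_real,
    Complex.norm_real, norm_norm, norm_norm, div_self hw.ne', one_mul, ← add_div,
    div_le_iff₀ hz0]
  have h1 : ‖‖w‖ - ‖z‖‖ ≤ ‖z - w‖ := by
    rw [norm_sub_rev z w]; exact abs_norm_sub_norm_le _ _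
  nlinarith [norm_nonneg (z - w)]

/-- Points closer than the scale of the deeper one are compared directly. Otherwise, with `s = |z -
w|`, both are moved radially to depth `Q s`, compared there in one step, and moved back; each of the
three legs costs a multiple of `√s`. -/
lemma HolderAtScale.exists_propagates (h : HolderAtScale f Ω R a r κ C) (hκ : 0 < κ)
    (hκ1 : κ ≤ 1) (hC : 0 < C) (hr : 0 < r) (hr1 : r ≤ 1) (ha : ‖a‖ = 1) :
    ∃ η > 0, ∃ C' > 0, ∀ z ∈ disc, ‖z - a‖ < η → ∀ w ∈ disc, ‖w - a‖ < η →
      Propagates f Ω R z w (C' * √‖z - w‖) := by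
  obtain ⟨A, hA0, hA⟩ : ∃ A > 0, C + A / √(1 + κ / 2) ≤ A := by
    have h1 : 1 < √(1 + κ / 2) := by rw [Real.lt_sqrt] <;> linarith
    have h2 : 0 < √(1 + κ / 2) := by linarith
    have h3 : 0 < 1 - 1 / √(1 + κ / 2) := by
      rw [sub_pos, div_lt_one h2]; exact h1
    refine ⟨C / (1 - 1 / √(1 + κ / 2)), by positivity, le_of_eq ?_⟩
    generalize √(1 + κ / 2) = q at *
    have h4 : q - 1 ≠ 0 := by linarith
    have h5 : 1 - 1 / q = (q - 1) / q := by field_simp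
    rw [h5]
    field_simp
    ring
  -- At depth `Q s` the radial projections are at distance at most `4s = (κ/2) Q s`, which is just
  -- within one admissible step.
  set Q := 8 / κ with hQ
  have hQ0 : 0 < Q := by positivity
  have hQ1 : 8 ≤ Q := by rw [hQ, le_div_iff₀ hκ]; linarith
  refine ⟨r / (4 * Q), by positivity, C * √4 + 2 * A * √Q, by positivity, ?_⟩
  have hη : r / (4 * Q) ≤ r / 32 := by gcongr; linarith
  have hηQ : Q * (2 * (r / (4 * Q))) = r / 2 := by field_simp; norm_num
  set η := r / (4 * Q)
  have hnear : ∀ z, ‖z - a‖ < η → 1 - η < ‖z‖ := fun z hz => by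
    have := norm_sub_norm_le a (a - z)
    rw [sub_sub_cancel, norm_sub_rev a z, ha] at this
    linarith
  -- the one sided statement suffices
  have main : ∀ z ∈ disc, ‖z - a‖ < η → ∀ w ∈ disc, ‖w - a‖ < η → ‖w‖ ≤ ‖z‖ →
      Propagates f Ω R z w ((C * √4 + 2 * A * √Q) * √‖z - w‖) := by
    intro z hz hza w hw hwa hwz
    have hz1 : ‖z‖ < 1 := mem_disc.1 hz
    have hw1 : ‖w‖ < 1 := mem_disc.1 hw
    have hzη := hnear z hza
    have hwη := hnear w hwa
    have hC4 : C ≤ C * √4 := by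
      have : (1 : ℝ) ≤ √4 := by rw [Real.one_le_sqrt]; norm_num
      nlinarith
    rcases le_or_gt ‖z - w‖ (κ / 2 * (1 - ‖w‖)) with hc | hc
    · refine ((h.propagates hκ.le hκ1 hC.le (by linarith) (by linarith) hw1.le hc).symm).trans
        (Propagates.refl f Ω R _ le_rfl) (by positivity) le_rfl ?_
      rw [add_zero]
      gcongr
      have : 0 ≤ 2 * A * √Q := by positivity
      linarith
    · set s := ‖z - w‖ with hs
      have hs0 : 0 < s := lt_of_le_of_lt (by
        have : 0 ≤ 1 - ‖w‖ := by linarith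
        positivity) hc
      have hsη : s < 2 * η := by
        have : ‖z - w‖ ≤ ‖z - a‖ + ‖w - a‖ := by
          simpa using norm_sub_le (z - a) (w - a)
        linarith
      have hy : Q * s < r / 2 := by rw [← hηQ]; gcongr
      have hdw : 1 - ‖w‖ ≤ Q * s := by
        have : κ / 2 * Q = 4 := by rw [hQ]; field_simp; norm_num
        have h2 : κ / 2 * (1 - ‖w‖) ≤ κ / 2 * (Q * s) := by rw [← mul_assoc, this]; linarith
        exact le_of_mul_le_mul_left h2 (by positivity)
      have rad : ∀ x : ℂ, ‖x‖ < 1 → ‖x - a‖ < η → 1 - ‖x‖ ≤ Q * s →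
          Propagates f Ω R ((1 - Q * s : ℝ) * (x / ‖x‖)) x (A * √(Q * s)) := by
        intro x hx1 hxa hxd
        have hxη := hnear x hxa
        have hx0 : 0 < ‖x‖ := by linarith
        have hxc : (‖x‖ : ℂ) ≠ 0 := by exact_mod_cast hx0.ne'
        have e : ((1 - (1 - ‖x‖) : ℝ) : ℂ) * (x / ‖x‖) = x := by
          rw [sub_sub_cancel]; field_simp
        have hζ : ‖x / (‖x‖ : ℂ)‖ = 1 := by
          rw [norm_div, Complex.norm_real, norm_norm, div_self hx0.ne']
        have hζa : ‖x / (‖x‖ : ℂ) - a‖ < r / 2 := by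
          have e2 : x / (‖x‖ : ℂ) - a = ((1 - ‖x‖ : ℝ) : ℂ) * (x / ‖x‖) + (x - a) := by
            push_cast; field_simp; ring
          rw [e2]
          refine (norm_add_le _ _).trans_lt ?_
          rw [norm_mul, hζ, Complex.norm_real, Real.norm_of_nonneg (by linarith)]
          linarith
        obtain ⟨k, hk⟩ := pow_unbounded_of_one_lt (Q * s / (1 - ‖x‖))
          (show 1 < 1 + κ / 2 by linarith)
        rw [div_lt_iff₀ (by linarith)] at hk
        have := h.propagates_radial hκ hκ1 hC.le hA hA0.le hζ hζa k (1 - ‖x‖) (Q * s)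
          (by linarith) hxd hy (by linarith) hk.le
        rwa [e] at this
      have hor : Propagates f Ω R ((1 - Q * s : ℝ) * (z / ‖z‖)) ((1 - Q * s : ℝ) * (w / ‖w‖))
          (C * √(4 * s)) := by
        have hz0 : 0 < ‖z‖ := by linarith
        have hw0 : 0 < ‖w‖ := by linarith
        have hloc : ∀ x : ℂ, 0 < ‖x‖ → ‖x‖ < 1 → ‖x - a‖ < η →
            ‖((1 - Q * s : ℝ) : ℂ) * (x / ‖x‖) - a‖ < r := by
          intro x hx0 hx1 hxa
          have hxη := hnear x hxa
          have hxc : (‖x‖ : ℂ) ≠ 0 := by exact_mod_cast hx0.ne'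
          have e2 : ((1 - Q * s : ℝ) : ℂ) * (x / ‖x‖) - a =
              ((1 - Q * s - ‖x‖ : ℝ) : ℂ) * (x / ‖x‖) + (x - a) := by
            push_cast; field_simp; ring
          rw [e2]
          refine (norm_add_le _ _).trans_lt ?_
          rw [norm_mul, norm_div, Complex.norm_real, Complex.norm_real, norm_norm,
            div_self hx0.ne', mul_one, Real.norm_eq_abs]
          have : |1 - Q * s - ‖x‖| ≤ r / 2 + η := by
            rw [abs_le]; constructor <;> nlinarith
          linarith
        have hnz : ‖((1 - Q * s : ℝ) : ℂ) * (z / ‖z‖)‖ = 1 - Q * s := by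
          rw [norm_mul, norm_div, Complex.norm_real, Complex.norm_real, norm_norm,
            div_self hz0.ne', mul_one, Real.norm_of_nonneg (by linarith)]
        have hdist : ‖((1 - Q * s : ℝ) : ℂ) * (w / ‖w‖) - ((1 - Q * s : ℝ) : ℂ) * (z / ‖z‖)‖ ≤
            4 * s := by
          rw [← mul_sub, norm_mul, Complex.norm_real, Real.norm_of_nonneg (by linarith),
            norm_sub_rev]
          have h1 := norm_radial_sub_le (z := z) (w := w) (by linarith) hw0
          have h2 : 1 - Q * s ≤ 1 := by
            have : 0 < Q * s := by positivity
            linarith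
          calc (1 - Q * s) * ‖z / ‖z‖ - w / ‖w‖‖ ≤ 1 * ‖z / (‖z‖ : ℂ) - w / ‖w‖‖ := by gcongr
            _ ≤ _ := by rw [one_mul]; exact h1
        refine (h.propagates hκ.le hκ1 hC.le (hloc z hz0 hz1 hza) (hloc w hw0 hw1 hwa)
          (by rw [hnz]; nlinarith) ?_).trans (Propagates.refl f Ω R _ le_rfl) (by positivity)
          le_rfl ?_
        · rw [hnz]
          refine hdist.trans (le_of_eq ?_)
          rw [hQ]; field_simp; ring
        · rw [add_zero]; gcongr
      have r1 := rad z hz1 hza (by linarith)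
      have r2 := rad w hw1 hwa hdw
      refine (r1.symm.trans hor (by positivity) (by positivity) le_rfl).trans r2 (by positivity)
        (by positivity) (le_of_eq ?_)
      rw [Real.sqrt_mul hQ0.le, Real.sqrt_mul (x := 4) (by norm_num)]
      ring
  intro z hz hza w hw hwa
  rcases le_total ‖w‖ ‖z‖ with h1 | h1
  · exact main z hz hza w hw hwa h1
  · have := main w hw hwa z hz hza h1
    rw [norm_sub_rev]
    exact this.symm

/-- One point of `Ω` near `a` with small `f` reaches every nearby point of the disc by a propagation
of cost at most `R/4`. So a whole neighbourhood lies in `Ω` with `‖f‖ ≤ R/2`, which leaves room to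
propagate between any two of its points. -/
lemma HolderAtScale.exists_holder (h : HolderAtScale f Ω R a r κ C) (hκ : 0 < κ) (hκ1 : κ ≤ 1)
    (hC : 0 < C) (hr : 0 < r) (hr1 : r ≤ 1) (ha : ‖a‖ = 1) (hR : 0 < R) (hΩ : Ω ⊆ disc)
    (hfreq : ∀ δ > 0, ∃ z ∈ Ω, ‖z - a‖ < δ ∧ ‖f z‖ < δ) :
    ∃ η > 0, ∃ C' > 0, ∀ z ∈ disc, ‖z - a‖ < η → z ∈ Ω ∧ ‖f z‖ ≤ R / 2 ∧
      ∀ w ∈ disc, ‖w - a‖ < η → ‖f z - f w‖ ≤ C' * √‖z - w‖ := by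
  obtain ⟨η, hη, C', hC', hp⟩ := h.exists_propagates hκ hκ1 hC hr hr1 ha
  obtain ⟨η', hη', hη'η, hη'C⟩ : ∃ η' > 0, η' ≤ η ∧ C' * √(2 * η') ≤ R / 4 := by
    refine ⟨min η ((R / (4 * C')) ^ 2 / 2), by positivity, min_le_left _ _, ?_⟩
    have : √(2 * min η ((R / (4 * C')) ^ 2 / 2)) ≤ R / (4 * C') := by
      apply Real.sqrt_le_iff.2 ⟨by positivity, ?_⟩
      have := min_le_right η ((R / (4 * C')) ^ 2 / 2)
      linarith
    calc C' * √(2 * min η ((R / (4 * C')) ^ 2 / 2)) ≤ C' * (R / (4 * C')) := by gcongr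
      _ = R / 4 := by field_simp
  have hbd : ∀ z w : ℂ, ‖z - a‖ < η' → ‖w - a‖ < η' → C' * √‖z - w‖ ≤ R / 4 := by
    intro z w hz hw
    refine le_trans ?_ hη'C
    gcongr
    have : ‖z - w‖ ≤ ‖z - a‖ + ‖w - a‖ := by simpa using norm_sub_le (z - a) (w - a)
    linarith
  obtain ⟨z₀, hz₀, hz₀a, hz₀f⟩ := hfreq (min η' (R / 4)) (by positivity)
  have hz₀a' := hz₀a.trans_le (min_le_left _ _)
  have hz₀f' := hz₀f.trans_le (min_le_right _ _)
  have hall : ∀ z ∈ disc, ‖z - a‖ < η' → z ∈ Ω ∧ ‖f z‖ ≤ R / 2 := by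
    intro z hz hza
    have hb := hbd z₀ z hz₀a' hza
    obtain ⟨h1, h2⟩ := (hp z₀ (hΩ hz₀) (by linarith) z hz (by linarith)).1 hz₀ (by linarith)
    refine ⟨h1, ?_⟩
    have h4 : ‖f z‖ ≤ ‖f z₀‖ + ‖f z - f z₀‖ := by simpa using norm_add_le (f z₀) (f z - f z₀)
    linarith
  refine ⟨η', hη', C', hC', fun z hz hza => ⟨(hall z hz hza).1, (hall z hz hza).2, ?_⟩⟩
  intro w hw hwa
  have hb := hbd z w hza hwa
  exact ((hp z hz (by linarith) w hw (by linarith)).2 (hall w hw hwa).1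
    (by linarith [(hall w hw hwa).2])).2

end Chaining

/-! ### Extension to the closure -/

section Extension

open Filter

variable {Y : Type*} [NormedAddCommGroup Y] [CompleteSpace Y] {f : ℂ → Y} {C : ℝ} {s : Set ℂ}

/-- Extension of a Hölder-`1/2` map to the closure. -/
lemma exists_extension_of_holder (hC : 0 ≤ C)
    (h : ∀ z ∈ s, ∀ w ∈ s, ‖f z - f w‖ ≤ C * √‖z - w‖) :
    ∃ F : ℂ → Y, (∀ z ∈ s, F z = f z) ∧ (∀ z ∈ closure s, Tendsto f (𝓝[s] z) (𝓝 (F z))) ∧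
      ∀ z ∈ closure s, ∀ w ∈ closure s, ‖F z - F w‖ ≤ C * √‖z - w‖ := by
  have hlim : ∀ z ∈ closure s, ∃ y, Tendsto f (𝓝[s] z) (𝓝 y) := by
    intro z hz
    have := mem_closure_iff_nhdsWithin_neBot.1 hz
    apply cauchy_map_iff_exists_tendsto.1
    rw [Metric.cauchy_iff]
    refine ⟨this.map f, fun ε hε => ?_⟩
    have hc : Tendsto (fun w => C * √(2 * ‖w - z‖)) (𝓝[s] z) (𝓝 0) := by
      have : Continuous fun w : ℂ => C * √(2 * ‖w - z‖) := by fun_prop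
      have := (this.tendsto z).mono_left (nhdsWithin_le_nhds (s := s))
      simpa using this
    refine ⟨f '' (s ∩ {w | C * √(2 * ‖w - z‖) < ε}), image_mem_map
      (inter_mem self_mem_nhdsWithin (hc.eventually (gt_mem_nhds hε))), ?_⟩
    have key : ∀ x ∈ s, ∀ y ∈ s, ‖y - z‖ ≤ ‖x - z‖ → C * √(2 * ‖x - z‖) < ε →
        dist (f x) (f y) < ε := by
      intro x hx y hy hxy hxε
      rw [dist_eq_norm]
      refine ((h x hx y hy).trans ?_).trans_lt hxε
      gcongr
      have : ‖x - y‖ ≤ ‖x - z‖ + ‖y - z‖ := by simpa using norm_sub_le (x - z) (y - z)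
      linarith
    rintro _ ⟨x, ⟨hx, hxε⟩, rfl⟩ _ ⟨y, ⟨hy, hyε⟩, rfl⟩
    rcases le_total ‖y - z‖ ‖x - z‖ with h1 | h1
    · exact key x hx y hy h1 hxε
    · rw [dist_comm]; exact key y hy x hx h1 hyε
  choose! F hF using hlim
  refine ⟨F, ?_, hF, ?_⟩
  · intro z hz
    have := mem_closure_iff_nhdsWithin_neBot.1 (subset_closure hz)
    refine tendsto_nhds_unique (hF z (subset_closure hz)) ?_
    rw [tendsto_iff_norm_sub_tendsto_zero]
    have hc : Tendsto (fun w => C * √‖w - z‖) (𝓝[s] z) (𝓝 0) := by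
      have : Continuous fun w : ℂ => C * √‖w - z‖ := by fun_prop
      have := (this.tendsto z).mono_left (nhdsWithin_le_nhds (s := s))
      simpa using this
    refine squeeze_zero' (Eventually.of_forall fun w => norm_nonneg _) ?_ hc
    filter_upwards [self_mem_nhdsWithin] with w hw
    exact h w hw z hz
  · intro z hz w hw
    have h1 := mem_closure_iff_nhdsWithin_neBot.1 hz
    have h2 := mem_closure_iff_nhdsWithin_neBot.1 hw
    have l1 : Tendsto (fun q : ℂ × ℂ => ‖f q.1 - f q.2‖) (𝓝[s] z ×ˢ 𝓝[s] w) (𝓝 ‖F z - F w‖) :=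
      (((hF z hz).comp tendsto_fst).sub ((hF w hw).comp tendsto_snd)).norm
    have l2 : Tendsto (fun q : ℂ × ℂ => C * √‖q.1 - q.2‖) (𝓝[s] z ×ˢ 𝓝[s] w)
        (𝓝 (C * √‖z - w‖)) := by
      have hc : Continuous fun q : ℂ × ℂ => C * √‖q.1 - q.2‖ := by fun_prop
      refine (hc.tendsto (z, w)).mono_left ?_
      rw [nhds_prod_eq]
      exact Filter.prod_mono nhdsWithin_le_nhds nhdsWithin_le_nhds
    refine le_of_tendsto_of_tendsto l1 l2 ?_
    filter_upwards [prod_mem_prod self_mem_nhdsWithin self_mem_nhdsWithin] with q hq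
    exact h _ hq.1 _ hq.2

end Extension


/-! ### Metric and Christoffel symbols in a chart -/

section ChartDerivative

open Filter

variable {n : ℕ} {M : Type*} [TopologicalSpace M] [ChartedSpace (EuclideanSpace ℝ (Fin n)) M]
  {e : OpenPartialHomeomorph M (EuclideanSpace ℝ (Fin n))} {y : EuclideanSpace ℝ (Fin n)}

lemma mfderiv_symm_injective (he : e ∈ IsManifold.maximalAtlas (𝓡 n) ∞ M) (hy : y ∈ e.target) :
    Function.Injective (mfderiv (𝓡 n) (𝓡 n) e.symm y) := by
  have h1 : MDifferentiableAt (𝓡 n) (𝓡 n) e.symm y :=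
    (contMDiffAt_symm_of_mem_maximalAtlas he hy).mdifferentiableAt (by simp)
  have h2 : MDifferentiableAt (𝓡 n) (𝓡 n) e (e.symm y) :=
    (contMDiffAt_of_mem_maximalAtlas he (e.map_target hy)).mdifferentiableAt (by simp)
  have h3 := mfderiv_comp y h2 h1
  have h4 : e ∘ e.symm =ᶠ[𝓝 y] id := by
    filter_upwards [e.open_target.mem_nhds hy] with x hx using e.right_inv hx
  rw [h4.mfderiv_eq, mfderiv_id] at h3
  intro v w hvw
  have h5 := congrArg (mfderiv (𝓡 n) (𝓡 n) e (e.symm y)) hvw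
  have h6 : ∀ v, mfderiv (𝓡 n) (𝓡 n) e (e.symm y) (mfderiv (𝓡 n) (𝓡 n) e.symm y v) = v :=
    fun v => (congrArg (fun L => L v) h3).symm
  rw [h6, h6] at h5
  exact h5

end ChartDerivative

section ChartMetric

set_option linter.unusedSectionVars false

open Filter

variable {n : ℕ} {M : Type*} [TopologicalSpace M] [ChartedSpace (EuclideanSpace ℝ (Fin n)) M]
  [IsManifold (𝓡 n) ∞ M] [Bundle.RiemannianBundle (fun x : M => TangentSpace (𝓡 n) x)]

/-- The metric in the chart `e`, as a bilinear form. -/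
noncomputable def coordMetric (e : OpenPartialHomeomorph M (EuclideanSpace ℝ (Fin n)))
    (y : EuclideanSpace ℝ (Fin n)) :
    EuclideanSpace ℝ (Fin n) →L[ℝ] EuclideanSpace ℝ (Fin n) →L[ℝ] ℝ :=
  ∑ i, ∑ j, metricMatrix e y i j •
    (EuclideanSpace.proj i : EuclideanSpace ℝ (Fin n) →L[ℝ] ℝ).smulRight
      (EuclideanSpace.proj j : EuclideanSpace ℝ (Fin n) →L[ℝ] ℝ)

/-- The quadratic part of the harmonic map equation, as a bilinear map. -/
noncomputable def christoffelForm (e : OpenPartialHomeomorph M (EuclideanSpace ℝ (Fin n)))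
    (y : EuclideanSpace ℝ (Fin n)) :
    EuclideanSpace ℝ (Fin n) →L[ℝ] EuclideanSpace ℝ (Fin n) →L[ℝ] EuclideanSpace ℝ (Fin n) :=
  ∑ k, ∑ i, ∑ j, (-christoffel e y k i j) •
    (EuclideanSpace.proj i : EuclideanSpace ℝ (Fin n) →L[ℝ] ℝ).smulRight
      ((EuclideanSpace.proj j : EuclideanSpace ℝ (Fin n) →L[ℝ] ℝ).smulRight
        (EuclideanSpace.single k (1 : ℝ)))

variable {e : OpenPartialHomeomorph M (EuclideanSpace ℝ (Fin n))} {y : EuclideanSpace ℝ (Fin n)}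

lemma coordMetric_apply_sum (v w : EuclideanSpace ℝ (Fin n)) :
    coordMetric e y v w = ∑ i, ∑ j, metricMatrix e y i j * (v i * w j) := by
  simp only [coordMetric, _root_.sum_apply, _root_.smul_apply,
    ContinuousLinearMap.smulRight_apply, PiLp.proj_apply, smul_eq_mul]

lemma christoffelForm_apply (v w : EuclideanSpace ℝ (Fin n)) (k : Fin n) :
    christoffelForm e y v w k = -∑ i, ∑ j, christoffel e y k i j * (v i * w j) := by
  simp only [christoffelForm, _root_.sum_apply, _root_.smul_apply,
    ContinuousLinearMap.smulRight_apply, PiLp.proj_apply]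
  simp [Finset.sum_apply, Pi.single_apply]

lemma sum_single_eq (v : EuclideanSpace ℝ (Fin n)) :
    ∑ i, v i • (EuclideanSpace.single i (1 : ℝ) : EuclideanSpace ℝ (Fin n)) = v := by
  ext j
  simp [Pi.single_apply]

lemma coordMetric_apply (v w : EuclideanSpace ℝ (Fin n)) :
    coordMetric e y v w = inner ℝ (mfderiv (𝓡 n) (𝓡 n) e.symm y v)
      (mfderiv (𝓡 n) (𝓡 n) e.symm y w) := by
  have hs : ∀ v : EuclideanSpace ℝ (Fin n), mfderiv (𝓡 n) (𝓡 n) e.symm y v =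
      ∑ i, v i • coordVec e y i := by
    intro v
    conv_lhs => rw [← sum_single_eq v]
    exact (map_sum (mfderiv (𝓡 n) (𝓡 n) e.symm y) _ _).trans
      (Finset.sum_congr rfl fun i _ => map_smul (mfderiv (𝓡 n) (𝓡 n) e.symm y) _ _)
  rw [hs, hs, coordMetric_apply_sum, sum_inner]
  refine Finset.sum_congr rfl fun i _ => ?_
  rw [inner_sum]
  refine Finset.sum_congr rfl fun j _ => ?_
  rw [real_inner_smul_left, real_inner_smul_right]
  simp only [metricMatrix, Matrix.of_apply]
  ring

lemma inner_tangent_congr {x x' : M} (hx : x = x') {v w : TangentSpace (𝓡 n) x}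
    {v' w' : TangentSpace (𝓡 n) x'} (hv : (v : EuclideanSpace ℝ (Fin n)) = v')
    (hw : (w : EuclideanSpace ℝ (Fin n)) = w') : inner ℝ v w = inner ℝ v' w' := by
  subst hx
  have h1 : v = v' := hv
  have h2 : w = w' := hw
  rw [h1, h2]

lemma coordMetric_symm (v w : EuclideanSpace ℝ (Fin n)) :
    coordMetric e y v w = coordMetric e y w v := by
  rw [coordMetric_apply, coordMetric_apply, real_inner_comm]

lemma det_metricMatrix_ne_zero (he : e ∈ IsManifold.maximalAtlas (𝓡 n) ∞ M)
    (hy : y ∈ e.target) : (metricMatrix e y).det ≠ 0 := by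
  intro h0
  obtain ⟨v, hv, hv0⟩ := Matrix.exists_mulVec_eq_zero_iff.2 h0
  apply hv
  have h1 : coordMetric e y (WithLp.toLp 2 v) (WithLp.toLp 2 v) = 0 := by
    rw [coordMetric_apply_sum]
    refine Finset.sum_eq_zero fun i _ => ?_
    have := congrFun hv0 i
    simp only [Matrix.mulVec, dotProduct, Pi.zero_apply] at this
    calc _ = v i * ∑ j, metricMatrix e y i j * v j := by
          rw [Finset.mul_sum]
          exact Finset.sum_congr rfl fun j _ => by simp only; ring
      _ = 0 := by rw [this, mul_zero]
  rw [coordMetric_apply] at h1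
  have h2 := inner_self_eq_zero.1 h1
  have h3 := mfderiv_symm_injective he hy (h2.trans (map_zero _).symm)
  have h4 : (WithLp.toLp 2 v : EuclideanSpace ℝ (Fin n)) = 0 := h3
  exact (WithLp.toLp_eq_zero 2).1 h4

variable [IsContMDiffRiemannianBundle (𝓡 n) ∞ (EuclideanSpace ℝ (Fin n))
      (fun x : M => TangentSpace (𝓡 n) x)]

/-- The coordinate fields are images of constant sections under the tangent map of `e.symm`, hence
smooth along `e.symm`, and inner products of smooth sections are smooth. -/
lemma contDiffOn_metricMatrix (he : e ∈ IsManifold.maximalAtlas (𝓡 n) ∞ M) (i j : Fin n) :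
    ContDiffOn ℝ ∞ (fun y => metricMatrix e y i j) e.target := by
  have hs : ∀ i : Fin n, ContMDiffOn (𝓡 n) ((𝓡 n).prod (𝓡 n)) ∞
      (fun y => (⟨e.symm y, coordVec e y i⟩ : Bundle.TotalSpace (EuclideanSpace ℝ (Fin n))
        (fun x : M => TangentSpace (𝓡 n) x))) e.target := by
    intro i
    have h1 := contMDiffOn_symm_of_mem_maximalAtlas he
    have h2 := h1.contMDiffOn_tangentMapWithin (m := ∞) (by simp) e.open_target.uniqueMDiffOn
    have h3 : ContMDiffOn (𝓡 n) ((𝓡 n).prod (𝓡 n)) ∞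
        (fun y => (⟨y, EuclideanSpace.single i (1 : ℝ)⟩ :
          TangentBundle (𝓡 n) (EuclideanSpace ℝ (Fin n)))) e.target := by
      apply contMDiffOn_vectorSpace_iff_contDiffOn.2
      exact contDiffOn_const
    have h4 := h2.comp h3 (fun y hy => hy)
    refine h4.congr fun y hy => ?_
    simp only [Function.comp, tangentMapWithin]
    rw [mfderivWithin_of_isOpen e.open_target hy]
    rfl
  rw [← contMDiffOn_iff_contDiffOn]
  exact (hs i).inner_bundle (hs j)

end ChartMetric


/-! ### Smoothness of the inverse matrix and of the chart data -/

section MatrixCalculus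

variable {E : Type*} [NormedAddCommGroup E] [NormedSpace ℝ E] {ι : Type*} [Fintype ι]
  [DecidableEq ι] {A : E → Matrix ι ι ℝ} {x : E} {k : ℕ∞ω}

lemma contDiffAt_det (hA : ∀ i j, ContDiffAt ℝ k (fun x => A x i j) x) :
    ContDiffAt ℝ k (fun x => (A x).det) x := by
  simp only [Matrix.det_apply']
  exact ContDiffAt.sum fun σ _ => contDiffAt_const.mul (contDiffAt_prod fun i _ => hA _ _)

lemma contDiffAt_matrix_inv (hA : ∀ i j, ContDiffAt ℝ k (fun x => A x i j) x)
    (h0 : (A x).det ≠ 0) (i j : ι) : ContDiffAt ℝ k (fun x => (A x)⁻¹ i j) x := by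
  simp only [Matrix.inv_def, Ring.inverse_eq_inv', Matrix.smul_apply, smul_eq_mul,
    Matrix.adjugate_apply]
  refine ((contDiffAt_det hA).inv h0).mul (contDiffAt_det fun a b => ?_)
  by_cases h : a = j
  · subst h
    simp only [Matrix.updateRow_self]
    exact contDiffAt_const
  · simp only [Matrix.updateRow_ne h]
    exact hA a b

end MatrixCalculus

section ChartSmoothness

set_option linter.unusedSectionVars false

open Filter

variable {n : ℕ} {M : Type*} [TopologicalSpace M] [ChartedSpace (EuclideanSpace ℝ (Fin n)) M]
  [IsManifold (𝓡 n) ∞ M] [Bundle.RiemannianBundle (fun x : M => TangentSpace (𝓡 n) x)]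
  [IsContMDiffRiemannianBundle (𝓡 n) ∞ (EuclideanSpace ℝ (Fin n))
      (fun x : M => TangentSpace (𝓡 n) x)]
  {e : OpenPartialHomeomorph M (EuclideanSpace ℝ (Fin n))} {y : EuclideanSpace ℝ (Fin n)}

lemma contDiffAt_metricMatrix (he : e ∈ IsManifold.maximalAtlas (𝓡 n) ∞ M) (hy : y ∈ e.target)
    (i j : Fin n) : ContDiffAt ℝ ∞ (fun y => metricMatrix e y i j) y :=
  (contDiffOn_metricMatrix he i j).contDiffAt (e.open_target.mem_nhds hy)

lemma contDiffAt_coordMetric (he : e ∈ IsManifold.maximalAtlas (𝓡 n) ∞ M) (hy : y ∈ e.target) :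
    ContDiffAt ℝ ∞ (coordMetric e) y := by
  unfold coordMetric
  exact ContDiffAt.sum fun i _ => ContDiffAt.sum fun j _ =>
    (contDiffAt_metricMatrix he hy i j).smul contDiffAt_const

lemma contDiffAt_metricDeriv (he : e ∈ IsManifold.maximalAtlas (𝓡 n) ∞ M) (hy : y ∈ e.target)
    (i j k : Fin n) : ContDiffAt ℝ ∞ (fun y => metricDeriv e y i j k) y :=
  ((contDiffAt_metricMatrix he hy i j).fderiv_right (m := ∞) (by simp)).clm_apply contDiffAt_const

lemma contDiffAt_christoffel (he : e ∈ IsManifold.maximalAtlas (𝓡 n) ∞ M) (hy : y ∈ e.target)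
    (k i j : Fin n) : ContDiffAt ℝ ∞ (fun y => christoffel e y k i j) y := by
  unfold christoffel
  exact contDiffAt_const.mul (ContDiffAt.sum fun l _ =>
    (contDiffAt_matrix_inv (fun i j => contDiffAt_metricMatrix he hy i j)
      (det_metricMatrix_ne_zero he hy) k l).mul
    (((contDiffAt_metricDeriv he hy j l i).add (contDiffAt_metricDeriv he hy i l j)).sub
      (contDiffAt_metricDeriv he hy i j l)))

lemma contDiffAt_christoffelForm (he : e ∈ IsManifold.maximalAtlas (𝓡 n) ∞ M)
    (hy : y ∈ e.target) : ContDiffAt ℝ ∞ (christoffelForm e) y := by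
  unfold christoffelForm
  exact ContDiffAt.sum fun k _ => ContDiffAt.sum fun i _ => ContDiffAt.sum fun j _ =>
    (contDiffAt_christoffel he hy k i j).neg.smul contDiffAt_const

/-- Near the centre of a chart in which the metric is the identity at the centre. -/
lemma exists_metricBounds (he : e ∈ IsManifold.maximalAtlas (𝓡 n) ∞ M)
    (h0 : (0 : EuclideanSpace ℝ (Fin n)) ∈ e.target) (h1 : metricMatrix e 0 = 1) :
    ∃ R₀ > 0, ∃ Mg Lg K, 0 ≤ K ∧ Metric.ball 0 R₀ ⊆ e.target ∧
      (∀ y, ‖y‖ < R₀ → ‖christoffelForm e y‖ ≤ K) ∧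
      ∀ R ≤ R₀, MetricBounds (coordMetric e) R (1 / 2) Mg Lg := by
  obtain ⟨Lg, t, ht, hLip⟩ :=
    ((contDiffAt_coordMetric he h0).of_le (m := 1) (by simp)).exists_lipschitzOnWith
  have hK : ∀ᶠ y in 𝓝 (0 : EuclideanSpace ℝ (Fin n)), ‖christoffelForm e y‖ <
      ‖christoffelForm e (0 : EuclideanSpace ℝ (Fin n))‖ + 1 :=
    (contDiffAt_christoffelForm he h0).continuousAt.norm.eventually (gt_mem_nhds (by linarith))
  obtain ⟨R₁, hR₁, hball⟩ := Metric.eventually_nhds_iff_ball.1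
    (((eventually_mem_set.2 ht).and hK).and (eventually_mem_set.2 (e.open_target.mem_nhds h0)))
  have hid : ∀ v w, coordMetric e (0 : EuclideanSpace ℝ (Fin n)) v w = inner ℝ v w := by
    intro v w
    rw [coordMetric_apply_sum, h1, PiLp.inner_apply]
    refine Finset.sum_congr rfl fun i _ => ?_
    simp [Matrix.one_apply, mul_comm]
  have happ : ∀ L : EuclideanSpace ℝ (Fin n) →L[ℝ] EuclideanSpace ℝ (Fin n) →L[ℝ] ℝ, ∀ v w,
      |L v w| ≤ ‖L‖ * ‖v‖ * ‖w‖ := fun L v w => L.le_opNorm₂ v w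
  have hlip : ∀ y c, ‖y‖ < R₁ → ‖c‖ < R₁ → ∀ v w,
      |coordMetric e y v w - coordMetric e c v w| ≤ Lg * ‖y - c‖ * ‖v‖ * ‖w‖ := by
    intro y c hy hc v w
    have hd := hLip.dist_le_mul y (hball y (by simpa using hy)).1.1 c
      (hball c (by simpa using hc)).1.1
    rw [dist_eq_norm, dist_eq_norm] at hd
    have := happ (coordMetric e y - coordMetric e c) v w
    simp only [_root_.sub_apply] at this
    refine this.trans ?_
    gcongr
  -- Within `3/4` of the Euclidean product the metric is at least `1/4 = (1/2)²` and at most `7/4 ≤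
  -- 2` times it, whence the constants `1/2` and `2`.
  have hdiff : ∀ y, ‖y‖ < min R₁ (3 / 4 / (Lg + 1)) → ∀ v w,
      |coordMetric e y v w - inner ℝ v w| ≤ 3 / 4 * ‖v‖ * ‖w‖ := by
    intro y hy v w
    have h2 := hlip y 0 (hy.trans_le (min_le_left _ _)) (by simpa) v w
    rw [hid, sub_zero] at h2
    refine h2.trans ?_
    have h3 := hy.le.trans (min_le_right _ _)
    rw [le_div_iff₀ (by positivity)] at h3
    have : (Lg : ℝ) * ‖y‖ ≤ 3 / 4 := by nlinarith [norm_nonneg y]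
    gcongr
  refine ⟨min R₁ (3 / 4 / (Lg + 1)), by positivity, 2, Lg, _, by positivity, ?_,
    fun y hy => (hball y (by simpa using hy.trans_le (min_le_left _ _))).1.2.le, ?_⟩
  · intro y hy
    rw [Metric.mem_ball, dist_zero_right] at hy
    exact (hball y (by simpa using hy.trans_le (min_le_left _ _))).2
  · intro R hR
    refine ⟨by norm_num, by norm_num, Lg.2, ?_, ?_, ?_, ?_⟩
    · intros; exact coordMetric_symm _ _
    · intro y hy v
      have := (abs_le.1 (hdiff y (hy.trans_le hR) v v)).1
      rw [real_inner_self_eq_norm_sq] at this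
      nlinarith
    · intro y hy v w
      have h2 := hdiff y (hy.trans_le hR) v w
      have h3 := abs_real_inner_le_norm v w
      have h4 := abs_sub_abs_le_abs_sub (coordMetric e y v w) (inner ℝ v w)
      have : 0 ≤ ‖v‖ * ‖w‖ := by positivity
      linarith
    · intro y hy c hc v w
      exact hlip y c (hy.trans_le (hR.trans (min_le_left _ _)))
        (hc.trans_le (hR.trans (min_le_left _ _))) v w

end ChartSmoothness

/-! ### Riemannian distance against coordinate distance -/

section ChartLipschitz

open Filter

open scoped ENNReal

variable {n : ℕ} {M : Type*} [EMetricSpace M] [ChartedSpace (EuclideanSpace ℝ (Fin n)) M]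
  [IsManifold (𝓡 n) ∞ M] [Bundle.RiemannianBundle (fun x : M => TangentSpace (𝓡 n) x)]
  [IsRiemannianManifold (𝓡 n) M]
  {e : OpenPartialHomeomorph M (EuclideanSpace ℝ (Fin n))}

/-- The Riemannian distance is at most the length of the image of the straight segment, which stays
in the convex coordinate ball, where the metric is at most `Mg` times the Euclidean one. -/
lemma edist_symm_le (he : e ∈ IsManifold.maximalAtlas (𝓡 n) ∞ M) {R m Mg Lg : ℝ}
    (hsub : Metric.ball 0 R ⊆ e.target) (hg : MetricBounds (coordMetric e) R m Mg Lg)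
    {y y' : EuclideanSpace ℝ (Fin n)} (hy : ‖y‖ < R) (hy' : ‖y'‖ < R) :
    edist (e.symm y) (e.symm y') ≤ ENNReal.ofReal (√Mg) * edist y y' := by
  let η := ContinuousAffineMap.lineMap (R := ℝ) y y'
  set γ := e.symm ∘ η with hγ
  have hη : ∀ t ∈ Set.Icc (0 : ℝ) 1, η t ∈ Metric.ball (0 : EuclideanSpace ℝ (Fin n)) R := by
    intro t ht
    apply (convex_ball (0 : EuclideanSpace ℝ (Fin n)) R).segment_subset (x := y) (y := y')
      (by simpa) (by simpa)
    rw [segment_eq_image_lineMap]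
    exact ⟨t, ht, rfl⟩
  have η_smooth : ContMDiff 𝓘(ℝ, ℝ) (𝓡 n) 1 η := by
    rw [contMDiff_iff_contDiff]
    exact ContinuousAffineMap.contDiff _
  rw [IsRiemannianManifold.out (I := 𝓡 n) (e.symm y) (e.symm y')]
  have hle : Manifold.riemannianEDist (𝓡 n) (e.symm y) (e.symm y') ≤
      Manifold.pathELength (𝓡 n) γ 0 1 := by
    apply Manifold.riemannianEDist_le_pathELength _ _ _ zero_le_one
    · exact ((contMDiffOn_symm_of_mem_maximalAtlas he).of_le (by simp)).comp η_smooth.contMDiffOn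
        fun t ht => hsub (hη t ht)
    · simp [γ, η, ContinuousAffineMap.coe_lineMap_eq]
    · simp [γ, η, ContinuousAffineMap.coe_lineMap_eq]
  refine hle.trans ?_
  rw [← lintegral_fderiv_lineMap_eq_edist, Manifold.pathELength_eq_lintegral_mfderivWithin_Icc,
    ← MeasureTheory.lintegral_const_mul' _ _ ENNReal.ofReal_ne_top]
  apply MeasureTheory.setLIntegral_mono' measurableSet_Icc (fun t ht ↦ ?_)
  have : mfderivWithin 𝓘(ℝ, ℝ) (𝓡 n) γ (Set.Icc 0 1) t =
      (mfderiv (𝓡 n) (𝓡 n) e.symm (η t)) ∘L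
        (mfderivWithin 𝓘(ℝ, ℝ) (𝓡 n) η (Set.Icc 0 1) t) := by
    apply mfderiv_comp_mfderivWithin
    · exact (contMDiffAt_symm_of_mem_maximalAtlas he (hsub (hη t ht))).mdifferentiableAt (by simp)
    · exact η_smooth.contMDiffOn.mdifferentiableOn one_ne_zero t ht
    · rw [uniqueMDiffWithinAt_iff_uniqueDiffWithinAt]
      exact uniqueDiffOn_Icc zero_lt_one t ht
  have h1 : mfderivWithin 𝓘(ℝ, ℝ) (𝓡 n) γ (Set.Icc 0 1) t 1 =
      (mfderiv (𝓡 n) (𝓡 n) e.symm (η t)) (mfderivWithin 𝓘(ℝ, ℝ) (𝓡 n) η (Set.Icc 0 1) t 1) :=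
    congr($this 1)
  rw [h1]
  have hbound : ∀ (v : EuclideanSpace ℝ (Fin n)),
      ‖mfderiv (𝓡 n) (𝓡 n) e.symm (η t) v‖ₑ ≤ ENNReal.ofReal √Mg * ‖v‖ₑ := by
    intro v
    rw [← ofReal_norm, ← ofReal_norm, ← ENNReal.ofReal_mul (by positivity)]
    apply ENNReal.ofReal_le_ofReal
    have h2 := (le_abs_self _).trans (hg.upper (η t) (by simpa using hη t ht) v v)
    rw [coordMetric_apply, real_inner_self_eq_norm_sq, mul_assoc, ← sq] at h2
    have h3 := Real.le_sqrt_of_sq_le h2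
    rwa [Real.sqrt_mul hg.Mg_nonneg, Real.sqrt_sq (norm_nonneg v)] at h3
  refine (hbound _).trans (le_of_eq ?_)
  simp only [mfderivWithin_eq_fderivWithin]
  rfl

end ChartLipschitz


/-! ### Conformal harmonic discs in coordinates and their critical points -/

section DiscInChart

set_option linter.unusedSectionVars false

open Filter Laplacian

variable {n : ℕ} {M : Type*} [TopologicalSpace M] [ChartedSpace (EuclideanSpace ℝ (Fin n)) M]
  [IsManifold (𝓡 n) ∞ M]
  {e : OpenPartialHomeomorph M (EuclideanSpace ℝ (Fin n))} {u : ℂ → M} {z : ℂ}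

lemma contMDiffAt_of_disc (hu : ContMDiffOn 𝓘(ℝ, ℂ) (𝓡 n) ∞ u disc) (hz : z ∈ disc) :
    ContMDiffAt 𝓘(ℝ, ℂ) (𝓡 n) ∞ u z :=
  hu.contMDiffAt (isOpen_disc.mem_nhds hz)

lemma contDiffAt_chart (he : e ∈ IsManifold.maximalAtlas (𝓡 n) ∞ M)
    (hu : ContMDiffOn 𝓘(ℝ, ℂ) (𝓡 n) ∞ u disc) (hz : z ∈ disc) (hze : u z ∈ e.source) :
    ContDiffAt ℝ ∞ (fun z => e (u z)) z :=
  contMDiffAt_iff_contDiffAt.1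
    ((contMDiffAt_of_mem_maximalAtlas he hze).comp z (contMDiffAt_of_disc hu hz))

lemma eventually_mem_source (hu : ContMDiffOn 𝓘(ℝ, ℂ) (𝓡 n) ∞ u disc) (hz : z ∈ disc)
    (hze : u z ∈ e.source) : ∀ᶠ w in 𝓝 z, w ∈ disc ∧ u w ∈ e.source :=
  (isOpen_disc.eventually_mem hz).and
    ((contMDiffAt_of_disc hu hz).continuousAt.eventually (e.open_source.mem_nhds hze))

lemma mfderiv_eq_symm (he : e ∈ IsManifold.maximalAtlas (𝓡 n) ∞ M)
    (hu : ContMDiffOn 𝓘(ℝ, ℂ) (𝓡 n) ∞ u disc) (hz : z ∈ disc) (hze : u z ∈ e.source) (v : ℂ) :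
    (mfderiv 𝓘(ℝ, ℂ) (𝓡 n) u z v : EuclideanSpace ℝ (Fin n)) =
      mfderiv (𝓡 n) (𝓡 n) e.symm (e (u z)) (fderiv ℝ (fun z => e (u z)) z v) := by
  have hf := contDiffAt_chart he hu hz hze
  have h1 : MDifferentiableAt (𝓡 n) (𝓡 n) e.symm (e (u z)) :=
    (contMDiffAt_symm_of_mem_maximalAtlas he (e.map_source hze)).mdifferentiableAt (by simp)
  have h2 : MDifferentiableAt 𝓘(ℝ, ℂ) (𝓡 n) (fun z => e (u z)) z :=
    (contMDiffAt_iff_contDiffAt.2 hf).mdifferentiableAt (by simp)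
  have h3 := mfderiv_comp z h1 h2
  have h4 : e.symm ∘ (fun z => e (u z)) =ᶠ[𝓝 z] u := by
    filter_upwards [eventually_mem_source hu hz hze] with w hw using e.left_inv hw.2
  rw [h4.mfderiv_eq] at h3
  have h5 := congrArg (fun L : ℂ →L[ℝ] EuclideanSpace ℝ (Fin n) => L v) h3
  refine h5.trans ?_
  have h6 : mfderiv 𝓘(ℝ, ℂ) (𝓡 n) (fun z => e (u z)) z = fderiv ℝ (fun z => e (u z)) z :=
    mfderiv_eq_fderiv
  exact congrArg (fun L : ℂ →L[ℝ] EuclideanSpace ℝ (Fin n) =>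
    mfderiv (𝓡 n) (𝓡 n) e.symm (e (u z)) (L v)) h6

variable (n) in
/-- The set of singular points of a disc. -/
def critSet (u : ℂ → M) : Set ℂ := {z | mfderiv 𝓘(ℝ, ℂ) (𝓡 n) u z = 0}

lemma mem_critSet_iff (he : e ∈ IsManifold.maximalAtlas (𝓡 n) ∞ M)
    (hu : ContMDiffOn 𝓘(ℝ, ℂ) (𝓡 n) ∞ u disc) (hz : z ∈ disc) (hze : u z ∈ e.source) :
    z ∈ critSet n u ↔ fderiv ℝ (fun z => e (u z)) z = 0 := by
  constructor
  · intro h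
    ext1 v
    have h1 := mfderiv_eq_symm he hu hz hze v
    have h2 : mfderiv 𝓘(ℝ, ℂ) (𝓡 n) u z = 0 := h
    rw [h2] at h1
    exact mfderiv_symm_injective he (e.map_source hze) (h1.symm.trans (map_zero _).symm)
  · intro h
    change mfderiv 𝓘(ℝ, ℂ) (𝓡 n) u z = 0
    ext1 v
    refine (mfderiv_eq_symm he hu hz hze v).trans ?_
    rw [h]
    exact map_zero (mfderiv (𝓡 n) (𝓡 n) e.symm (e (u z)))

lemma fderiv_eq_zero_iff_gradSq {Y : Type*} [NormedAddCommGroup Y] [InnerProductSpace ℝ Y]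
    {f : ℂ → Y} : fderiv ℝ f z = 0 ↔ gradSq f z = 0 := by
  unfold gradSq dirD
  constructor
  · intro h; rw [h]; simp
  · intro h
    have h1 : ‖fderiv ℝ f z 1‖ ^ 2 = 0 := by
      nlinarith [sq_nonneg ‖fderiv ℝ f z 1‖, sq_nonneg ‖fderiv ℝ f z Complex.I‖]
    have h2 : ‖fderiv ℝ f z Complex.I‖ ^ 2 = 0 := by
      nlinarith [sq_nonneg ‖fderiv ℝ f z 1‖, sq_nonneg ‖fderiv ℝ f z Complex.I‖]
    have h1' : fderiv ℝ f z 1 = 0 := by simpa using h1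
    have h2' : fderiv ℝ f z Complex.I = 0 := by simpa using h2
    ext1 v
    have : v = v.re • (1 : ℂ) + v.im • Complex.I := by
      simp [Complex.re_add_im]
    rw [this, map_add, map_smul, map_smul, h1', h2']
    simp

variable [Bundle.RiemannianBundle (fun x : M => TangentSpace (𝓡 n) x)]

lemma inner_mfderiv_eq (he : e ∈ IsManifold.maximalAtlas (𝓡 n) ∞ M)
    (hu : ContMDiffOn 𝓘(ℝ, ℂ) (𝓡 n) ∞ u disc) (hz : z ∈ disc) (hze : u z ∈ e.source) (v w : ℂ) :
    inner ℝ (mfderiv 𝓘(ℝ, ℂ) (𝓡 n) u z v) (mfderiv 𝓘(ℝ, ℂ) (𝓡 n) u z w) =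
      coordMetric e (e (u z)) (fderiv ℝ (fun z => e (u z)) z v)
        (fderiv ℝ (fun z => e (u z)) z w) := by
  rw [coordMetric_apply]
  exact inner_tangent_congr (e.left_inv hze).symm (mfderiv_eq_symm he hu hz hze v)
    (mfderiv_eq_symm he hu hz hze w)

lemma IsConformalDisc.coord (he : e ∈ IsManifold.maximalAtlas (𝓡 n) ∞ M)
    (hu : IsConformalDisc (n := n) u) (hz : z ∈ disc) (hze : u z ∈ e.source) :
    coordMetric e (e (u z)) (dirD 1 (fun z => e (u z)) z) (dirD 1 (fun z => e (u z)) z) =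
      coordMetric e (e (u z)) (dirD Complex.I (fun z => e (u z)) z)
        (dirD Complex.I (fun z => e (u z)) z) ∧
    coordMetric e (e (u z)) (dirD 1 (fun z => e (u z)) z)
      (dirD Complex.I (fun z => e (u z)) z) = 0 := by
  obtain ⟨lam, -, hlam⟩ := hu.2 z hz
  have h := fun v w => (inner_mfderiv_eq he hu.1 hz hze v w).symm.trans (hlam v w)
  unfold dirD
  rw [h, h, h]
  simp

/-- A nonzero kernel vector forces the conformal factor to vanish, and with it the whole
differential: there are no points of rank one. -/
lemma IsConformalDisc.injective (hu : IsConformalDisc (n := n) u) (hz : z ∈ disc)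
    (hS : z ∉ critSet n u) : Function.Injective (mfderiv 𝓘(ℝ, ℂ) (𝓡 n) u z) := by
  obtain ⟨lam, -, hlam⟩ := hu.2 z hz
  apply (injective_iff_map_eq_zero (mfderiv 𝓘(ℝ, ℂ) (𝓡 n) u z)).2
  intro v hv
  by_contra hv0
  apply hS
  have h1 := hlam v v
  rw [hv, inner_self_eq_zero.2 rfl] at h1
  have h2 : lam = 0 := by
    rcases mul_eq_zero.1 h1.symm with h | h
    · exact h
    · exact absurd (inner_self_eq_zero.1 h) hv0
  change mfderiv 𝓘(ℝ, ℂ) (𝓡 n) u z = 0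
  ext1 w
  have h3 := hlam w w
  rw [h2, zero_mul] at h3
  exact inner_self_eq_zero.1 h3

lemma IsHarmonicDisc.quadraticSystemAt (he : e ∈ IsManifold.maximalAtlas (𝓡 n) ∞ M)
    (hu : IsHarmonicDisc (n := n) u) (hz : z ∈ disc) (hze : u z ∈ e.source) :
    QuadraticSystemAt (christoffelForm e) (fun z => e (u z)) z := by
  ext k
  have h := hu.2 z hz e he hze k
  rw [PiLp.add_apply, christoffelForm_apply, christoffelForm_apply, ← neg_add,
    ← Finset.sum_add_distrib, eq_neg_iff_add_eq_zero]
  refine Eq.trans ?_ h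
  congr 1
  refine Finset.sum_congr rfl fun i _ => ?_
  rw [← Finset.sum_add_distrib]
  refine Finset.sum_congr rfl fun j _ => ?_
  unfold dirD
  ring

variable [IsContMDiffRiemannianBundle (𝓡 n) ∞ (EuclideanSpace ℝ (Fin n))
      (fun x : M => TangentSpace (𝓡 n) x)]

lemma IsHarmonicDisc.locallyPolarAt_critSet (hu : IsHarmonicDisc (n := n) u) (hz : z ∈ disc) :
    LocallyPolarAt (critSet n u) z := by
  set e := chartAt (EuclideanSpace ℝ (Fin n)) (u z) with hedef
  have he : e ∈ IsManifold.maximalAtlas (𝓡 n) ∞ M := IsManifold.chart_mem_maximalAtlas (u z)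
  have hze : u z ∈ e.source := mem_chart_source _ _
  have hev := eventually_mem_source hu.1 hz hze
  refine locallyPolarAt_of_quadraticSystem (𝔅 := christoffelForm e) (f := fun z => e (u z))
    ((contDiffAt_chart he hu.1 hz hze).of_le (WithTop.coe_le_coe.2 (le_top : (3 : ℕ∞) ≤ ⊤)))
    ((contDiffAt_christoffelForm he (e.map_source hze)).of_le (by simp)) ?_ ?_
  · filter_upwards [hev] with w hw using hu.quadraticSystemAt he hw.1 hw.2
  · filter_upwards [hev] with w hw
    rw [mem_critSet_iff he hu.1 hw.1 hw.2, fderiv_eq_zero_iff_gradSq]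

/-- By unique continuation across polar sets the interior of the critical set is relatively closed
in the disc. If it is nonempty, then `du = 0` throughout and `u` is constant by connectedness; if it
is empty, regularization from the complement is meaningful at every point. -/
lemma IsHarmonicDisc.const_or_neBot (hu : IsHarmonicDisc (n := n) u) :
    (∃ q, ∀ z ∈ disc, u z = q) ∨ ∀ z ∈ disc, NeBot (𝓝[(critSet n u)ᶜ] z) := by
  have hconn : IsPreconnected disc := (convex_ball (0 : ℂ) 1).isPreconnected
  by_cases hne : (disc ∩ interior (critSet n u)).Nonempty
  · left
    have hsub : disc ⊆ interior (critSet n u) := by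
      refine hconn.subset_of_closure_inter_subset isOpen_interior hne ?_
      rintro z ⟨hz, hzd⟩
      exact mem_interior_iff_mem_nhds.2 ((hu.locallyPolarAt_critSet hzd).mem_nhds hz)
    have hloc : ∀ z ∈ disc, ∀ᶠ w in 𝓝 z, u w = u z := by
      intro z hz
      set e := chartAt (EuclideanSpace ℝ (Fin n)) (u z) with hedef
      have he : e ∈ IsManifold.maximalAtlas (𝓡 n) ∞ M := IsManifold.chart_mem_maximalAtlas (u z)
      have hze : u z ∈ e.source := mem_chart_source _ _
      obtain ⟨r, hr, hball⟩ := Metric.eventually_nhds_iff_ball.1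
        (eventually_mem_source hu.1 hz hze)
      have hconst : ∀ w ∈ Metric.ball z r, e (u z) = e (u w) := by
        intro w hw
        refine (convex_ball z r).is_const_of_fderivWithin_eq_zero (𝕜 := ℝ)
          (f := fun z => e (u z)) ?_ ?_ (Metric.mem_ball_self hr) hw
        · intro x hx
          exact ((contDiffAt_chart he hu.1 (hball x hx).1 (hball x hx).2).differentiableAt
            (by simp)).differentiableWithinAt
        · intro x hx
          rw [fderivWithin_of_isOpen Metric.isOpen_ball hx]
          exact (mem_critSet_iff he hu.1 (hball x hx).1 (hball x hx).2).1
            (interior_subset (hsub (hball x hx).1))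
      filter_upwards [Metric.ball_mem_nhds z hr] with w hw
      exact e.injOn (hball w hw).2 hze (hconst w hw).symm
    have hpre : PreconnectedSpace disc := isPreconnected_iff_preconnectedSpace.1 hconn
    have hlc : IsLocallyConstant (fun z : disc => u z) := by
      rw [IsLocallyConstant.iff_eventually_eq]
      intro z
      exact continuousAt_subtype_val.eventually (hloc z z.2)
    have h0 : (0 : ℂ) ∈ disc := by simp [disc]
    exact ⟨u 0, fun z hz => hlc.apply_eq_of_preconnectedSpace ⟨z, hz⟩ ⟨0, h0⟩⟩
  · right
    intro z hz
    rw [← mem_closure_iff_nhdsWithin_neBot, closure_compl]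
    exact fun h => hne ⟨z, hz, h⟩

end DiscInChart


/-! ### Affine reparametrization and restriction to small immersed discs -/

section AffineChange

open Filter Laplacian

variable {E : Type*} [NormedAddCommGroup E] [NormedSpace ℝ E] {F : ℂ → E} {c : ℂ} {s : ℝ} {z : ℂ}

lemma hasFDerivAt_affine (c : ℂ) (s : ℝ) (z : ℂ) :
    HasFDerivAt (fun w : ℂ => c + s • w) (s • ContinuousLinearMap.id ℝ ℂ) z :=
  ((hasFDerivAt_id z).const_smul s).const_add c

lemma contDiff_affine (c : ℂ) (s : ℝ) {k : ℕ∞ω} : ContDiff ℝ k (fun w : ℂ => c + s • w) :=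
  contDiff_const.add (contDiff_const_smul s)

lemma tendsto_affine (c : ℂ) (s : ℝ) (z : ℂ) :
    Tendsto (fun w : ℂ => c + s • w) (𝓝 z) (𝓝 (c + s • z)) :=
  (contDiff_affine c s (k := 0)).continuous.tendsto z

lemma dirD_comp_affine {v : ℂ} (hF : DifferentiableAt ℝ F (c + s • z)) :
    dirD v (fun w => F (c + s • w)) z = s • dirD v F (c + s • z) := by
  have h := hF.hasFDerivAt.comp z (hasFDerivAt_affine c s z)
  unfold dirD
  rw [show (fun w => F (c + s • w)) = F ∘ fun w : ℂ => c + s • w from rfl, h.fderiv]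
  simp

lemma dirD_dirD_comp_affine {v : ℂ} (hF : ContDiffAt ℝ 2 F (c + s • z)) :
    dirD v (dirD v (fun w => F (c + s • w))) z = s ^ 2 • dirD v (dirD v F) (c + s • z) := by
  have h1 : dirD v (fun w => F (c + s • w)) =ᶠ[𝓝 z] fun w => s • dirD v F (c + s • w) := by
    have := (tendsto_affine c s z).eventually (hF.eventually (by simp))
    filter_upwards [this] with w hw using dirD_comp_affine (hw.differentiableAt (by simp))
  have h2 : DifferentiableAt ℝ (dirD v F) (c + s • z) :=
    (contDiffAt_dirD (m := 1) hF (by norm_num)).differentiableAt (by simp)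
  have h3 : DifferentiableAt ℝ (fun w => dirD v F (c + s • w)) z :=
    h2.fun_comp' z (hasFDerivAt_affine c s z).differentiableAt
  rw [dirD_congr h1]
  have h4 : dirD v (fun w => s • dirD v F (c + s • w)) z =
      s • dirD v (fun w => dirD v F (c + s • w)) z := by
    unfold dirD
    have := (h3.hasFDerivAt.const_smul s).fderiv
    exact congrArg (fun L : ℂ →L[ℝ] E => L v) this
  rw [h4, dirD_comp_affine h2, smul_smul, sq]

lemma laplacian_comp_affine (hF : ContDiffAt ℝ 2 F (c + s • z)) :
    (Δ (fun w => F (c + s • w))) z = s ^ 2 • (Δ F) (c + s • z) := by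
  have h : ContDiffAt ℝ 2 (fun w => F (c + s • w)) z :=
    hF.comp z (contDiff_affine c s).contDiffAt
  rw [laplacian_eq_dirD h, laplacian_eq_dirD hF, dirD_dirD_comp_affine hF,
    dirD_dirD_comp_affine hF, smul_add]

end AffineChange

section SubDisc

set_option linter.unusedSectionVars false

open Filter Laplacian

variable {n : ℕ} {M : Type*} [TopologicalSpace M] [ChartedSpace (EuclideanSpace ℝ (Fin n)) M]
  [IsManifold (𝓡 n) ∞ M] [Bundle.RiemannianBundle (fun x : M => TangentSpace (𝓡 n) x)]
  {u : ℂ → M} {c : ℂ} {s : ℝ}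

lemma contMDiffOn_comp_affine (hu : ContMDiffOn 𝓘(ℝ, ℂ) (𝓡 n) ∞ u disc)
    (hmaps : ∀ w ∈ disc, c + s • w ∈ disc) :
    ContMDiffOn 𝓘(ℝ, ℂ) (𝓡 n) ∞ (fun w => u (c + s • w)) disc :=
  hu.comp (contMDiff_iff_contDiff.2 (contDiff_affine c s)).contMDiffOn hmaps

lemma mfderiv_comp_affine (hu : ContMDiffOn 𝓘(ℝ, ℂ) (𝓡 n) ∞ u disc) {w : ℂ}
    (hw : c + s • w ∈ disc) (v : ℂ) :
    mfderiv 𝓘(ℝ, ℂ) (𝓡 n) (fun w => u (c + s • w)) w v =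
      mfderiv 𝓘(ℝ, ℂ) (𝓡 n) u (c + s • w) (s • v) := by
  have h1 : MDifferentiableAt 𝓘(ℝ, ℂ) (𝓡 n) u (c + s • w) :=
    (contMDiffAt_of_disc hu hw).mdifferentiableAt (by simp)
  have h2 : HasMFDerivAt 𝓘(ℝ, ℂ) 𝓘(ℝ, ℂ) (fun w : ℂ => c + s • w) w
      (s • ContinuousLinearMap.id ℝ ℂ) := (hasFDerivAt_affine c s w).hasMFDerivAt
  have h3 := (h1.hasMFDerivAt.comp w h2).mfderiv
  exact congrArg (fun L : ℂ →L[ℝ] EuclideanSpace ℝ (Fin n) => L v) h3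

lemma IsConformalDisc.comp_affine (hu : IsConformalDisc (n := n) u)
    (hmaps : ∀ w ∈ disc, c + s • w ∈ disc) :
    IsConformalDisc (n := n) (fun w => u (c + s • w)) := by
  refine ⟨contMDiffOn_comp_affine hu.1 hmaps, fun z hz => ?_⟩
  obtain ⟨lam, h0, hlam⟩ := hu.2 _ (hmaps z hz)
  refine ⟨lam * s ^ 2, by positivity, fun v w => ?_⟩
  rw [mfderiv_comp_affine hu.1 (hmaps z hz), mfderiv_comp_affine hu.1 (hmaps z hz), hlam,
    real_inner_smul_left, real_inner_smul_right]
  ring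

lemma IsHarmonicDisc.comp_affine (hu : IsHarmonicDisc (n := n) u)
    (hmaps : ∀ w ∈ disc, c + s • w ∈ disc) :
    IsHarmonicDisc (n := n) (fun w => u (c + s • w)) := by
  refine ⟨contMDiffOn_comp_affine hu.1 hmaps, fun z hz e he hze k => ?_⟩
  have h := hu.2 _ (hmaps z hz) e he hze k
  have hf : ContDiffAt ℝ 2 (fun z => e (u z)) (c + s • z) :=
    (contDiffAt_chart he hu.1 (hmaps z hz) hze).of_le
      (WithTop.coe_le_coe.2 (le_top : (2 : ℕ∞) ≤ ⊤))
  have hd : ∀ v, fderiv ℝ (fun z' => e (u (c + s • z'))) z v =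
      s • fderiv ℝ (fun z' => e (u z')) (c + s • z) v := fun v =>
    dirD_comp_affine (hf.differentiableAt (by simp))
  have hl := laplacian_comp_affine hf
  rw [hl]
  simp only [hd, PiLp.smul_apply, smul_eq_mul]
  have h' := congrArg (fun t => s ^ 2 * t) h
  simp only [mul_zero, mul_add, Finset.mul_sum] at h'
  rw [← h']
  congr 1
  refine Finset.sum_congr rfl fun i _ => Finset.sum_congr rfl fun j _ => ?_
  ring

lemma IsConformalHarmonicDisc.comp_affine (hu : IsConformalHarmonicDisc (n := n) u) (hs : s ≠ 0)
    (hmaps : ∀ w ∈ disc, c + s • w ∈ disc) (hcrit : ∀ w ∈ disc, c + s • w ∉ critSet n u) :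
    IsConformalHarmonicImmersedDisc (n := n) (fun w => u (c + s • w)) := by
  refine ⟨⟨hu.1.comp_affine hmaps, hu.2.comp_affine hmaps⟩, fun z hz v w hvw => ?_⟩
  have h := (mfderiv_comp_affine hu.1.1 (hmaps z hz) v).symm.trans
    (hvw.trans (mfderiv_comp_affine hu.1.1 (hmaps z hz) w))
  exact smul_right_injective ℂ hs (hu.1.injective (hmaps z hz) (hcrit z hz) h)

lemma isOpen_regular (hu : ContMDiffOn 𝓘(ℝ, ℂ) (𝓡 n) ∞ u disc) {z : ℂ} (hz : z ∈ disc)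
    (hS : z ∉ critSet n u) : ∀ᶠ w in 𝓝 z, w ∉ critSet n u := by
  set e := chartAt (EuclideanSpace ℝ (Fin n)) (u z) with hedef
  have he : e ∈ IsManifold.maximalAtlas (𝓡 n) ∞ M := IsManifold.chart_mem_maximalAtlas (u z)
  have hze : u z ∈ e.source := mem_chart_source _ _
  have h1 : ContinuousAt (fderiv ℝ (fun z => e (u z))) z :=
    ((contDiffAt_chart he hu hz hze).fderiv_right (m := 0) (by simp)).continuousAt
  rw [mem_critSet_iff he hu hz hze] at hS
  filter_upwards [h1.eventually_ne hS, eventually_mem_source hu hz hze] with w hw hw'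
  rwa [mem_critSet_iff he hu hw'.1 hw'.2]

/-- An MPSH function `σ` restricted to a disc is viscosity subharmonic off the singular points. -/
lemma MPSHOn.laplacian_nonneg {σ : M → EReal} {W : Set M} (hσ : MPSHOn n σ W) (hW : IsOpen W)
    (hu : IsConformalHarmonicDisc (n := n) u) {z : ℂ} (hz : z ∈ disc) (hS : z ∉ critSet n u)
    (hzW : u z ∈ W) {G φ : ℂ → ℝ} (hG : ∀ᶠ w in 𝓝 z, σ (u w) = (G w : EReal))
    (hφ : ContDiffAt ℝ 2 φ z) (hmax : IsLocalMax (fun w => G w - φ w) z) : 0 ≤ (Δ φ) z := by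
  have hev : ∀ᶠ w in 𝓝 z, w ∈ disc ∧ w ∉ critSet n u ∧ u w ∈ W :=
    (isOpen_disc.eventually_mem hz).and ((isOpen_regular hu.1.1 hz hS).and
      ((contMDiffAt_of_disc hu.1.1 hz).continuousAt.eventually (hW.mem_nhds hzW)))
  -- A small disc about `z` without critical points, rescaled to the unit disc, is an immersed disc
  -- to which the MPSH property applies.
  obtain ⟨s, hs, hball⟩ := Metric.eventually_nhds_iff_ball.1 hev
  have hin : ∀ w ∈ disc, z + s • w ∈ Metric.ball z s := by
    intro w hw
    rw [Metric.mem_ball, dist_eq_norm, add_sub_cancel_left, norm_smul, Real.norm_of_nonneg hs.le]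
    have := mem_disc.1 hw
    nlinarith
  have hsub := hσ.subharmonic (fun w => u (z + s • w))
    (hu.comp_affine hs.ne' (fun w hw => (hball _ (hin w hw)).1)
      fun w hw => (hball _ (hin w hw)).2.1) fun w hw => (hball _ (hin w hw)).2.2
  have ht : Tendsto (fun w : ℂ => z + s • w) (𝓝 0) (𝓝 z) := by
    simpa using tendsto_affine z s 0
  have e0 : z + s • (0 : ℂ) = z := by simp
  have hφ' : ContDiffAt ℝ 2 φ (z + s • (0 : ℂ)) := by rwa [e0]
  have key := hsub.laplacian_nonneg_of_touching (G := fun w => G (z + s • w))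
    (φ := fun w => φ (z + s • w)) (ht.eventually hG)
    (hφ'.comp (0 : ℂ) (contDiff_affine z s).contDiffAt) (by
      change ∀ᶠ w in 𝓝 (0 : ℂ), G (z + s • w) - φ (z + s • w) ≤
        G (z + s • (0 : ℂ)) - φ (z + s • (0 : ℂ))
      rw [e0]
      exact ht.eventually hmax)
  rw [laplacian_comp_affine hφ', e0, smul_eq_mul] at key
  exact nonneg_of_mul_nonneg_right key (by positivity)

end SubDisc


/-! ### The function `ρ ∘ u` and its regularization -/

section Potential

set_option linter.unusedSectionVars false

open Filter Laplacian

variable {n : ℕ} {M : Type*} [TopologicalSpace M] [ChartedSpace (EuclideanSpace ℝ (Fin n)) M]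
  [IsManifold (𝓡 n) ∞ M] [Bundle.RiemannianBundle (fun x : M => TangentSpace (𝓡 n) x)]
  {u : ℂ → M} {ρ : M → EReal} {z : ℂ}

/-- The real valued function `ρ ∘ u`. -/
noncomputable def potential (ρ : M → EReal) (u : ℂ → M) (z : ℂ) : ℝ := (ρ (u z)).toReal

lemma coe_potential (hρ : MPSHOn n ρ Set.univ) (hpos : ∀ z ∈ disc, 0 ≤ ρ (u z)) (hz : z ∈ disc) :
    (potential ρ u z : EReal) = ρ (u z) :=
  EReal.coe_toReal (hρ.lt_top _ (Set.mem_univ _)).ne (fun h => by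
    have := hpos z hz
    rw [h] at this
    exact absurd this (by simp))

lemma potential_nonneg (hpos : ∀ z ∈ disc, 0 ≤ ρ (u z)) (hz : z ∈ disc) : 0 ≤ potential ρ u z :=
  EReal.toReal_nonneg (hpos z hz)

lemma upperSemicontinuousOn_potential (hρ : MPSHOn n ρ Set.univ)
    (hpos : ∀ z ∈ disc, 0 ≤ ρ (u z)) (hu : ContMDiffOn 𝓘(ℝ, ℂ) (𝓡 n) ∞ u disc) :
    UpperSemicontinuousOn (potential ρ u) disc := by
  intro z hz y hy
  have h1 : ρ (u z) < (y : EReal) := by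
    rw [← coe_potential hρ hpos hz]; exact EReal.coe_lt_coe_iff.2 hy
  have h2 := hρ.usc (u z) (Set.mem_univ _) _ h1
  rw [nhdsWithin_univ] at h2
  have h3 := (hu.continuousOn z hz).eventually h2
  filter_upwards [h3, self_mem_nhdsWithin] with w hw hwd
  rw [← coe_potential hρ hpos hwd] at hw
  exact EReal.coe_lt_coe_iff.1 hw

lemma viscAt_potential (hρ : MPSHOn n ρ Set.univ) (hpos : ∀ z ∈ disc, 0 ≤ ρ (u z))
    (hu : IsConformalHarmonicDisc (n := n) u) (hz : z ∈ disc) (hS : z ∉ critSet n u) :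
    ViscAt (potential ρ u) 0 z := by
  intro φ hφ hmax
  refine hρ.laplacian_nonneg isOpen_univ hu hz hS (Set.mem_univ _) ?_ hφ hmax
  filter_upwards [isOpen_disc.mem_nhds hz] with w hw using (coe_potential hρ hpos hw).symm

lemma viscAt_potential_of_strict (hρ : MPSHOn n ρ Set.univ) (hpos : ∀ z ∈ disc, 0 ≤ ρ (u z))
    (hu : IsConformalHarmonicDisc (n := n) u) (hz : z ∈ disc) (hS : z ∉ critSet n u)
    {e : OpenPartialHomeomorph M (EuclideanSpace ℝ (Fin n))}
    (he : e ∈ IsManifold.maximalAtlas (𝓡 n) ∞ M) {ε : ℝ} {V : Set M} (hV : IsOpen V)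
    (hσ : MPSHOn n (fun x => ρ x - ((ε * ‖e x‖ ^ 2 : ℝ) : EReal)) V) (hzV : u z ∈ V)
    (hze : u z ∈ e.source) :
    ViscAt (potential ρ u) (ε * (Δ (fun w => ‖e (u w)‖ ^ 2)) z) z := by
  intro φ hφ hmax
  have hf : ContDiffAt ℝ 2 (fun w => e (u w)) z := (contDiffAt_chart he hu.1.1 hz hze).of_le
    (WithTop.coe_le_coe.2 (le_top : (2 : ℕ∞) ≤ ⊤))
  have hn : ContDiffAt ℝ 2 (fun w => ‖e (u w)‖ ^ 2) z := contDiffAt_normSq hf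
  have hn' : ContDiffAt ℝ 2 (fun w => ε * ‖e (u w)‖ ^ 2) z := contDiffAt_const.mul hn
  have key := hσ.laplacian_nonneg hV hu hz hS hzV
    (G := fun w => potential ρ u w - ε * ‖e (u w)‖ ^ 2)
    (φ := fun w => φ w - ε * ‖e (u w)‖ ^ 2) ?_ (hφ.sub hn') ?_
  · rw [laplacian_fun_sub hφ hn', laplacian_const_mul _ hn] at key
    linarith
  · filter_upwards [isOpen_disc.mem_nhds hz] with w hw
    rw [EReal.coe_sub, coe_potential hρ hpos hw]
  · filter_upwards [hmax] with w hw
    linarith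

/-- An upper bound for `ρ ∘ u` near `b` holds on a relatively open part of the disc, so it passes to
the upper limits defining the regularization. -/
lemma tendsto_regularize_potential (hρ : MPSHOn n ρ Set.univ) (hpos : ∀ z ∈ disc, 0 ≤ ρ (u z))
    (hu : ContMDiffOn 𝓘(ℝ, ℂ) (𝓡 n) ∞ u disc)
    (hne : ∀ z ∈ disc, NeBot (𝓝[(critSet n u)ᶜ] z)) {b : ℂ}
    (hlim : Tendsto (fun z => ρ (u z)) (𝓝[disc] b) (𝓝 0)) :
    Tendsto (regularize (critSet n u) (potential ρ u)) (𝓝[disc] b) (𝓝 0) := by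
  have h0 : ∀ z ∈ disc, 0 ≤ potential ρ u z := fun z hz => potential_nonneg hpos hz
  rw [Metric.tendsto_nhds]
  intro δ hδ
  have h1 : ∀ᶠ z in 𝓝[disc] b, ρ (u z) < ((δ / 2 : ℝ) : EReal) :=
    hlim.eventually (gt_mem_nhds (by exact_mod_cast (by positivity : (0 : ℝ) < δ / 2)))
  obtain ⟨U, hUo, hbU, hU⟩ := mem_nhdsWithin.1 h1
  filter_upwards [mem_nhdsWithin_of_mem_nhds (hUo.mem_nhds hbU), self_mem_nhdsWithin]
    with z hzU hzd
  have := hne z hzd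
  have h2 : regularize (critSet n u) (potential ρ u) z ≤ δ / 2 := by
    refine regularize_le isOpen_disc h0 hzd (mem_nhdsWithin_of_mem_nhds ?_)
    filter_upwards [hUo.mem_nhds hzU, isOpen_disc.mem_nhds hzd] with w hwU hwd
    have h3 : ρ (u w) < ((δ / 2 : ℝ) : EReal) := hU ⟨hwU, hwd⟩
    rw [← coe_potential hρ hpos hwd] at h3
    exact (EReal.coe_lt_coe_iff.1 h3).le
  have h4 := regularize_nonneg isOpen_disc h0 (upperSemicontinuousOn_potential hρ hpos hu) hzd
    (S := critSet n u)
  rw [dist_zero_right, Real.norm_of_nonneg h4]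
  linarith

end Potential

/-! ### The part of the disc mapped into a coordinate ball -/

section ChartDomain

set_option linter.unusedSectionVars false

open Filter Laplacian

variable {n : ℕ} {M : Type*} [TopologicalSpace M] [T2Space M]
  [ChartedSpace (EuclideanSpace ℝ (Fin n)) M]
  [IsManifold (𝓡 n) ∞ M] [Bundle.RiemannianBundle (fun x : M => TangentSpace (𝓡 n) x)]
  {u : ℂ → M} {e : OpenPartialHomeomorph M (EuclideanSpace ℝ (Fin n))} {R K : ℝ}

/-- The points which `u` maps into the coordinate ball of radius `R`. -/
def chartDomain (u : ℂ → M) (e : OpenPartialHomeomorph M (EuclideanSpace ℝ (Fin n))) (R : ℝ) :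
    Set ℂ :=
  {z | z ∈ disc ∧ u z ∈ e.source ∧ ‖e (u z)‖ < R}

lemma conformalModel_chartDomain (he : e ∈ IsManifold.maximalAtlas (𝓡 n) ∞ M)
    (hu : IsConformalHarmonicDisc (n := n) u) (hsub : Metric.ball 0 R ⊆ e.target)
    (hK : ∀ y, ‖y‖ < R → ‖christoffelForm e y‖ ≤ K) :
    ConformalModel (coordMetric e) (fun z => e (u z)) (chartDomain u e R) R K where
  isOpen := by
    rw [isOpen_iff_mem_nhds]
    rintro z ⟨hz, hze, hzR⟩
    have h1 := (contDiffAt_chart he hu.1.1 hz hze).continuousAt.norm.eventually (gt_mem_nhds hzR)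
    filter_upwards [eventually_mem_source hu.1.1 hz hze, h1] with w hw hw'
    exact ⟨hw.1, hw.2, hw'⟩
  subset z hz := hz.1
  contDiffAt z hz := (contDiffAt_chart he hu.1.1 hz.1 hz.2.1).of_le
    (WithTop.coe_le_coe.2 (le_top : (2 : ℕ∞) ≤ ⊤))
  norm_lt z hz := hz.2.2
  system z hz := by
    rw [hu.2.quadraticSystemAt he hz.1 hz.2.1]
    refine (norm_add_le _ _).trans ?_
    have h1 := hK _ hz.2.2
    have h2 : ∀ v, ‖christoffelForm e (e (u z)) v v‖ ≤ K * ‖v‖ ^ 2 := fun v => by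
      refine ((christoffelForm e (e (u z))).le_opNorm₂ v v).trans ?_
      rw [mul_assoc, ← sq]
      gcongr
    unfold gradSq
    rw [mul_add]
    exact add_le_add (h2 _) (h2 _)
  conformal z hz := (hu.1.coord he hz.1 hz.2.1).1
  orthogonal z hz := (hu.1.coord he hz.1 hz.2.1).2
  closed ρ hρ z hz hzΩ := by
    have hball : Metric.closedBall (0 : EuclideanSpace ℝ (Fin n)) ρ ⊆ Metric.ball 0 R :=
      Metric.closedBall_subset_ball hρ
    -- The image of a smaller closed coordinate ball is compact, hence closed in the Hausdorff space
    -- `M`; a point `u z` outside it has a neighbourhood outside it.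
    have hcpt : IsCompact (e.symm '' Metric.closedBall 0 ρ) :=
      (isCompact_closedBall _ _).image_of_continuousOn
        (e.continuousOn_symm.mono (hball.trans hsub))
    have hnot : u z ∉ e.symm '' Metric.closedBall 0 ρ := by
      rintro ⟨y, hy, hyz⟩
      have hyt := hsub (hball hy)
      refine hzΩ ⟨hz, ?_, ?_⟩
      · rw [← hyz]; exact e.map_target hyt
      · rw [← hyz, e.right_inv hyt]; simpa using hball hy
    filter_upwards [(contMDiffAt_of_disc hu.1.1 hz).continuousAt.eventually
      (hcpt.isClosed.isOpen_compl.mem_nhds hnot)] with w hw hn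
    exact hw ⟨e (u w), by simpa using hn.2, e.left_inv hn.1.2.1⟩

lemma continuousOn_laplacian_normSq (he : e ∈ IsManifold.maximalAtlas (𝓡 n) ∞ M)
    (hu : ContMDiffOn 𝓘(ℝ, ℂ) (𝓡 n) ∞ u disc) :
    ContinuousOn (Δ (fun w => ‖e (u w)‖ ^ 2)) (chartDomain u e R) := by
  intro z hz
  apply ContinuousAt.continuousWithinAt
  have h : ContDiffAt ℝ 4 (fun w => ‖e (u w)‖ ^ 2) z :=
    ((contDiffAt_chart he hu hz.1 hz.2.1).of_le
      (WithTop.coe_le_coe.2 (le_top : (4 : ℕ∞) ≤ ⊤))).norm_sq ℝ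
  have h1 : ∀ v, ContinuousAt (dirD v (dirD v (fun w => ‖e (u w)‖ ^ 2))) z := fun v =>
    (contDiffAt_dirD (m := 2) (contDiffAt_dirD (m := 3) h (by norm_num)) (by norm_num)).continuousAt
  refine ((h1 1).add (h1 Complex.I)).congr ?_
  filter_upwards [h.eventually (by simp)] with w hw
  exact (laplacian_eq_dirD (hw.of_le (by norm_num))).symm

end ChartDomain


/-! ### Local Hölder regularity near the cluster point -/

section BoundaryRegularity

open Filter Laplacian

variable {n : ℕ} {M : Type*}

/-- The local regularity statement in a chart centred at a point of the cluster set. -/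
lemma exists_holder_in_chart [TopologicalSpace M] [T2Space M]
    [ChartedSpace (EuclideanSpace ℝ (Fin n)) M] [IsManifold (𝓡 n) ∞ M]
    [Bundle.RiemannianBundle (fun x : M => TangentSpace (𝓡 n) x)]
    [IsContMDiffRiemannianBundle (𝓡 n) ∞ (EuclideanSpace ℝ (Fin n))
      (fun x : M => TangentSpace (𝓡 n) x)]
    {ρ : M → EReal} (hρ : MPSHOn n ρ Set.univ) {u : ℂ → M}
    (hu : IsConformalHarmonicDisc (n := n) u) (hpos : ∀ z ∈ disc, 0 ≤ ρ (u z)) {α β : ℝ}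
    (hlim : ∀ b ∈ openArc α β, Tendsto (fun z => ρ (u z)) (𝓝[disc] b) (𝓝 0))
    {a : ℂ} (ha : a ∈ openArc α β) {p : M} (hp : MapClusterPt p (𝓝[disc] a) u)
    (hne : ∀ z ∈ disc, NeBot (𝓝[(critSet n u)ᶜ] z))
    {e : OpenPartialHomeomorph M (EuclideanSpace ℝ (Fin n))} (he : IsNormalChart e p)
    {ε : ℝ} (hε : 0 < ε) {V : Set M} (hV : IsOpen V) (hpV : p ∈ V)
    (hσ : MPSHOn n (fun x => ρ x - ((ε * ‖e x‖ ^ 2 : ℝ) : EReal)) V) {R₁ : ℝ} (hR₁ : 0 < R₁) :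
    ∃ η > 0, ∃ C > 0, ∀ z ∈ disc, ‖z - a‖ < η → u z ∈ e.source ∧ ‖e (u z)‖ < R₁ ∧
      ∀ w ∈ disc, ‖w - a‖ < η → ‖e (u z) - e (u w)‖ ≤ C * √‖z - w‖ := by
  have he' := he.mem_atlas
  have h0t : (0 : EuclideanSpace ℝ (Fin n)) ∈ e.target := by
    rw [← he.map_center]; exact e.map_source he.mem_source
  have hsymm0 : e.symm 0 = p := by rw [← he.map_center]; exact e.left_inv he.mem_source
  obtain ⟨R₀, hR₀, Mg, Lg, K, hK0, hball, hK, hg⟩ := exists_metricBounds he' h0t he.metric_center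
  have hVev : ∀ᶠ y in 𝓝 (0 : EuclideanSpace ℝ (Fin n)), e.symm y ∈ V :=
    (e.continuousAt_symm h0t).eventually (by rw [hsymm0]; exact hV.mem_nhds hpV)
  obtain ⟨R₂, hR₂, hR₂V⟩ := Metric.eventually_nhds_iff_ball.1 hVev
  have hMg : 0 ≤ Mg := (hg R₀ le_rfl).Mg_nonneg
  have hLg : 0 ≤ Lg := (hg R₀ le_rfl).Lg_nonneg
  -- `R` has to fit into the ball with metric bounds, the required radius `R₁` and the set where `ρ`
  -- is strict; the last two conditions are the smallness required by the pole and by the quadratic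
  -- term.
  obtain ⟨R, hR, hRR₀, hRR₁, hRR₂, hRsmall, hKR⟩ : ∃ R > 0, R ≤ R₀ ∧ R ≤ R₁ ∧ R ≤ R₂ ∧
      2 * R * ((Lg + Mg * K) + Lg) ≤ (1 / 2) ^ 2 / 4 ∧ 4 * (K * R) ≤ 1 := by
    refine ⟨min (min R₀ (min R₁ R₂)) (min (1 / 32 / ((Lg + Mg * K) + Lg + 1)) (1 / (4 * K + 1))),
      by positivity, (min_le_left _ _).trans (min_le_left _ _),
      ((min_le_left _ _).trans (min_le_right _ _)).trans (min_le_left _ _),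
      ((min_le_left _ _).trans (min_le_right _ _)).trans (min_le_right _ _), ?_, ?_⟩
    · have h1 : min (min R₀ (min R₁ R₂)) (min (1 / 32 / ((Lg + Mg * K) + Lg + 1))
        (1 / (4 * K + 1))) ≤ 1 / 32 / ((Lg + Mg * K) + Lg + 1) :=
        (min_le_right _ _).trans (min_le_left _ _)
      have hpos : 0 < min (min R₀ (min R₁ R₂)) (min (1 / 32 / ((Lg + Mg * K) + Lg + 1))
        (1 / (4 * K + 1))) := by positivity
      rw [le_div_iff₀ (by positivity)] at h1
      linarith
    · have h1 : min (min R₀ (min R₁ R₂)) (min (1 / 32 / ((Lg + Mg * K) + Lg + 1))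
        (1 / (4 * K + 1))) ≤ 1 / (4 * K + 1) := (min_le_right _ _).trans (min_le_right _ _)
      have hpos : 0 < min (min R₀ (min R₁ R₂)) (min (1 / 32 / ((Lg + Mg * K) + Lg + 1))
        (1 / (4 * K + 1))) := by positivity
      rw [le_div_iff₀ (by positivity)] at h1
      linarith
  have hmodel := conformalModel_chartDomain he' hu
    ((Metric.ball_subset_ball hRR₀).trans hball) fun y hy => hK y (hy.trans_le hRR₀)
  set Ω := chartDomain u e R with hΩ
  set K₁ := 4 * ((Lg + Mg * K) + 2 * Lg) / (1 / 2) ^ 3 with hK₁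
  have hK₁0 : 0 ≤ K₁ := by positivity
  obtain ⟨η, hb⟩ := exists_barrierConstants (1 / 2) Mg K₁ hε hMg hK₁0
  have hr0 : ∀ z ∈ disc, 0 ≤ potential ρ u z := fun z hz => potential_nonneg hpos hz
  have hrusc := upperSemicontinuousOn_potential hρ hpos hu.1.1
  set rr := regularize (critSet n u) (potential ρ u) with hrr
  have husc : UpperSemicontinuousOn rr disc :=
    upperSemicontinuousOn_regularize isOpen_disc hr0 hrusc hne
  have hrr0 : ∀ z ∈ disc, 0 ≤ rr z := fun z hz => by
    have := hne z hz
    exact regularize_nonneg isOpen_disc hr0 hrusc hz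
  have hv0 : ∀ z ∈ disc, ViscAt rr 0 z := fun z hz =>
    viscAt_regularize (m := fun _ => 0) isOpen_disc hr0 hrusc hne
      (fun z hz => hu.2.locallyPolarAt_critSet hz) continuousOn_const
      (fun z hz hS => viscAt_potential hρ hpos hu hz hS) hz
  have hΔc : ContinuousOn (Δ (fun w => ‖e (u w)‖ ^ 2)) Ω :=
    continuousOn_laplacian_normSq he' hu.1.1
  have hmc : ContinuousOn (fun z => ε * (Δ (fun w => ‖e (u w)‖ ^ 2)) z) Ω :=
    continuousOn_const.mul hΔc
  have hv : ∀ z ∈ Ω, ViscAt rr (ε * (Δ (fun w => ‖e (u w)‖ ^ 2)) z) z := fun z hz =>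
    viscAt_regularize (m := fun z => ε * (Δ (fun w => ‖e (u w)‖ ^ 2)) z) hmodel.isOpen
      (fun z hz => hr0 z hz.1) (hrusc.mono hmodel.subset) (fun z hz => hne z hz.1)
      (fun z hz => hu.2.locallyPolarAt_critSet hz.1)
      hmc
      (fun z hz hS => viscAt_potential_of_strict hρ hpos hu hz.1 hS he' hV hσ (by
        rw [← e.left_inv hz.2.1]
        exact hR₂V _ (by simpa using hz.2.2.trans_le hRR₂)) hz.2.1) hz
  obtain ⟨r₁, hr₁, C₀, hC₀, hbdry⟩ := le_mul_dist_boundary ha husc hv0 fun b hb =>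
    tendsto_regularize_potential hρ hpos hu.1.1 hne (hlim b hb)
  -- The factor `3/2` arises because points within `d/2` of `z₀` have distance to the circle at most
  -- `3d/2`.
  obtain ⟨κ, hκ, C, hC, hκ4, hkey⟩ := holder_at_boundary_scale (hg R hRR₀) hmodel hb hK0 hRsmall
    (by rw [hK₁]; norm_num) hKR husc hrr0 hv0 hv (Cr := 3 / 2 * C₀) (by positivity)
  have ha1 := norm_openArc ha
  -- `R²/32` guarantees `2√d < R/2`, so that `‖f z₀‖ ≤ R/2` leaves room for the annulus `√d ≤ |f - f
  -- z₀| ≤ 2√d` inside the chart ball.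
  have hscale : HolderAtScale (fun z => e (u z)) Ω (R / 2) a
      (min (min (r₁ / 2) 1) (R ^ 2 / 32)) κ C := by
    intro z₀ hz₀ hz₀a hfz₀ z hz
    have hz₀1 : ‖z₀‖ < 1 := mem_disc.1 hz₀.1
    have hz₀r : ‖z₀ - a‖ < r₁ / 2 := hz₀a.trans_le ((min_le_left _ _).trans (min_le_left _ _))
    have hz₀R : ‖z₀ - a‖ < R ^ 2 / 32 := hz₀a.trans_le (min_le_right _ _)
    have hd : 1 - ‖z₀‖ ≤ ‖z₀ - a‖ := by
      rw [← ha1, norm_sub_rev]; exact norm_sub_norm_le a z₀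
    have hnear : ∀ w, ‖w - z₀‖ ≤ (1 - ‖z₀‖) / 2 → ‖w‖ ≤ ‖z₀‖ + (1 - ‖z₀‖) / 2 ∧
        ‖z₀‖ ≤ ‖w‖ + (1 - ‖z₀‖) / 2 := by
      intro w hw
      have h1 : ‖w‖ ≤ ‖z₀‖ + ‖w - z₀‖ := by simpa using norm_add_le z₀ (w - z₀)
      have h2 : ‖z₀‖ ≤ ‖w‖ + ‖w - z₀‖ := by
        have := norm_sub_le w (w - z₀)
        simpa using this
      constructor <;> linarith
    have hdisc : ∀ w, ‖w - z₀‖ ≤ (1 - ‖z₀‖) / 2 → w ∈ disc := fun w hw =>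
      mem_disc.2 (by linarith [(hnear w hw).1])
    have hsqrt : 2 * √(1 - ‖z₀‖) < R / 2 := by
      have : √(1 - ‖z₀‖) < R / 4 := by
        rw [Real.sqrt_lt' (by positivity)]
        have : R ^ 2 / 32 ≤ (R / 4) ^ 2 := by nlinarith [sq_nonneg R]
        linarith
      linarith
    refine hkey z₀ hz₀ (1 - ‖z₀‖) (by linarith) (by linarith [norm_nonneg z₀]) (by linarith)
      hdisc (fun w hw => ?_) z hz
    have h1 : ‖w - a‖ < r₁ := by
      have : ‖w - a‖ ≤ ‖w - z₀‖ + ‖z₀ - a‖ := norm_sub_le_norm_sub_add_norm_sub _ _ _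
      linarith
    refine (hbdry w (hdisc w hw) h1).trans ?_
    have h2 := (hnear w hw).2
    have : 1 - ‖w‖ ≤ 3 / 2 * (1 - ‖z₀‖) := by linarith
    calc C₀ * (1 - ‖w‖) ≤ C₀ * (3 / 2 * (1 - ‖z₀‖)) := by gcongr
      _ = 3 / 2 * C₀ * (1 - ‖z₀‖) := by ring
  have hfreq : ∀ δ > 0, ∃ z ∈ Ω, ‖z - a‖ < δ ∧ ‖e (u z)‖ < δ := by
    intro δ hδ
    have hnhds : ∀ᶠ x in 𝓝 p, x ∈ e.source ∧ ‖e x‖ < min δ R := by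
      refine (e.open_source.eventually_mem he.mem_source).and ?_
      refine (e.continuousAt he.mem_source).norm.eventually (gt_mem_nhds ?_)
      change ‖e p‖ < min δ R
      rw [he.map_center, norm_zero]
      positivity
    have h1 := mapClusterPt_iff_frequently.1 hp _ hnhds
    have h2 : ∀ᶠ z in 𝓝[disc] a, z ∈ disc ∧ ‖z - a‖ < δ := by
      filter_upwards [self_mem_nhdsWithin,
        mem_nhdsWithin_of_mem_nhds (Metric.ball_mem_nhds a hδ)] with z h3 h4
      exact ⟨h3, by simpa [dist_eq_norm] using h4⟩
    obtain ⟨z, ⟨hzs, hzn⟩, hzd, hza⟩ := (h1.and_eventually h2).exists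
    exact ⟨z, ⟨hzd, hzs, hzn.trans_le (min_le_right _ _)⟩, hza, hzn.trans_le (min_le_left _ _)⟩
  obtain ⟨η', hη', C', hC', hfin⟩ := hscale.exists_holder hκ (by linarith) hC (by positivity)
    ((min_le_left _ _).trans (min_le_right _ _)) ha1 (by positivity) hmodel.subset hfreq
  refine ⟨η', hη', C', hC', fun z hz hza => ?_⟩
  obtain ⟨h1, -, h3⟩ := hfin z hz hza
  exact ⟨h1.2.1, h1.2.2.trans_le hRR₁, h3⟩

lemma openArc_subset_closure {α β η : ℝ} {a b : ℂ} (hb : b ∈ openArc α β) (hba : ‖b - a‖ < η) :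
    b ∈ closure (disc ∩ Metric.ball a η) := by
  have h1 := norm_openArc hb
  have h2 : b ∈ closure disc := by
    rw [disc, closure_ball _ one_ne_zero]; simp [h1]
  have := Metric.isOpen_ball.inter_closure (s := Metric.ball a η) (t := disc)
    ⟨by simpa [dist_eq_norm] using hba, h2⟩
  rwa [Set.inter_comm] at this

end BoundaryRegularity

end MinimalDisc

/-! ### Conclusion: extension in the chart and return to the manifold -/

theorem theorem3p3 {n : ℕ} (hn : 2 ≤ n) {M : Type*} [EMetricSpace M]
    [ChartedSpace (EuclideanSpace ℝ (Fin n)) M] [IsManifold (𝓡 n) ∞ M]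
    [Bundle.RiemannianBundle (fun x : M => TangentSpace (𝓡 n) x)]
    [IsContMDiffRiemannianBundle (𝓡 n) ∞ (EuclideanSpace ℝ (Fin n))
      (fun x : M => TangentSpace (𝓡 n) x)]
    [IsRiemannianManifold (𝓡 n) M]
    (ρ : M → EReal) (hρ : MinimalDisc.MPSHOn n ρ Set.univ)
    (u : ℂ → M) (hu : MinimalDisc.IsConformalHarmonicDisc (n := n) u)
    (hpos : ∀ z ∈ MinimalDisc.disc, 0 ≤ ρ (u z))
    (α β : ℝ)
    (hlim : ∀ b ∈ MinimalDisc.openArc α β,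
      Filter.Tendsto (fun z => ρ (u z)) (𝓝[MinimalDisc.disc] b) (𝓝 0))
    (a : ℂ) (ha : a ∈ MinimalDisc.openArc α β)
    (p : M) (hp : MapClusterPt p (𝓝[MinimalDisc.disc] a) u)
    (hstrict : ∃ W : Set M, IsOpen W ∧ p ∈ W ∧ MinimalDisc.StrictlyMPSHOn n ρ W) :
    ∃ V ∈ 𝓝 a, ∃ v : ℂ → M, Set.EqOn v u (V ∩ MinimalDisc.disc) ∧
      ∃ C : ℝ≥0, HolderOnWith C (1 / 2) v
        (V ∩ (MinimalDisc.disc ∪ MinimalDisc.openArc α β)) := by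
  open MinimalDisc in
  rcases hu.2.const_or_neBot with ⟨q, hq⟩ | hne
  · refine ⟨Set.univ, Filter.univ_mem, fun _ => q, fun z hz => (hq z hz.2).symm, 0, ?_⟩
    intro z _ w _
    simp
  obtain ⟨W, -, hpW, hW⟩ := hstrict
  obtain ⟨e, he, ε, hε, V, hV, hpV, -, hσ⟩ := hW p hpW
  have he' := he.mem_atlas
  have h0t : (0 : EuclideanSpace ℝ (Fin n)) ∈ e.target := by
    rw [← he.map_center]; exact e.map_source he.mem_source
  obtain ⟨R₀, hR₀, Mg, Lg, K, -, hball, -, hg⟩ := exists_metricBounds he' h0t he.metric_center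
  -- Radius `R₀/2` keeps the limits of `e ∘ u` at the arc strictly inside the ball of radius `R₀`,
  -- on which `e.symm` is Lipschitz.
  obtain ⟨η, hη, C, hC, hH⟩ := exists_holder_in_chart hρ hu hpos hlim ha hp hne he hε hV hpV hσ
    (half_pos hR₀)
  have hs : ∀ z ∈ disc ∩ Metric.ball a η, z ∈ disc ∧ ‖z - a‖ < η := fun z hz =>
    ⟨hz.1, by simpa [dist_eq_norm] using hz.2⟩
  obtain ⟨F, hFs, hFlim, hF⟩ := exists_extension_of_holder (f := fun z => e (u z))
    (s := disc ∩ Metric.ball a η) hC.le fun z hz w hw =>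
      (hH z (hs z hz).1 (hs z hz).2).2.2 w (hs w hw).1 (hs w hw).2
  have hFR : ∀ z ∈ closure (disc ∩ Metric.ball a η), ‖F z‖ < R₀ := by
    intro z hz
    have := mem_closure_iff_nhdsWithin_neBot.1 hz
    have h1 : ‖F z‖ ≤ R₀ / 2 := by
      refine le_of_tendsto (hFlim z hz).norm ?_
      filter_upwards [self_mem_nhdsWithin] with w hw
      exact (hH w (hs w hw).1 (hs w hw).2).2.1.le
    linarith
  have hsub : Metric.ball a η ∩ (disc ∪ openArc α β) ⊆ closure (disc ∩ Metric.ball a η) := by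
    rintro z ⟨hza, hz | hz⟩
    · exact subset_closure ⟨hz, hza⟩
    · exact openArc_subset_closure hz (by simpa [dist_eq_norm] using hza)
  refine ⟨Metric.ball a η, Metric.ball_mem_nhds a hη, fun z => e.symm (F z), ?_,
    (√Mg).toNNReal * C.toNNReal, ?_⟩
  · rintro z ⟨hza, hz⟩
    change e.symm (F z) = u z
    rw [hFs z ⟨hz, hza⟩]
    exact e.left_inv (hH z hz (hs z ⟨hz, hza⟩).2).1
  · intro z hz w hw
    have hz' := hsub hz
    have hw' := hsub hw
    refine (edist_symm_le he' hball (hg R₀ le_rfl) (hFR z hz') (hFR w hw')).trans ?_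
    have h1 : edist (F z) (F w) ≤ ENNReal.ofReal C * edist z w ^ (1 / 2 : ℝ) := by
      rw [edist_dist, edist_dist, dist_eq_norm, dist_eq_norm,
        ENNReal.ofReal_rpow_of_nonneg (norm_nonneg _) (by norm_num), ← ENNReal.ofReal_mul hC.le,
        ← Real.sqrt_eq_rpow]
      exact ENNReal.ofReal_le_ofReal (hF z hz' w hw')
    calc ENNReal.ofReal √Mg * edist (F z) (F w)
        ≤ ENNReal.ofReal √Mg * (ENNReal.ofReal C * edist z w ^ (1 / 2 : ℝ)) := by gcongr
      _ = _ := by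
        rw [← mul_assoc]
        simp [ENNReal.ofReal]
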